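/- Let $\lambda,\mu\in\mathbb R$ with $\mu>0$ and $\lambda>-\tfrac{2\mu}{3}$, and put $\alpha=\frac{\mu+\lambda}{2}$, $\beta=\frac{3\mu+\lambda}{2}$, $\alpha^*=\frac{\alpha}{\alpha^2-\beta^2}$, $\beta^*=\frac{\beta}{\alpha^2-\beta^2}$. Let $\partial_{z}=\frac12(\partial_x-i\partial_y)$, $\partial_{\bar z}=\frac12(\partial_x+i\partial_y)$, and $$\mathcal L_{\alpha,\beta}[f]=\alpha\,\partial_{\bar z}\partial_{\bar z}\bar f+\beta\,\partial_{\bar z}\partial_z f,\qquad \mathcal T_\Omega^{\mathcal L}[g](z)=\frac1\pi\int_\Omega\Big[\alpha^*\frac{\xi-z}{\overline{\xi-z}}\,\overline{g(\xi)}-\beta^*\ln|\xi-z|^2\,g(\xi)\Big]dA(\xi),$$ where $dA$ is the area measure. Let $1<d<2$ and $0<\nu<1$ with $\nu>\frac d2$. Let $\Omega\subset\mathbb C$ be a (bounded) Jordan domain whose boundary, the Jordan curve $\gamma$, is $d$-summable, i.e. $\int_0^1 N_\gamma(\tau)\,\tau^{d-1}\,d\tau<\infty$, where $N_\gamma(\tau)$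 is the least number of balls of radius $\tau$ needed to cover $\gamma$. Write $\Omega_+=\Omega$ and $\Omega_-=\mathbb C\setminus(\Omega\cup\gamma)$. Let $\mathbf f=\{f_0,f_1,f_2\}\in \mathrm{Lip}(1+\nu,\gamma)$, i.e. $f_0,f_1,f_2:\gamma\to\mathbb C$ are bounded and there is $c>0$ such that for all $t,\tau\in\gamma$ $$|f_0(t)-f_0(\tau)-(t-\tau)f_1(\tau)-\overline{(t-\tau)}f_2(\tau)|\le c|t-\tau|^{1+\nu},\qquad |f_j(t)-f_j(\tau)|\le c|t-\tau|^{\nu}\quad(j=1,2).$$ A Whitney extension of $\mathbf f$ is a compactly supported function $\tilde f\in C^{1,\nu}(\mathbb R^2)$ with $\tilde f|_\gamma=f_0$, $\partial_z\tilde f|_\gamma=f_1$, $\partial_{\bar z}\tilde f|_\gamma=f_2$, with $\tilde f\in C^\infty(\mathbb R^2\setminus\gamma)$, and such that for some constant $c$ one has $|\partial_z^{j_1}\partial_{\bar z}^{j_2}\tilde f(z)|\le c\,\mathrm{dist}(z,\gamma)^{\nu-1}$ for all $j_1+j_2=2$ and $z\in\mathbb R^2\setminus\gamma$. Then $\mathbf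 f$ has a Whitney extension. Moreover, for every Whitney extension $\tilde f$ of $\mathbf f$, the integral defining $\mathcal T_\Omega^{\mathcal L}[\mathcal L_{\alpha,\beta}\tilde f](z)$ converges absolutely for every $z\in\mathbb C$, and the function $$F(z)=\chi_\Omega(z)\tilde f(z)-\mathcal T_\Omega^{\mathcal L}[\mathcal L_{\alpha,\beta}\tilde f](z)$$ is of class $C^2$ in $\Omega_+\cup\Omega_-$ and solves the jump problem $$\begin{cases}\mathcal L_{\alpha,\beta}F(z)=0, & z\in\Omega_+\cup\Omega_-,\\ F^+(t)-F^-(t)=f_0(t), & t\in\gamma,\\ [\partial_zF]^+(t)-[\partial_zF]^-(t)=f_1(t), & t\in\gamma,\end{cases}$$ where $G^\pm(t)=\lim_{\Omega_\pm\ni z\to t}G(z)$, the existence of these limits for $G=F$ and $G=\partial_zF$ being part of the assertion. -/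

import Mathlib

open MeasureTheory Set Filter Topology
open scoped ComplexConjugate ENNReal ContDiff

noncomputable section

namespace LameNavier

/-- The Wirtinger derivative `∂_z h = (∂_x h - i ∂_y h) / 2`. -/
def dz (h : ℂ → ℂ) (z : ℂ) : ℂ :=
  (1 / 2 : ℂ) * (fderiv ℝ h z 1 - Complex.I * fderiv ℝ h z Complex.I)

/-- The Cauchy-Riemann operator `∂_{z̄} h = (∂_x h + i ∂_y h) / 2`. -/
def dzbar (h : ℂ → ℂ) (z : ℂ) : ℂ :=
  (1 / 2 : ℂ) * (fderiv ℝ h z 1 + Complex.I * fderiv ℝ h z Complex.I)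

/-- `α = (μ + λ) / 2`. -/
def alpha (lam mu : ℝ) : ℝ := (mu + lam) / 2

/-- `β = (3 μ + λ) / 2`. -/
def beta (lam mu : ℝ) : ℝ := (3 * mu + lam) / 2

/-- `α* = α / (α² - β²)`. -/
def alphaStar (lam mu : ℝ) : ℝ := alpha lam mu / (alpha lam mu ^ 2 - beta lam mu ^ 2)

/-- `β* = β / (α² - β²)`. -/
def betaStar (lam mu : ℝ) : ℝ := beta lam mu / (alpha lam mu ^ 2 - beta lam mu ^ 2)

/-- The complex Lamé-Navier operator
`L_{α,β}[f] = α ∂_{z̄} ∂_{z̄} f̄ + β ∂_{z̄} ∂_z f`. -/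
def lameOp (lam mu : ℝ) (f : ℂ → ℂ) (z : ℂ) : ℂ :=
  (alpha lam mu : ℂ) * dzbar (dzbar (fun w => conj (f w))) z
    + (beta lam mu : ℂ) * dzbar (dz f) z

/-- The integrand
`α* (ξ - z) / conj (ξ - z) * conj (g ξ) - β* ln |ξ - z|² * g ξ` of the Teodorescu operator. -/
def teodorescuIntegrand (lam mu : ℝ) (g : ℂ → ℂ) (z ξ : ℂ) : ℂ :=
  (alphaStar lam mu : ℂ) * ((ξ - z) / conj (ξ - z)) * conj (g ξ)
    - (betaStar lam mu : ℂ) * (Real.log (‖ξ - z‖ ^ 2) : ℂ) * g ξ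

/-- The Teodorescu type operator of the Lamé-Navier system over `Ω` (area integral). -/
def teodorescu (lam mu : ℝ) (Ω : Set ℂ) (g : ℂ → ℂ) (z : ℂ) : ℂ :=
  (1 / Real.pi : ℂ) * ∫ ξ in Ω, teodorescuIntegrand lam mu g z ξ

/-- A closed Jordan curve: an injective continuous image of the circle. -/
def IsJordanCurve (γ : Set ℂ) : Prop :=
  ∃ φ : Circle → ℂ, Continuous φ ∧ Function.Injective φ ∧ range φ = γ

/-- `Ω` is a (bounded) Jordan domain with boundary curve `γ`. -/
structure IsJordanDomain (Ω γ : Set ℂ) : Prop where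
  isOpen : IsOpen Ω
  isConnected : IsConnected Ω
  isBounded : Bornology.IsBounded Ω
  frontier_eq : frontier Ω = γ
  isJordanCurve : IsJordanCurve γ

/-- The exterior domain `Ω₋ = ℝ² \ (Ω ∪ γ)`. -/
def exteriorDomain (Ω γ : Set ℂ) : Set ℂ := (Ω ∪ γ)ᶜ

/-- `γ` is `d`-summable: `∫₀¹ N_γ(τ) τ^(d-1) dτ < ∞`, where `N_γ(τ)` is the least number of
balls of radius `τ` that cover `γ`. -/
def IsSummable (d : ℝ) (γ : Set ℂ) : Prop :=
  ∫⁻ τ in Ioc (0 : ℝ) 1,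
    ((Metric.externalCoveringNumber τ.toNNReal γ : ℕ∞) : ℝ≥0∞) * ENNReal.ofReal (τ ^ (d - 1)) < ⊤

/-- `{f₀, f₁, f₂}` (only the values on `γ` matter) is a Whitney jet in `Lip(1 + ν, γ)`. -/
structure IsLipJet (ν : ℝ) (γ : Set ℂ) (f₀ f₁ f₂ : ℂ → ℂ) : Prop where
  bounded : ∃ M : ℝ, ∀ t ∈ γ, ‖f₀ t‖ ≤ M ∧ ‖f₁ t‖ ≤ M ∧ ‖f₂ t‖ ≤ M
  lipschitz : ∃ c : ℝ, 0 < c ∧ ∀ t ∈ γ, ∀ τ ∈ γ,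
    ‖f₀ t - f₀ τ - (t - τ) * f₁ τ - conj (t - τ) * f₂ τ‖ ≤ c * ‖t - τ‖ ^ (1 + ν) ∧
    ‖f₁ t - f₁ τ‖ ≤ c * ‖t - τ‖ ^ ν ∧
    ‖f₂ t - f₂ τ‖ ≤ c * ‖t - τ‖ ^ ν

/-- `F` is a Whitney extension of the jet `{f₀, f₁, f₂}` on `γ`: a compactly supported `C^{1,ν}`
function on the plane, with the values and first derivatives of the jet on `γ`, smooth off `γ`,
with second derivatives `O(dist(z, γ)^(ν-1))`. -/
structure IsWhitneyExtension (ν : ℝ) (γ : Set ℂ) (f₀ f₁ f₂ F : ℂ → ℂ) : Prop where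
  hasCompactSupport : HasCompactSupport F
  contDiff_one : ContDiff ℝ 1 F
  holder : ∃ c : ℝ, ∀ z w : ℂ, ‖fderiv ℝ F z - fderiv ℝ F w‖ ≤ c * ‖z - w‖ ^ ν
  eq_zero : ∀ t ∈ γ, F t = f₀ t
  eq_one : ∀ t ∈ γ, dz F t = f₁ t
  eq_two : ∀ t ∈ γ, dzbar F t = f₂ t
  smooth_off : ContDiffOn ℝ ∞ F γᶜ
  second_bound : ∃ c : ℝ, ∀ j₁ j₂ : ℕ, j₁ + j₂ = 2 → ∀ z ∈ γᶜ,
    ‖(dz^[j₁] (dzbar^[j₂] F)) z‖ ≤ c * Metric.infDist z γ ^ (ν - 1)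

/-- `G` has one-sided limits `G⁺(t)`, `G⁻(t)` from `Ω₊ = Ω` and `Ω₋` at every `t ∈ γ`, and
`G⁺(t) - G⁻(t) = f(t)`. -/
def HasJump (Ω γ : Set ℂ) (G f : ℂ → ℂ) : Prop :=
  ∀ t ∈ γ, ∃ a b : ℂ, Tendsto G (𝓝[Ω] t) (𝓝 a) ∧
    Tendsto G (𝓝[exteriorDomain Ω γ] t) (𝓝 b) ∧ a - b = f t

/-- `F` solves the jump problem: it is a classical solution of `L_{α,β} F = 0` in `Ω₊ ∪ Ω₋`, with
`F⁺ - F⁻ = f₀` and `[∂_z F]⁺ - [∂_z F]⁻ = f₁` on `γ`. -/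
structure SolvesJumpProblem (lam mu : ℝ) (Ω γ : Set ℂ) (f₀ f₁ F : ℂ → ℂ) : Prop where
  contDiffOn : ContDiffOn ℝ 2 F (Ω ∪ exteriorDomain Ω γ)
  lame_eq_zero : ∀ z ∈ Ω ∪ exteriorDomain Ω γ, lameOp lam mu F z = 0
  jump : HasJump Ω γ F f₀
  jump_dz : HasJump Ω γ (dz F) f₁

end LameNavier

end

/-!
Let `g = L f̃`, where `f̃` is a Whitney extension. On `Ω` it is smooth, with
`|g(z)| = O(dist(z, γ)^(ν - 1))`. The `d`-summability of `γ` implies that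
`dist(·, γ)^(d - 2)` is integrable on `Ω` (`lintegral_infDist_rpow_lt_top`), so `g ∈ L^p(Ω)` with
`p = (2 - d) / (1 - ν)`, and the hypothesis `ν > d / 2` is the inequality `p > 2`. Young's
inequality then bounds the Riesz potentials `∫ |z - ξ|^(-1-s) |g(ξ)| dA(ξ)` uniformly in `z` for
some `s > 0` (`IsWhitneyExtension.exists_isRieszDensity`).

This bound is all that is needed for `T g` to be of class `C¹` on the whole plane, with derivatives
obtained under the integral sign (`hasFDerivAt_potential`, applied to the kernels `z / z̄` and
`log |z|²`, whose first derivatives have homogeneity `-1`). Hence neither `T g` nor `∂_z T g` jumps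
across `γ`, and the jumps of `F = χ_Ω f̃ - T g` and `∂_z F` are those of `χ_Ω f̃` and
`χ_Ω ∂_z f̃`, namely `f₀` and `f₁`.

Near a point off `γ` the density `χ_Ω g` is smooth; it is split into a smooth compactly supported
part and a remainder vanishing near the point. Since `∂_z T g` is an
`ℝ`-linear function of the Cauchy transform of `g`, the identity `L T g = g` for the first part is
the Cauchy-Pompeiu formula (`dzbar_potential_inv`), and the second part contributes a smooth
solution of the homogeneous equation. So `L T g` is `g` in `Ω` and `0` outside
(`lameOp_teodorescuPotential`), which gives `L F = 0` off `γ`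
(`IsWhitneyExtension.solvesJumpProblem`).

The Whitney extension (`exists_isWhitneyExtension`) is built from dyadic shells around `γ` rather
than from Whitney cubes. The function `G(w) = P_t(w)`, with `P_t` the first-order Taylor polynomial
of the jet at a measurably chosen, almost nearest point `t = t(w)` of `γ`, is mollified at scale
`2^(-k)` in the shell where `dist(·, γ)` is about `2^(-k)`, and these mollifications are glued by a
partition of unity made of mollified indicators of neighbourhoods of `γ`. Mollification reproduces
affine functions, so near a point `z` at distance `δ` from `t` the result differs from `P_t` by the
mollification of `G - P_t = O(δ^(1 + ν))`, and each derivative costs a factor `1 / δ`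
(`exists_shellSum_bound`).
-/

namespace LameNavier

/-! ### Wirtinger calculus -/

/-- The `ℝ`-linear functional sending a differential `A` to its `∂_z`-component. -/
noncomputable def dzL : (ℂ →L[ℝ] ℂ) →L[ℝ] ℂ :=
  (1 / 2 : ℂ) • (ContinuousLinearMap.apply ℝ ℂ (1 : ℂ)
    - Complex.I • ContinuousLinearMap.apply ℝ ℂ Complex.I)

/-- The `ℝ`-linear functional sending a differential `A` to its `∂_{z̄}`-component. -/
noncomputable def dzbarL : (ℂ →L[ℝ] ℂ) →L[ℝ] ℂ :=
  (1 / 2 : ℂ) • (ContinuousLinearMap.apply ℝ ℂ (1 : ℂ)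
    + Complex.I • ContinuousLinearMap.apply ℝ ℂ Complex.I)

lemma dzL_apply (A : ℂ →L[ℝ] ℂ) : dzL A = (1 / 2 : ℂ) * (A 1 - Complex.I * A Complex.I) := by
  simp [dzL]

lemma dzbarL_apply (A : ℂ →L[ℝ] ℂ) :
    dzbarL A = (1 / 2 : ℂ) * (A 1 + Complex.I * A Complex.I) := by
  simp [dzbarL, mul_add]

lemma dz_eq (h : ℂ → ℂ) (z : ℂ) : dz h z = dzL (fderiv ℝ h z) := (dzL_apply _).symm

lemma dzbar_eq (h : ℂ → ℂ) (z : ℂ) : dzbar h z = dzbarL (fderiv ℝ h z) := (dzbarL_apply _).symm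

lemma apply_eq_re_im (A : ℂ →L[ℝ] ℂ) (v : ℂ) : A v = v.re * A 1 + v.im * A Complex.I := by
  conv_lhs => rw [show v = v.re • (1 : ℂ) + v.im • Complex.I by simp [Complex.re_add_im]]
  rw [map_add, map_smul, map_smul]; simp

/-- A differential is recovered from its Wirtinger components. -/
lemma apply_eq_dzL_dzbarL (A : ℂ →L[ℝ] ℂ) (v : ℂ) : A v = v * dzL A + conj v * dzbarL A := by
  rw [dzL_apply, dzbarL_apply, apply_eq_re_im A v]
  have h1 := Complex.re_add_im v
  have h2 : conj v = v.re - v.im * Complex.I := by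
    apply Complex.ext <;> simp
  conv_rhs => rw [h2]
  conv_rhs => enter [1, 1]; rw [← h1]
  linear_combination ((v.im : ℂ) * A Complex.I) * Complex.I_mul_I

/-- The differential `v ↦ a v + b v̄`, with Wirtinger components `a` and `b`. -/
noncomputable def wirtinger (a b : ℂ) : ℂ →L[ℝ] ℂ :=
  a • ContinuousLinearMap.id ℝ ℂ + b • (Complex.conjCLE : ℂ →L[ℝ] ℂ)

@[simp] lemma wirtinger_apply (a b v : ℂ) : wirtinger a b v = a * v + b * conj v := by
  simp [wirtinger]

lemma dzL_wirtinger (a b : ℂ) : dzL (wirtinger a b) = a := by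
  rw [dzL_apply]; simp
  linear_combination (-(1/2) * a + (1/2) * b) * Complex.I_mul_I

lemma dzbarL_wirtinger (a b : ℂ) : dzbarL (wirtinger a b) = b := by
  rw [dzbarL_apply]; simp
  linear_combination ((1/2) * a - (1/2) * b) * Complex.I_mul_I

lemma norm_wirtinger_le (a b : ℂ) : ‖wirtinger a b‖ ≤ ‖a‖ + ‖b‖ := by
  refine ContinuousLinearMap.opNorm_le_bound _ (by positivity) fun v => ?_
  rw [wirtinger_apply]
  refine (norm_add_le _ _).trans (le_of_eq ?_)
  simp [add_mul]

lemma wirtinger_sub (a b c d : ℂ) : wirtinger a b - wirtinger c d = wirtinger (a - c) (b - d) := by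
  ext v
  simp
  ring

lemma norm_dzL_le (A : ℂ →L[ℝ] ℂ) : ‖dzL A‖ ≤ ‖A‖ := by
  rw [dzL_apply]
  have h1 : ‖A 1‖ ≤ ‖A‖ := by simpa using A.le_opNorm 1
  have h2 : ‖A Complex.I‖ ≤ ‖A‖ := by simpa using A.le_opNorm Complex.I
  have h3 := norm_sub_le (A 1) (Complex.I * A Complex.I)
  simp only [norm_mul, Complex.norm_I, one_mul] at h3 ⊢
  norm_num
  linarith

lemma norm_dzbarL_le (A : ℂ →L[ℝ] ℂ) : ‖dzbarL A‖ ≤ ‖A‖ := by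
  rw [dzbarL_apply]
  have h1 : ‖A 1‖ ≤ ‖A‖ := by simpa using A.le_opNorm 1
  have h2 : ‖A Complex.I‖ ≤ ‖A‖ := by simpa using A.le_opNorm Complex.I
  have h3 := norm_add_le (A 1) (Complex.I * A Complex.I)
  simp only [norm_mul, Complex.norm_I, one_mul] at h3 ⊢
  norm_num
  linarith

section

variable {f g : ℂ → ℂ} {z : ℂ}

lemma dzbar_add (hf : DifferentiableAt ℝ f z) (hg : DifferentiableAt ℝ g z) :
    dzbar (fun w => f w + g w) z = dzbar f z + dzbar g z := by
  simp only [dzbar_eq, fderiv_fun_add hf hg, map_add]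

lemma dz_sub (hf : DifferentiableAt ℝ f z) (hg : DifferentiableAt ℝ g z) :
    dz (fun w => f w - g w) z = dz f z - dz g z := by
  simp only [dz_eq, fderiv_fun_sub hf hg, map_sub]

lemma dzbar_sub (hf : DifferentiableAt ℝ f z) (hg : DifferentiableAt ℝ g z) :
    dzbar (fun w => f w - g w) z = dzbar f z - dzbar g z := by
  simp only [dzbar_eq, fderiv_fun_sub hf hg, map_sub]

lemma dz_const_mul (c : ℂ) (hf : DifferentiableAt ℝ f z) :
    dz (fun w => c * f w) z = c * dz f z := by
  simp only [dz, fderiv_const_mul hf c, smul_apply, smul_eq_mul]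
  ring

lemma dzbar_const_mul (c : ℂ) (hf : DifferentiableAt ℝ f z) :
    dzbar (fun w => c * f w) z = c * dzbar f z := by
  simp only [dzbar, fderiv_const_mul hf c, smul_apply, smul_eq_mul]
  ring

lemma fderiv_conj_comp (f : ℂ → ℂ) (z v : ℂ) :
    fderiv ℝ (fun w => conj (f w)) z v = conj (fderiv ℝ f z v) := by
  have h := Complex.conjCLE.comp_fderiv (f := f) (x := z)
  have h2 : (Complex.conjCLE ∘ f) = fun w => conj (f w) := by ext w; simp
  rw [h2] at h
  rw [h]; simp

lemma dz_conj (f : ℂ → ℂ) (z : ℂ) : dz (fun w => conj (f w)) z = conj (dzbar f z) := by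
  simp only [dz, dzbar, fderiv_conj_comp]
  simp [map_ofNat, sub_eq_add_neg]

lemma dzbar_conj (f : ℂ → ℂ) (z : ℂ) : dzbar (fun w => conj (f w)) z = conj (dz f z) := by
  simp only [dz, dzbar, fderiv_conj_comp]
  simp [map_ofNat, sub_eq_add_neg]

lemma dz_congr (h : f =ᶠ[𝓝 z] g) : dz f z = dz g z := by
  simp only [dz_eq, h.fderiv_eq]

lemma dzbar_congr (h : f =ᶠ[𝓝 z] g) : dzbar f z = dzbar g z := by
  simp only [dzbar_eq, h.fderiv_eq]

lemma eventuallyEq_dz (h : f =ᶠ[𝓝 z] g) : dz f =ᶠ[𝓝 z] dz g := by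
  filter_upwards [h.fderiv (𝕜 := ℝ)] with w hw
  simp only [dz_eq, hw]

lemma contDiffAt_dz {m n : WithTop ℕ∞} (h : ContDiffAt ℝ n f z) (hmn : m + 1 ≤ n) :
    ContDiffAt ℝ m (dz f) z := by
  have : dz f = fun w => dzL (fderiv ℝ f w) := funext fun w => dz_eq f w
  rw [this]
  exact dzL.contDiff.contDiffAt.comp z (h.fderiv_right hmn)

lemma contDiffAt_dzbar {m n : WithTop ℕ∞} (h : ContDiffAt ℝ n f z) (hmn : m + 1 ≤ n) :
    ContDiffAt ℝ m (dzbar f) z := by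
  have : dzbar f = fun w => dzbarL (fderiv ℝ f w) := funext fun w => dzbar_eq f w
  rw [this]
  exact dzbarL.contDiff.contDiffAt.comp z (h.fderiv_right hmn)

lemma dz_dzbar_comm (h : ContDiffAt ℝ 2 f z) : dz (dzbar f) z = dzbar (dz f) z := by
  have hs : IsSymmSndFDerivAt ℝ f z := h.isSymmSndFDerivAt (by simp)
  have hd : DifferentiableAt ℝ (fderiv ℝ f) z :=
    (h.fderiv_right (m := 1) (by norm_num)).differentiableAt (by norm_num)
  have e1 : dzbar f = fun w => dzbarL (fderiv ℝ f w) := funext fun w => dzbar_eq f w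
  have e2 : dz f = fun w => dzL (fderiv ℝ f w) := funext fun w => dz_eq f w
  have f1 : ∀ v, fderiv ℝ (dzbar f) z v = dzbarL (fderiv ℝ (fderiv ℝ f) z v) := fun v => by
    rw [e1, fderiv_fun_comp z dzbarL.differentiableAt hd]; simp
  have f2 : ∀ v, fderiv ℝ (dz f) z v = dzL (fderiv ℝ (fderiv ℝ f) z v) := fun v => by
    rw [e2, fderiv_fun_comp z dzL.differentiableAt hd]; simp
  simp only [dz_eq (dzbar f), dzbar_eq (dz f)]
  rw [dzL_apply, dzbarL_apply, f1, f1, f2, f2]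
  simp only [dzL_apply, dzbarL_apply]
  rw [hs.eq Complex.I 1]
  ring

/-- The Lamé-Navier operator in terms of `∂_z f` alone. -/
lemma lameOp_eq (lam mu : ℝ) (f : ℂ → ℂ) (z : ℂ) :
    lameOp lam mu f z
      = (alpha lam mu : ℂ) * conj (dz (dz f) z) + (beta lam mu : ℂ) * dzbar (dz f) z := by
  have : dzbar (fun w => conj (f w)) = fun w => conj (dz f w) := funext fun w => dzbar_conj f w
  rw [lameOp, this, dzbar_conj]

end

/-! ### Convolution with a smooth kernel -/

/-- The potential `z ↦ ∫ k (z - ξ) h (ξ) dA(ξ)` of the density `h` with kernel `k`. -/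
noncomputable def potential (k h : ℂ → ℂ) (z : ℂ) : ℂ := ∫ ξ, k (z - ξ) * h ξ

lemma potential_comm (k h : ℂ → ℂ) : potential k h = potential h k := by
  ext z
  unfold potential
  rw [← integral_sub_left_eq_self _ volume z]
  simp [mul_comm]

lemma potential_conj (k h : ℂ → ℂ) (z : ℂ) :
    potential (fun x => conj (k x)) (fun x => conj (h x)) z = conj (potential k h z) := by
  unfold potential
  rw [← integral_conj]
  simp

lemma potential_eq_convolution (k h : ℂ → ℂ) :
    potential k h = convolution h k (ContinuousLinearMap.mul ℝ ℂ) volume := by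
  ext z
  simp [potential, convolution, mul_comm]

section

variable {k h : ℂ → ℂ}

lemma integrable_potential (hk : HasCompactSupport k) (hkc : Continuous k)
    (hh : LocallyIntegrable h) (z : ℂ) : Integrable (fun ξ => k (z - ξ) * h ξ) := by
  have := (hk.convolutionExists_right (ContinuousLinearMap.mul ℝ ℂ) hh hkc) z
  simpa [ConvolutionExistsAt, mul_comm] using this

lemma contDiff_potential {n : ℕ∞} (hk : HasCompactSupport k) (hkc : ContDiff ℝ n k)
    (hh : LocallyIntegrable h) : ContDiff ℝ n (potential k h) := by
  rw [potential_eq_convolution]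
  exact hk.contDiff_convolution_right _ hh hkc

lemma fderiv_potential (hk : HasCompactSupport k) (hkc : ContDiff ℝ 1 k)
    (hh : LocallyIntegrable h) (z v : ℂ) :
    fderiv ℝ (potential k h) z v = potential (fun x => fderiv ℝ k x v) h z := by
  rw [potential_eq_convolution,
    (hk.hasFDerivAt_convolution_right (ContinuousLinearMap.mul ℝ ℂ) hh hkc z).fderiv,
    convolution_precompR_apply _ hh (hk.fderiv ℝ) (hkc.continuous_fderiv one_ne_zero),
    potential_eq_convolution]

/-- If a differential is obtained under the integral sign, so are the Wirtinger derivatives. -/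
lemma potential_dz_of_fderiv {u : ℂ → ℂ} {D : ℂ → ℂ →L[ℝ] ℂ} {z : ℂ}
    (hint : ∀ v, Integrable (fun ξ => D (z - ξ) v * h ξ))
    (hu : ∀ v, fderiv ℝ u z v = potential (fun x => D x v) h z) :
    dz u z = potential (fun x => dzL (D x)) h z ∧
      dzbar u z = potential (fun x => dzbarL (D x)) h z := by
  constructor
  · simp only [dz, hu, potential, dzL_apply]
    rw [← integral_const_mul, ← integral_sub (hint 1) ((hint _).const_mul _), ← integral_const_mul]
    congr 1; ext ξ; ring
  · simp only [dzbar, hu, potential, dzbarL_apply]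
    rw [← integral_const_mul, ← integral_add (hint 1) ((hint _).const_mul _), ← integral_const_mul]
    congr 1; ext ξ; ring

lemma dz_potential (hk : HasCompactSupport k) (hkc : ContDiff ℝ 1 k)
    (hh : LocallyIntegrable h) (z : ℂ) :
    dz (potential k h) z = potential (dz k) h z ∧
      dzbar (potential k h) z = potential (dzbar k) h z := by
  have := potential_dz_of_fderiv (D := fderiv ℝ k) (h := h) (z := z) (u := potential k h)
    (fun v => integrable_potential
      ((hk.fderiv ℝ).comp_left (g := fun A : ℂ →L[ℝ] ℂ => A v) (by simp))
      ((hkc.continuous_fderiv one_ne_zero).clm_apply continuous_const) hh z)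
    (fun v => fderiv_potential hk hkc hh z v)
  simpa only [← dz_eq, ← dzbar_eq] using this

end

/-! ### Potentials with weakly singular kernels -/

/-- A kernel of homogeneity `-1`: size `A / ‖x‖`, with the matching Lipschitz bound. -/
structure IsCauchyKernel (A : ℝ) (a : ℂ → ℂ) : Prop where
  measurable : Measurable a
  bound : ∀ x, ‖a x‖ ≤ A / ‖x‖
  lipschitz : ∀ x y, x ≠ 0 → y ≠ 0 → ‖a x - a y‖ ≤ A * ‖x - y‖ / (‖x‖ * ‖y‖)

/-- An integrable density whose Riesz potentials of order `1 - s` are bounded by `M`. -/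
structure IsRieszDensity (s M : ℝ) (h : ℂ → ℂ) : Prop where
  integrable : Integrable h
  integrable_riesz : ∀ z, Integrable (fun ξ => ‖z - ξ‖ ^ (-1 - s) * ‖h ξ‖)
  riesz_le : ∀ z, ∫ ξ, ‖z - ξ‖ ^ (-1 - s) * ‖h ξ‖ ≤ M

/-- Interpolation between the Lipschitz bound of a Cauchy kernel and its size: a factor `d ^ s` is
kept, at the price of singularities of order `1 + s`. -/
lemma div_mul_le_rpow {s d X Y : ℝ} (hs0 : 0 < s) (hs1 : s < 1) (hd : 0 ≤ d) (hX : 0 < X)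
    (hY : 0 < Y) (hdXY : d ≤ X + Y) :
    d / (X * Y) ≤ 2 * d ^ s * (X ^ (-1 - s) + Y ^ (-1 - s)) := by
  wlog hXY : X ≤ Y generalizing X Y
  · have := this hY hX (by linarith) (by linarith)
    rwa [mul_comm X Y, add_comm]
  have h1 : d ≤ d ^ s * (2 * Y ^ (1 - s)) := by
    rcases hd.eq_or_lt with rfl | hd'
    · positivity
    calc d = d ^ s * d ^ (1 - s) := by rw [← Real.rpow_add hd']; simp
      _ ≤ d ^ s * (2 * Y) ^ (1 - s) := by
          gcongr
          linarith
      _ ≤ d ^ s * (2 * Y ^ (1 - s)) := by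
          rw [Real.mul_rpow (by norm_num) hY.le]
          gcongr
          calc (2 : ℝ) ^ (1 - s) ≤ 2 ^ (1 : ℝ) :=
                Real.rpow_le_rpow_of_exponent_le (by norm_num) (by linarith)
            _ = 2 := by simp
  have h2 : Y ^ (1 - s) / (X * Y) ≤ X ^ (-1 - s) := by
    have e1 : Y ^ (1 - s) / (X * Y) = Y ^ (-s) / X := by
      rw [show (1 : ℝ) - s = -s + 1 by ring, Real.rpow_add hY]
      field_simp
      simp
    have e2 : X ^ (-1 - s) = X ^ (-s) / X := by
      rw [show -1 - s = -s - 1 by ring, Real.rpow_sub_one hX.ne']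
    rw [e1, e2]
    exact div_le_div_of_nonneg_right
      (Real.rpow_le_rpow_of_nonpos hX hXY (by linarith : -s ≤ 0)) hX.le
  calc d / (X * Y) ≤ d ^ s * (2 * Y ^ (1 - s)) / (X * Y) := by gcongr
    _ = 2 * d ^ s * (Y ^ (1 - s) / (X * Y)) := by ring
    _ ≤ 2 * d ^ s * (X ^ (-1 - s) + Y ^ (-1 - s)) := by
        gcongr
        exact h2.trans (le_add_of_nonneg_right (by positivity))

lemma inv_le_rpow_add_one {s X : ℝ} (hs0 : 0 < s) (hX : 0 ≤ X) :
    X⁻¹ ≤ X ^ (-1 - s) + 1 := by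
  rcases hX.eq_or_lt with rfl | hX
  · simp; positivity
  rcases le_total X 1 with h | h
  · have : X ^ (-1 : ℝ) ≤ X ^ (-1 - s) :=
      Real.rpow_le_rpow_of_exponent_ge hX h (by linarith)
    rw [Real.rpow_neg_one] at this
    linarith
  · have : X⁻¹ ≤ 1 := inv_le_one_of_one_le₀ h
    have : 0 ≤ X ^ (-1 - s) := by positivity
    linarith

lemma IsCauchyKernel.nonneg {A : ℝ} {a : ℂ → ℂ} (ha : IsCauchyKernel A a) : 0 ≤ A := by
  have := (norm_nonneg _).trans (ha.bound 1)
  simpa using this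

lemma IsCauchyKernel.integrable {A s M : ℝ} {a h : ℂ → ℂ} (ha : IsCauchyKernel A a)
    (hs0 : 0 < s) (hh : IsRieszDensity s M h) (z : ℂ) :
    Integrable (fun ξ => a (z - ξ) * h ξ) := by
  have hA := ha.nonneg
  refine Integrable.mono'
    (((hh.integrable_riesz z).add hh.integrable.norm).const_mul A) ?_ ?_
  · exact (ha.measurable.comp (measurable_const.sub measurable_id)).aestronglyMeasurable.mul
      hh.integrable.aestronglyMeasurable
  · refine Eventually.of_forall fun ξ => ?_
    rw [norm_mul]
    calc ‖a (z - ξ)‖ * ‖h ξ‖ ≤ (A * ‖z - ξ‖⁻¹) * ‖h ξ‖ := by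
          gcongr; exact ha.bound _
      _ ≤ (A * (‖z - ξ‖ ^ (-1 - s) + 1)) * ‖h ξ‖ := by
          gcongr; exact inv_le_rpow_add_one hs0 (norm_nonneg _)
      _ = _ := by simp; ring

lemma ae_sub_ne_zero (z : ℂ) : ∀ᵐ ξ : ℂ, z - ξ ≠ 0 := by
  have : ∀ᵐ ξ : ℂ, ξ ≠ z := by simp [ae_iff, measure_singleton]
  filter_upwards [this] with ξ hξ h
  exact hξ (sub_eq_zero.mp h).symm

/-- The potential of a kernel of homogeneity `-1` is Hölder continuous. -/
lemma IsCauchyKernel.holder {A s M : ℝ} {a h : ℂ → ℂ} (ha : IsCauchyKernel A a)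
    (hs0 : 0 < s) (hs1 : s < 1) (hh : IsRieszDensity s M h) (z w : ℂ) :
    ‖potential a h z - potential a h w‖ ≤ 4 * A * M * ‖z - w‖ ^ s := by
  have hA := ha.nonneg
  unfold potential
  rw [← integral_sub (ha.integrable hs0 hh z) (ha.integrable hs0 hh w)]
  have hI := ((hh.integrable_riesz z).add (hh.integrable_riesz w)).const_mul
    (2 * A * ‖z - w‖ ^ s)
  refine (norm_integral_le_of_norm_le hI ?_).trans ?_
  · filter_upwards [ae_sub_ne_zero z, ae_sub_ne_zero w] with ξ h1 h2
    rw [← sub_mul, norm_mul]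
    have h3 := div_mul_le_rpow (d := ‖z - w‖) hs0 hs1 (norm_nonneg _) (norm_pos_iff.mpr h1)
      (norm_pos_iff.mpr h2)
      (by have := norm_sub_le (z - ξ) (w - ξ); rwa [sub_sub_sub_cancel_right] at this)
    have h4 := ha.lipschitz _ _ h1 h2
    rw [sub_sub_sub_cancel_right, mul_div_assoc] at h4
    calc ‖a (z - ξ) - a (w - ξ)‖ * ‖h ξ‖
        ≤ (A * (2 * ‖z - w‖ ^ s * (‖z - ξ‖ ^ (-1 - s) + ‖w - ξ‖ ^ (-1 - s)))) * ‖h ξ‖ := by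
          gcongr
          exact h4.trans (by gcongr)
      _ = _ := by simp; ring
  · rw [integral_const_mul, integral_add' (hh.integrable_riesz z) (hh.integrable_riesz w)]
    have h1 := hh.riesz_le z
    have h2 := hh.riesz_le w
    calc _ ≤ 2 * A * ‖z - w‖ ^ s * (M + M) := by gcongr
      _ = _ := by ring

lemma IsCauchyKernel.continuous_potential {A s M : ℝ} {a h : ℂ → ℂ} (ha : IsCauchyKernel A a)
    (hs0 : 0 < s) (hs1 : s < 1) (hh : IsRieszDensity s M h) : Continuous (potential a h) := by
  rw [continuous_iff_continuousAt]
  intro z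
  rw [ContinuousAt, tendsto_iff_norm_sub_tendsto_zero]
  refine squeeze_zero (fun _ => norm_nonneg _) (fun w => ha.holder hs0 hs1 hh w z) ?_
  have : Tendsto (fun w : ℂ => 4 * A * M * ‖w - z‖ ^ s) (𝓝 z) (𝓝 (4 * A * M * ‖z - z‖ ^ s)) := by
    refine Tendsto.const_mul _ (Tendsto.rpow_const ?_ (Or.inr hs0.le))
    exact ((continuous_id.sub continuous_const).norm.tendsto z)
  simpa [Real.zero_rpow hs0.ne'] using this

/-- First-order Taylor remainder of a kernel with logarithmic-type singularity at `0`, in the form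
in which it can be integrated against a density with bounded Riesz potentials. -/
lemma norm_kernel_remainder_le {A s : ℝ} {K a b : ℂ → ℂ} (hs0 : 0 < s) (hs1 : s < 1)
    (ha : IsCauchyKernel A a) (hb : IsCauchyKernel A b)
    (hK : ∀ x, x ≠ 0 → HasFDerivAt K (wirtinger (a x) (b x)) x)
    (hK0 : ∀ x, x ≠ 0 → ‖x‖ ≤ 1 → ‖K x‖ ≤ A * ‖x‖ ^ (-(s / 2)))
    {x v : ℂ} (hx : x ≠ 0) (hxv : x + v ≠ 0) (hv : ‖v‖ ≤ 1 / 3) :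
    ‖K (x + v) - K x - wirtinger (a x) (b x) v‖
      ≤ 22 * A * ‖v‖ ^ (1 + s / 2) * (‖x‖ ^ (-1 - s) + ‖x + v‖ ^ (-1 - s)) := by
  have hA := ha.nonneg
  rcases eq_or_ne v 0 with rfl | hv0
  · simp; positivity
  have hvp : 0 < ‖v‖ := norm_pos_iff.mpr hv0
  have hxp : 0 < ‖x‖ := norm_pos_iff.mpr hx
  have hv1 : ‖v‖ ≤ 1 := hv.trans (by norm_num)
  have hvs : ‖v‖ ^ (1 + s) ≤ ‖v‖ ^ (1 + s / 2) :=
    Real.rpow_le_rpow_of_exponent_ge hvp hv1 (by linarith)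
  rcases le_or_gt (2 * ‖v‖) ‖x‖ with hc | hc
  · -- away from the singularity: mean value inequality on the segment `[x, x + v]`
    have hseg : ∀ y ∈ segment ℝ x (x + v), ‖x‖ / 2 ≤ ‖y‖ ∧ ‖y - x‖ ≤ ‖v‖ := by
      intro y hy
      have h1 : ‖y - x‖ ≤ ‖v‖ := by
        have := norm_sub_le_of_mem_segment hy
        simpa using this
      refine ⟨?_, h1⟩
      have := norm_sub_norm_le x y
      rw [norm_sub_rev] at this
      linarith
    have key := (convex_segment x (x + v)).norm_image_sub_le_of_norm_hasFDerivWithin_le'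
      (f := K) (f' := fun y => wirtinger (a y) (b y)) (φ := wirtinger (a x) (b x))
      (C := 4 * A * ‖v‖ / ‖x‖ ^ 2) (x := x) (y := x + v)
      (fun y hy => (hK y (by
        rw [← norm_pos_iff]; linarith [(hseg y hy).1])).hasFDerivWithinAt)
      (fun y hy => by
        obtain ⟨h1, h2⟩ := hseg y hy
        have hy0 : y ≠ 0 := by rw [← norm_pos_iff]; linarith
        rw [wirtinger_sub]
        have e : A * ‖y - x‖ / (‖y‖ * ‖x‖) ≤ 2 * A * ‖v‖ / ‖x‖ ^ 2 := by
          calc A * ‖y - x‖ / (‖y‖ * ‖x‖) ≤ A * ‖v‖ / (‖x‖ / 2 * ‖x‖) := by gcongr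
            _ = _ := by field_simp
        calc _ ≤ ‖a y - a x‖ + ‖b y - b x‖ := norm_wirtinger_le _ _
          _ ≤ 2 * A * ‖v‖ / ‖x‖ ^ 2 + 2 * A * ‖v‖ / ‖x‖ ^ 2 :=
            add_le_add ((ha.lipschitz _ _ hy0 hx).trans e) ((hb.lipschitz _ _ hy0 hx).trans e)
          _ = _ := by ring)
      (left_mem_segment ℝ _ _) (right_mem_segment ℝ _ _)
    rw [add_sub_cancel_left] at key
    have h3 : ‖v‖ * ‖v‖ / ‖x‖ ^ 2 ≤ ‖v‖ ^ (1 + s) * ‖x‖ ^ (-1 - s) := by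
      have e1 : ‖v‖ * ‖v‖ = ‖v‖ ^ (1 + s) * ‖v‖ ^ (1 - s) := by
        rw [← Real.rpow_add hvp, show (1 + s) + (1 - s) = (2 : ℝ) by ring, Real.rpow_two]; ring
      have e2 : ‖x‖ ^ (-1 - s) = ‖x‖ ^ (1 - s) / ‖x‖ ^ 2 := by
        rw [← Real.rpow_two, ← Real.rpow_sub hxp]; congr 1; ring
      rw [e1, e2, mul_div_assoc]
      gcongr
      linarith
    calc _ ≤ 4 * A * ‖v‖ / ‖x‖ ^ 2 * ‖v‖ := key
      _ = 4 * A * (‖v‖ * ‖v‖ / ‖x‖ ^ 2) := by ring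
      _ ≤ 4 * A * (‖v‖ ^ (1 + s / 2) * ‖x‖ ^ (-1 - s)) := by
          gcongr
          exact h3.trans (by gcongr)
      _ ≤ 22 * A * (‖v‖ ^ (1 + s / 2) * (‖x‖ ^ (-1 - s) + ‖x + v‖ ^ (-1 - s))) := by
          gcongr
          · norm_num
          · exact le_add_of_nonneg_right (by positivity)
      _ = _ := by ring
  · -- near the singularity each of the three terms is small by itself
    have hval : ∀ y : ℂ, y ≠ 0 → ‖y‖ ≤ 3 * ‖v‖ →
        ‖K y‖ ≤ 9 * A * ‖v‖ ^ (1 + s / 2) * ‖y‖ ^ (-1 - s) := by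
      intro y hy hyv
      have hyp : 0 < ‖y‖ := norm_pos_iff.mpr hy
      have e1 : ‖y‖ ^ (-(s / 2)) = ‖y‖ ^ (1 + s / 2) * ‖y‖ ^ (-1 - s) := by
        rw [← Real.rpow_add hyp]; congr 1; ring
      calc ‖K y‖ ≤ A * ‖y‖ ^ (-(s / 2)) := hK0 y hy (by linarith)
        _ = A * (‖y‖ ^ (1 + s / 2) * ‖y‖ ^ (-1 - s)) := by rw [e1]
        _ ≤ A * ((9 * ‖v‖ ^ (1 + s / 2)) * ‖y‖ ^ (-1 - s)) := by
            gcongr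
            calc ‖y‖ ^ (1 + s / 2) ≤ (3 * ‖v‖) ^ (1 + s / 2) := by gcongr
              _ = 3 ^ (1 + s / 2) * ‖v‖ ^ (1 + s / 2) :=
                  Real.mul_rpow (by norm_num) (norm_nonneg _)
              _ ≤ 9 * ‖v‖ ^ (1 + s / 2) := by
                  gcongr
                  calc (3 : ℝ) ^ (1 + s / 2) ≤ 3 ^ (2 : ℝ) :=
                        Real.rpow_le_rpow_of_exponent_le (by norm_num) (by linarith)
                    _ = 9 := by norm_num
        _ = _ := by ring
    have h1 := hval (x + v) hxv ((norm_add_le _ _).trans (by linarith))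
    have h2 := hval x hx (by linarith)
    have h3 : ‖wirtinger (a x) (b x) v‖ ≤ 4 * A * ‖v‖ ^ (1 + s / 2) * ‖x‖ ^ (-1 - s) := by
      have e1 : ‖x‖⁻¹ = ‖x‖ ^ s * ‖x‖ ^ (-1 - s) := by
        rw [← Real.rpow_add hxp, ← Real.rpow_neg_one]; congr 1; ring
      have e2 : ‖x‖ ^ s ≤ 2 * ‖v‖ ^ s := by
        calc ‖x‖ ^ s ≤ (2 * ‖v‖) ^ s := by gcongr
          _ = 2 ^ s * ‖v‖ ^ s := Real.mul_rpow (by norm_num) (norm_nonneg _)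
          _ ≤ 2 * ‖v‖ ^ s := by
              gcongr
              calc (2 : ℝ) ^ s ≤ 2 ^ (1 : ℝ) :=
                    Real.rpow_le_rpow_of_exponent_le (by norm_num) hs1.le
                _ = 2 := by simp
      calc _ ≤ ‖wirtinger (a x) (b x)‖ * ‖v‖ := ContinuousLinearMap.le_opNorm _ _
        _ ≤ (A / ‖x‖ + A / ‖x‖) * ‖v‖ := by
            gcongr
            exact (norm_wirtinger_le _ _).trans (add_le_add (ha.bound x) (hb.bound x))
        _ = 2 * A * (‖x‖⁻¹ * ‖v‖) := by ring
        _ ≤ 2 * A * ((2 * ‖v‖ ^ s) * ‖x‖ ^ (-1 - s) * ‖v‖) := by rw [e1]; gcongr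
        _ = 4 * A * ‖v‖ ^ (1 + s) * ‖x‖ ^ (-1 - s) := by
            rw [Real.rpow_add hvp, Real.rpow_one]; ring
        _ ≤ _ := by gcongr
    calc ‖K (x + v) - K x - wirtinger (a x) (b x) v‖
        ≤ ‖K (x + v)‖ + ‖K x‖ + ‖wirtinger (a x) (b x) v‖ :=
          (norm_sub_le _ _).trans (by gcongr; exact norm_sub_le _ _)
      _ ≤ 9 * A * ‖v‖ ^ (1 + s / 2) * ‖x + v‖ ^ (-1 - s)
          + 9 * A * ‖v‖ ^ (1 + s / 2) * ‖x‖ ^ (-1 - s)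
          + 4 * A * ‖v‖ ^ (1 + s / 2) * ‖x‖ ^ (-1 - s) := by gcongr
      _ ≤ _ := by
          have : 0 ≤ A * ‖v‖ ^ (1 + s / 2) * ‖x‖ ^ (-1 - s) := by positivity
          have : 0 ≤ A * ‖v‖ ^ (1 + s / 2) * ‖x + v‖ ^ (-1 - s) := by positivity
          linarith

/-- A potential with a weakly singular kernel may be differentiated under the integral sign. -/
lemma hasFDerivAt_potential {A s M : ℝ} {K a b h : ℂ → ℂ} (hs0 : 0 < s) (hs1 : s < 1)
    (ha : IsCauchyKernel A a) (hb : IsCauchyKernel A b)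
    (hK : ∀ x, x ≠ 0 → HasFDerivAt K (wirtinger (a x) (b x)) x)
    (hK0 : ∀ x, x ≠ 0 → ‖x‖ ≤ 1 → ‖K x‖ ≤ A * ‖x‖ ^ (-(s / 2)))
    (hh : IsRieszDensity s M h) (hKint : ∀ z, Integrable (fun ξ => K (z - ξ) * h ξ)) (z : ℂ) :
    HasFDerivAt (potential K h) (wirtinger (potential a h z) (potential b h z)) z := by
  have hA := ha.nonneg
  rw [hasFDerivAt_iff_isLittleO_nhds_zero]
  have hbig : (fun v : ℂ => potential K h (z + v) - potential K h z
      - wirtinger (potential a h z) (potential b h z) v)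
      =O[𝓝 0] fun v : ℂ => ‖v‖ ^ (1 + s / 2) := by
    -- integrate the kernel remainder against the density: two Riesz potentials, each at most `M`
    refine Asymptotics.IsBigO.of_bound (22 * A * (M + M)) ?_
    filter_upwards [Metric.closedBall_mem_nhds (0 : ℂ) (by norm_num : (0 : ℝ) < 1 / 3)] with v hv
    rw [mem_closedBall_zero_iff] at hv
    have hW : wirtinger (potential a h z) (potential b h z) v
        = ∫ ξ, wirtinger (a (z - ξ)) (b (z - ξ)) v * h ξ := by
      rw [wirtinger_apply, potential, potential, ← integral_mul_const, ← integral_mul_const,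
        ← integral_add ((ha.integrable hs0 hh z).mul_const _)
          ((hb.integrable hs0 hh z).mul_const _)]
      congr 1; ext ξ
      rw [wirtinger_apply]; ring
    have hWint : Integrable fun ξ => wirtinger (a (z - ξ)) (b (z - ξ)) v * h ξ := by
      refine (((ha.integrable hs0 hh z).mul_const v).add
        ((hb.integrable hs0 hh z).mul_const (conj v))).congr (Eventually.of_forall fun ξ => ?_)
      simp; ring
    have hKd : Integrable fun ξ => K (z + v - ξ) * h ξ - K (z - ξ) * h ξ :=
      (hKint (z + v)).sub (hKint z)
    rw [hW, potential, potential, ← integral_sub (hKint _) (hKint _),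
      ← integral_sub hKd hWint]
    have hI := ((hh.integrable_riesz z).add (hh.integrable_riesz (z + v))).const_mul
      (22 * A * ‖v‖ ^ (1 + s / 2))
    refine (norm_integral_le_of_norm_le hI ?_).trans ?_
    · filter_upwards [ae_sub_ne_zero z, ae_sub_ne_zero (z + v)] with ξ h1 h2
      rw [← sub_mul, ← sub_mul, norm_mul]
      have e : z + v - ξ = (z - ξ) + v := by ring
      rw [e] at h2 ⊢
      have := norm_kernel_remainder_le hs0 hs1 ha hb hK hK0 h1 h2 hv
      calc _ ≤ (22 * A * ‖v‖ ^ (1 + s / 2)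
            * (‖z - ξ‖ ^ (-1 - s) + ‖z - ξ + v‖ ^ (-1 - s))) * ‖h ξ‖ := by gcongr
        _ = _ := by simp [e]; ring
    · rw [integral_const_mul, integral_add' (hh.integrable_riesz z) (hh.integrable_riesz (z + v)),
        Real.norm_of_nonneg (by positivity)]
      have h1 := hh.riesz_le z
      have h2 := hh.riesz_le (z + v)
      calc _ ≤ 22 * A * ‖v‖ ^ (1 + s / 2) * (M + M) := by gcongr
        _ = _ := by ring
  refine hbig.trans_isLittleO ?_
  rw [← Asymptotics.isLittleO_norm_right]
  rw [Asymptotics.isLittleO_iff_tendsto (by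
    intro v hv
    rw [norm_eq_zero.mp hv, norm_zero, Real.zero_rpow (by linarith)])]
  have e : (fun v : ℂ => ‖v‖ ^ (1 + s / 2) / ‖v‖) = fun v : ℂ => ‖v‖ ^ (s / 2) := by
    ext v
    rcases eq_or_ne v 0 with rfl | hv
    · simp [Real.zero_rpow (show s / 2 ≠ 0 by linarith)]
    · rw [add_comm, Real.rpow_add_one (norm_ne_zero_iff.mpr hv)]
      field_simp [norm_ne_zero_iff.mpr hv]
  rw [e]
  have := (continuous_norm (E := ℂ)).rpow_const (p := s / 2) (fun _ => Or.inr (by linarith))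
  have := this.tendsto 0
  simpa [Real.zero_rpow (show s / 2 ≠ 0 by linarith)] using this

/-! ### The kernels of the Teodorescu operator -/

section WirtingerRules

variable {f g : ℂ → ℂ} {a b c d x : ℂ}

lemma hasFDerivAt_wirtinger_id : HasFDerivAt (fun w : ℂ => w) (wirtinger 1 0) x := by
  have : wirtinger 1 0 = ContinuousLinearMap.id ℝ ℂ := by ext v; simp
  rw [this]
  exact hasFDerivAt_id x

lemma hasFDerivAt_wirtinger_conj (hf : HasFDerivAt f (wirtinger a b) x) :
    HasFDerivAt (fun w => conj (f w)) (wirtinger (conj b) (conj a)) x := by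
  have h := (Complex.conjCLE : ℂ →L[ℝ] ℂ).hasFDerivAt.comp x hf
  have e : (Complex.conjCLE : ℂ →L[ℝ] ℂ).comp (wirtinger a b) = wirtinger (conj b) (conj a) := by
    ext v; simp; ring
  rw [e] at h
  exact h

lemma hasFDerivAt_wirtinger_mul (hf : HasFDerivAt f (wirtinger a b) x)
    (hg : HasFDerivAt g (wirtinger c d) x) :
    HasFDerivAt (fun w => f w * g w) (wirtinger (f x * c + g x * a) (f x * d + g x * b)) x := by
  have h := hf.mul hg
  have e : f x • wirtinger c d + g x • wirtinger a b
      = wirtinger (f x * c + g x * a) (f x * d + g x * b) := by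
    ext v; simp; ring
  rw [e] at h
  exact h

lemma hasFDerivAt_wirtinger_inv (hx : x ≠ 0) :
    HasFDerivAt (fun w : ℂ => w⁻¹) (wirtinger (-(x ^ 2)⁻¹) 0) x := by
  have h := (hasDerivAt_inv hx).hasFDerivAt.restrictScalars ℝ
  convert! h using 1
  ext v; simp; ring

lemma dz_eq_of_hasFDerivAt (hf : HasFDerivAt f (wirtinger a b) x) : dz f x = a := by
  rw [dz_eq, hf.fderiv, dzL_wirtinger]

lemma dzbar_eq_of_hasFDerivAt (hf : HasFDerivAt f (wirtinger a b) x) : dzbar f x = b := by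
  rw [dzbar_eq, hf.fderiv, dzbarL_wirtinger]

end WirtingerRules

/-- The unimodular kernel `x / x̄`. -/
noncomputable def phaseKernel (x : ℂ) : ℂ := x / conj x

/-- The logarithmic kernel `ln |x|²`. -/
noncomputable def logKernel (x : ℂ) : ℂ := (Real.log (‖x‖ ^ 2) : ℂ)

lemma measurable_conj : Measurable (fun x : ℂ => conj x) := Complex.continuous_conj.measurable

lemma measurable_phaseKernel : Measurable phaseKernel := measurable_id.div measurable_conj

lemma measurable_logKernel : Measurable logKernel :=
  Complex.measurable_ofReal.comp (Real.measurable_log.comp (measurable_norm.pow_const 2))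

lemma hasFDerivAt_phaseKernel {x : ℂ} (hx : x ≠ 0) :
    HasFDerivAt phaseKernel (wirtinger (conj x)⁻¹ (-(x / conj x ^ 2))) x := by
  have h := hasFDerivAt_wirtinger_mul hasFDerivAt_wirtinger_id
    (hasFDerivAt_wirtinger_conj (hasFDerivAt_wirtinger_inv hx))
  convert! h using 1
  · ext w; simp [phaseKernel, div_eq_mul_inv]
  · simp [div_eq_mul_inv]

lemma hasFDerivAt_logKernel {x : ℂ} (hx : x ≠ 0) :
    HasFDerivAt logKernel (wirtinger x⁻¹ (conj x)⁻¹) x := by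
  have h0 : ‖x‖ ^ 2 ≠ 0 := by simpa using hx
  have h := (Complex.ofRealCLM.hasFDerivAt).comp x
    ((hasStrictFDerivAt_norm_sq x).hasFDerivAt.log h0)
  convert! h using 1
  ext v
  have hc : conj x ≠ 0 := by simpa using hx
  have h2 : ((‖x‖ ^ 2 : ℝ) : ℂ) = x * conj x := by
    rw [Complex.mul_conj, Complex.normSq_eq_norm_sq]
  have h3 : ((inner ℝ x v : ℝ) : ℂ) * 2 = v * conj x + conj v * x := by
    rw [Complex.inner]
    apply Complex.ext <;> simp <;> ring
  simp only [wirtinger_apply, ContinuousLinearMap.comp_apply, smul_apply, innerSL_apply_apply,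
    Complex.ofRealCLM_apply, smul_eq_mul, nsmul_eq_mul]
  push_cast at h2 ⊢
  rw [h2]
  field_simp
  linear_combination -h3

lemma contDiffAt_conj (x : ℂ) : ContDiffAt ℝ ∞ (fun w : ℂ => conj w) x :=
  (Complex.conjCLE : ℂ →L[ℝ] ℂ).contDiff.contDiffAt

lemma contDiffAt_phaseKernel {x : ℂ} (hx : x ≠ 0) : ContDiffAt ℝ ∞ phaseKernel x := by
  have h : ContDiffAt ℝ ∞ (fun w : ℂ => w * (conj w)⁻¹) x :=
    contDiffAt_id.mul ((contDiffAt_conj x).inv (by simpa using hx))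
  exact h.congr_of_eventuallyEq (Eventually.of_forall fun w => div_eq_mul_inv _ _)

lemma contDiffAt_logKernel {x : ℂ} (hx : x ≠ 0) : ContDiffAt ℝ ∞ logKernel x := by
  have h1 : ContDiffAt ℝ ∞ (fun w : ℂ => Real.log (‖w‖ ^ 2)) x :=
    ((contDiff_norm_sq ℝ (E := ℂ)).contDiffAt).log (pow_ne_zero 2 (norm_ne_zero_iff.mpr hx))
  exact Complex.ofRealCLM.contDiff.contDiffAt.comp x h1

lemma contDiffAt_inv_real {x : ℂ} (hx : x ≠ 0) : ContDiffAt ℝ ∞ (fun w : ℂ => w⁻¹) x :=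
  contDiffAt_id.inv hx

lemma IsCauchyKernel.mono {A B : ℝ} {a : ℂ → ℂ} (ha : IsCauchyKernel A a) (hAB : A ≤ B) :
    IsCauchyKernel B a where
  measurable := ha.measurable
  bound x := (ha.bound x).trans (by gcongr)
  lipschitz x y hx hy := (ha.lipschitz x y hx hy).trans (by gcongr)

lemma isCauchyKernel_inv : IsCauchyKernel 1 (fun x : ℂ => x⁻¹) where
  measurable := measurable_inv
  bound x := by simp
  lipschitz x y hx hy := by
    rw [inv_sub_inv hx hy, norm_div, norm_mul, one_mul, norm_sub_rev]

lemma isCauchyKernel_conj_inv : IsCauchyKernel 1 (fun x : ℂ => (conj x)⁻¹) where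
  measurable := measurable_conj.inv
  bound x := by simp
  lipschitz x y hx hy := by
    have := isCauchyKernel_inv.lipschitz x y hx hy
    rwa [← Complex.norm_conj, map_sub, map_inv₀, map_inv₀] at this

lemma isCauchyKernel_phase : IsCauchyKernel 3 (fun x : ℂ => -(x / conj x ^ 2)) where
  measurable := (measurable_id.div (measurable_conj.pow_const 2)).neg
  bound x := by
    rcases eq_or_ne x 0 with rfl | hx
    · simp
    · have : 0 < ‖x‖ := norm_pos_iff.mpr hx
      rw [norm_neg, norm_div, norm_pow, Complex.norm_conj, div_le_div_iff₀ (by positivity) this]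
      nlinarith
  lipschitz x y hx hy := by
    have hx' : conj x ≠ 0 := by simpa using hx
    have hy' : conj y ≠ 0 := by simpa using hy
    have hxp : 0 < ‖x‖ := norm_pos_iff.mpr hx
    have hyp : 0 < ‖y‖ := norm_pos_iff.mpr hy
    have e : -(x / conj x ^ 2) - -(y / conj y ^ 2)
        = ((x * conj y) * conj (x - y) - conj x * ((x - y) * conj y + y * conj (y - x)))
          / ((conj x) ^ 2 * (conj y) ^ 2) := by
      rw [map_sub, map_sub]
      field_simp
      ring
    rw [e, norm_div, norm_mul, norm_pow, norm_pow, Complex.norm_conj, Complex.norm_conj,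
      div_le_div_iff₀ (by positivity) (by positivity)]
    have h1 : ‖(x * conj y) * conj (x - y) - conj x * ((x - y) * conj y + y * conj (y - x))‖
        ≤ 3 * ‖x - y‖ * (‖x‖ * ‖y‖) := by
      refine (norm_sub_le _ _).trans ?_
      have h2 : ‖(x - y) * conj y + y * conj (y - x)‖ ≤ 2 * ‖x - y‖ * ‖y‖ := by
        refine (norm_add_le _ _).trans (le_of_eq ?_)
        rw [norm_mul, norm_mul, Complex.norm_conj, Complex.norm_conj, norm_sub_rev y x]
        ring
      simp only [norm_mul, Complex.norm_conj]
      calc _ ≤ ‖x‖ * ‖y‖ * ‖x - y‖ + ‖x‖ * (2 * ‖x - y‖ * ‖y‖) := by gcongr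
        _ = _ := by ring
    calc _ ≤ 3 * ‖x - y‖ * (‖x‖ * ‖y‖) * (‖x‖ * ‖y‖) := by gcongr
      _ = _ := by ring

/-! ### The Cauchy-Pompeiu formula -/

/-- The radial part of the area integral in the Cauchy-Pompeiu formula integrates to the value at
the centre. -/
lemma integral_polar_radial {φ : ℂ → ℂ} (hφ : ContDiff ℝ 1 φ) (hc : HasCompactSupport φ)
    (z e : ℂ) (he : ‖e‖ = 1) :
    ∫ r in Ioi (0 : ℝ), fderiv ℝ φ (z - r * e) e = φ z := by
  set u : ℝ → ℂ := fun r => φ (z - r * e) with hu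
  have hd : ∀ r : ℝ, HasDerivAt u (-(fderiv ℝ φ (z - r * e) e)) r := by
    intro r
    have h1 : HasDerivAt (fun r : ℝ => z - r * e) (-e) r := by
      have := ((hasDerivAt_id r).ofReal_comp.mul_const e).const_sub z
      simpa using this
    have := ((hφ.differentiable one_ne_zero) (z - r * e)).hasFDerivAt.comp_hasDerivAt r h1
    rw [map_neg] at this
    exact this
  have hderiv : deriv u = fun r : ℝ => -(fderiv ℝ φ (z - r * e) e) := funext fun r => (hd r).deriv
  have huC : ContDiff ℝ 1 u := by
    refine hφ.comp (contDiff_const.sub (Complex.ofRealCLM.contDiff.mul contDiff_const))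
  have huc : HasCompactSupport u := by
    obtain ⟨R, hR⟩ := hc.isCompact.isBounded.subset_closedBall 0
    refine HasCompactSupport.intro (isCompact_closedBall (0 : ℝ) (R + ‖z‖)) fun r hr => ?_
    by_contra h
    have h2 : z - r * e ∈ Metric.closedBall (0 : ℂ) R := hR (subset_tsupport _ h)
    apply hr
    rw [mem_closedBall_zero_iff] at h2 ⊢
    have h3 := norm_sub_norm_le (r * e) z
    rw [norm_sub_rev, norm_mul, he, mul_one, Complex.norm_real] at h3
    linarith
  have h := huc.integral_Ioi_deriv_eq huC 0
  rw [hderiv, integral_neg, neg_inj] at h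
  simpa [hu] using h

/-- The angular part of the area integral in the Cauchy-Pompeiu formula is an integral of a
derivative over full circles, so it vanishes. -/
lemma integral_polar_angular {φ : ℂ → ℂ} (hφ : ContDiff ℝ 1 φ) (z : ℂ) {r : ℝ} (hr : 0 < r) :
    ∫ θ in Ioo (-Real.pi) Real.pi, fderiv ℝ φ (z - r * Complex.exp (θ * Complex.I))
      (Complex.I * Complex.exp (θ * Complex.I)) = 0 := by
  have hd : ∀ θ : ℝ, HasDerivAt (fun θ : ℝ => φ (z - r * Complex.exp (θ * Complex.I)))
      ((-(r : ℝ)) • (fderiv ℝ φ (z - r * Complex.exp (θ * Complex.I))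
        (Complex.I * Complex.exp (θ * Complex.I)))) θ := by
    intro θ
    have h0 : HasDerivAt (fun θ : ℝ => Complex.exp (θ * Complex.I))
        (Complex.I * Complex.exp (θ * Complex.I)) θ := by
      have := ((hasDerivAt_id θ).ofReal_comp.mul_const Complex.I).cexp
      simpa [mul_comm] using this
    have h1 := (h0.const_mul (r : ℂ)).const_sub z
    have := ((hφ.differentiable one_ne_zero) _).hasFDerivAt.comp_hasDerivAt θ h1
    convert! this using 1
    rw [← map_smul]; simp
  have hcont : Continuous fun θ : ℝ => (fderiv ℝ φ (z - r * Complex.exp (θ * Complex.I))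
        (Complex.I * Complex.exp (θ * Complex.I))) := by
    have := hφ.continuous_fderiv one_ne_zero
    exact (this.comp (by fun_prop)).clm_apply (by fun_prop)
  have h := intervalIntegral.integral_eq_sub_of_hasDerivAt (a := -Real.pi) (b := Real.pi)
    (fun θ _ => hd θ) (Continuous.intervalIntegrable (by fun_prop) _ _)
  rw [intervalIntegral.integral_smul] at h
  have e1 : Complex.exp ((Real.pi : ℝ) * Complex.I) = -1 := Complex.exp_pi_mul_I
  have e2 : Complex.exp (((-Real.pi : ℝ) : ℂ) * Complex.I) = -1 := by
    rw [Complex.ofReal_neg, neg_mul, Complex.exp_neg, e1]; norm_num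
  rw [e1, e2, sub_self, smul_eq_zero] at h
  have := h.resolve_left (by linarith)
  rwa [intervalIntegral.integral_of_le (by linarith [Real.pi_pos]),
    integral_Ioc_eq_integral_Ioo] at this

lemma integrableOn_polar {F : ℝ × ℝ → ℂ} (hF : Continuous F) {R : ℝ}
    (h0 : ∀ p : ℝ × ℝ, R < p.1 → F p = 0) :
    IntegrableOn F (Ioi (0 : ℝ) ×ˢ Ioo (-Real.pi) Real.pi) := by
  have h1 : IntegrableOn F (Icc 0 R ×ˢ Icc (-Real.pi) Real.pi) :=
    hF.continuousOn.integrableOn_compact (isCompact_Icc.prod isCompact_Icc)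
  refine h1.of_forall_sdiff_eq_zero (measurableSet_Ioi.prod measurableSet_Ioo) ?_
  rintro ⟨r, θ⟩ ⟨⟨hr, hθ⟩, hn⟩
  apply h0
  by_contra hle
  exact hn ⟨⟨le_of_lt hr, not_lt.mp hle⟩, ⟨hθ.1.le, hθ.2.le⟩⟩

/-- The Cauchy transform is `π` times a fundamental solution operator of `∂_{z̄}`. -/
lemma dzbar_potential_inv {φ : ℂ → ℂ} (hφ : ContDiff ℝ 1 φ) (hc : HasCompactSupport φ) (z : ℂ) :
    dzbar (potential (fun x => x⁻¹) φ) z = Real.pi * φ z := by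
  have hloc : LocallyIntegrable (fun x : ℂ => x⁻¹) :=
    locallyIntegrable_of_norm_le_rpow (C := 1) (α := 1) (by simp [Complex.finrank_real_complex])
      (by simp [Complex.finrank_real_complex])
      (Eventually.of_forall fun x => by simp [Real.rpow_neg_one])
      measurable_inv.aestronglyMeasurable
  rw [potential_comm, (dz_potential hc hφ hloc z).2, potential,
    ← Complex.integral_comp_polarCoord_symm]
  set E : ℝ → ℂ := fun θ => Complex.exp (θ * Complex.I) with hE
  have hE1 : ∀ θ, ‖E θ‖ = 1 := fun θ => Complex.norm_exp_ofReal_mul_I θ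
  set F₁ : ℝ × ℝ → ℂ := fun p => fderiv ℝ φ (z - p.1 * E p.2) (E p.2) with hF₁
  set F₂ : ℝ × ℝ → ℂ := fun p => fderiv ℝ φ (z - p.1 * E p.2) (Complex.I * E p.2) with hF₂
  have hEc : Continuous E := by fun_prop
  have hfd := hφ.continuous_fderiv one_ne_zero
  have hF₁c : Continuous F₁ := (hfd.comp (by fun_prop)).clm_apply (by fun_prop)
  have hF₂c : Continuous F₂ := (hfd.comp (by fun_prop)).clm_apply (by fun_prop)
  obtain ⟨R, hR⟩ := (hc.fderiv ℝ).isCompact.isBounded.subset_closedBall 0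
  have hzero : ∀ p : ℝ × ℝ, max (R + ‖z‖) 0 < p.1 → fderiv ℝ φ (z - p.1 * E p.2) = 0 := by
    intro p hp
    by_contra h
    have h2 : z - p.1 * E p.2 ∈ Metric.closedBall (0 : ℂ) R := hR (subset_tsupport _ h)
    rw [mem_closedBall_zero_iff] at h2
    have h3 := norm_sub_norm_le (p.1 * E p.2) z
    rw [norm_sub_rev, norm_mul, hE1, mul_one, Complex.norm_real] at h3
    have h4 := le_abs_self p.1
    rw [← Real.norm_eq_abs] at h4
    have := le_max_left (R + ‖z‖) 0
    linarith
  have hI₁ := integrableOn_polar (R := max (R + ‖z‖) 0) hF₁c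
    (fun p hp => by simp only [hF₁, hzero p hp]; simp)
  have hI₂ := integrableOn_polar (R := max (R + ‖z‖) 0) hF₂c
    (fun p hp => by simp only [hF₂, hzero p hp]; simp)
  -- in polar coordinates the Jacobian `r` cancels `|w|⁻¹`, and `∂_{z̄} φ / w` becomes half the sum
  -- of the directional derivative `F₁` along `e^{iθ}` and `i` times the one, `F₂`, along `i e^{iθ}`
  have hcongr : ∫ p in polarCoord.target, p.1 • (dzbar φ (z - Complex.polarCoord.symm p)
      * (Complex.polarCoord.symm p)⁻¹)
      = ∫ p in Ioi (0 : ℝ) ×ˢ Ioo (-Real.pi) Real.pi,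
        ((1 / 2 : ℂ) * F₁ p + (Complex.I / 2) * F₂ p) := by
    refine setIntegral_congr_fun (measurableSet_Ioi.prod measurableSet_Ioo) ?_
    rintro ⟨r, θ⟩ ⟨hr, -⟩
    have hr0 : (r : ℂ) ≠ 0 := by exact_mod_cast (ne_of_gt hr)
    have hs : Complex.polarCoord.symm (r, θ) = r * E θ := by
      rw [Complex.polarCoord_symm_apply, hE]
      simp only [Complex.exp_mul_I, Complex.ofReal_cos, Complex.ofReal_sin]
    have hE0 : E θ ≠ 0 := by rw [← norm_ne_zero_iff, hE1]; exact one_ne_zero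
    have hEE : E θ * conj (E θ) = 1 := by
      rw [Complex.mul_conj, Complex.normSq_eq_norm_sq, hE1]; simp
    have hEi : (E θ)⁻¹ = conj (E θ) := inv_eq_of_mul_eq_one_right hEE
    simp only [hF₁, hF₂, hs, apply_eq_dzL_dzbarL (fderiv ℝ φ (z - r * E θ)) (E θ),
      apply_eq_dzL_dzbarL (fderiv ℝ φ (z - r * E θ)) (Complex.I * E θ), ← dzbar_eq, ← dz_eq,
      map_mul, Complex.conj_I, Complex.real_smul, mul_inv, hEi]
    field_simp
    linear_combination (dzbar φ (z - r * E θ) * conj (E θ) - E θ * dz φ (z - r * E θ))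
      * Complex.I_mul_I
  rw [hcongr, integral_add (hI₁.const_mul _) (hI₂.const_mul _), integral_const_mul,
    integral_const_mul]
  have hJ₁ : ∫ p in Ioi (0 : ℝ) ×ˢ Ioo (-Real.pi) Real.pi, F₁ p = 2 * Real.pi * φ z := by
    rw [Measure.volume_eq_prod, ← setIntegral_prod_swap,
      setIntegral_prod (fun p : ℝ × ℝ => F₁ p.swap) hI₁.swap]
    have : ∀ θ : ℝ, ∫ r in Ioi (0 : ℝ), F₁ (r, θ) = φ z := fun θ =>
      integral_polar_radial hφ hc z (E θ) (hE1 θ)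
    simp only [Prod.swap_prod_mk, this, setIntegral_const, Measure.real, Real.volume_Ioo]
    rw [ENNReal.toReal_ofReal (by linarith [Real.pi_pos]), Complex.real_smul]
    push_cast
    ring
  have hJ₂ : ∫ p in Ioi (0 : ℝ) ×ˢ Ioo (-Real.pi) Real.pi, F₂ p = 0 := by
    rw [Measure.volume_eq_prod, setIntegral_prod _ hI₂]
    exact setIntegral_eq_zero_of_forall_eq_zero fun r hr => integral_polar_angular hφ z hr
  rw [hJ₁, hJ₂]
  ring

/-! ### Potentials near points where the density is smooth -/

/-- A measurable kernel, smooth off the origin, with at most the size `‖x‖⁻¹ + ‖x‖`. -/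
structure IsTameKernel (K : ℂ → ℂ) : Prop where
  measurable : Measurable K
  contDiffAt : ∀ x, x ≠ 0 → ContDiffAt ℝ ∞ K x
  bound : ∃ C, 0 ≤ C ∧ ∀ x, ‖K x‖ ≤ C * (‖x‖⁻¹ + ‖x‖)

lemma isTameKernel_inv : IsTameKernel (fun x : ℂ => x⁻¹) where
  measurable := measurable_inv
  contDiffAt _ hx := contDiffAt_inv_real hx
  bound := ⟨1, zero_le_one, fun x => by simp⟩

lemma norm_phaseKernel_le (x : ℂ) : ‖phaseKernel x‖ ≤ 1 := by
  rw [phaseKernel, norm_div, Complex.norm_conj]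
  exact div_self_le_one _

lemma isTameKernel_phase : IsTameKernel phaseKernel where
  measurable := measurable_phaseKernel
  contDiffAt _ hx := contDiffAt_phaseKernel hx
  bound := by
    refine ⟨1, zero_le_one, fun x => ?_⟩
    rcases eq_or_ne x 0 with rfl | hx
    · simp [phaseKernel]
    · have h0 : 0 < ‖x‖ := norm_pos_iff.mpr hx
      refine (norm_phaseKernel_le x).trans ?_
      rcases le_total ‖x‖ 1 with h | h
      · have := (one_le_inv₀ h0).mpr h
        linarith
      · have : 0 ≤ ‖x‖⁻¹ := by positivity
        linarith

lemma norm_logKernel (x : ℂ) : ‖logKernel x‖ = 2 * |Real.log ‖x‖| := by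
  rw [logKernel, Complex.norm_real, Real.log_pow, Real.norm_eq_abs, abs_mul]
  simp

lemma isTameKernel_log : IsTameKernel logKernel where
  measurable := measurable_logKernel
  contDiffAt _ hx := contDiffAt_logKernel hx
  bound := by
    refine ⟨2, by norm_num, fun x => ?_⟩
    rw [norm_logKernel]
    gcongr
    have h1 := Real.log_le_self (norm_nonneg x)
    have h2 := Real.log_le_self (inv_nonneg.mpr (norm_nonneg x))
    rw [Real.log_inv] at h2
    have : 0 ≤ ‖x‖⁻¹ := by positivity
    rw [abs_le]
    constructor <;> linarith [norm_nonneg x]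

lemma locallyIntegrable_norm_inv : LocallyIntegrable (fun x : ℂ => ‖x‖⁻¹) :=
  locallyIntegrable_of_norm_le_rpow (C := 1) (α := 1) (by simp [Complex.finrank_real_complex])
    (by simp [Complex.finrank_real_complex])
    (Eventually.of_forall fun x => by simp [Real.rpow_neg_one])
    measurable_norm.inv.aestronglyMeasurable

lemma IsTameKernel.locallyIntegrable {K : ℂ → ℂ} (hK : IsTameKernel K) : LocallyIntegrable K := by
  obtain ⟨C, -, hC⟩ := hK.bound
  refine ((locallyIntegrable_norm_inv.add continuous_norm.locallyIntegrable).smul C).mono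
    hK.measurable.aestronglyMeasurable (Eventually.of_forall fun x => ?_)
  refine (hC x).trans (le_trans (le_of_eq ?_) (le_abs_self _))
  simp

lemma IsTameKernel.integrable {K : ℂ → ℂ} (hK : IsTameKernel K) {s M R : ℝ} {h : ℂ → ℂ}
    (hs0 : 0 < s) (hh : IsRieszDensity s M h) (hR : ∀ ξ, R < ‖ξ‖ → h ξ = 0) (z : ℂ) :
    Integrable (fun ξ => K (z - ξ) * h ξ) := by
  obtain ⟨C, hC0, hC⟩ := hK.bound
  refine Integrable.mono'
    (((hh.integrable_riesz z).add (hh.integrable.norm.const_mul (1 + (‖z‖ + R)))).const_mul C)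
    ?_ ?_
  · exact (hK.measurable.comp (measurable_const.sub measurable_id)).aestronglyMeasurable.mul
      hh.integrable.aestronglyMeasurable
  · refine Eventually.of_forall fun ξ => ?_
    rw [norm_mul]
    rcases lt_or_ge R ‖ξ‖ with hξ | hξ
    · simp [hR ξ hξ]
    calc ‖K (z - ξ)‖ * ‖h ξ‖ ≤ (C * (‖z - ξ‖⁻¹ + ‖z - ξ‖)) * ‖h ξ‖ := by
          gcongr; exact hC _
      _ ≤ (C * ((‖z - ξ‖ ^ (-1 - s) + 1) + (‖z‖ + R))) * ‖h ξ‖ := by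
          gcongr
          · exact inv_le_rpow_add_one hs0 (norm_nonneg _)
          · exact (norm_sub_le _ _).trans (by gcongr)
      _ = _ := by simp; ring

/-- Away from the support of the density, a potential agrees with one whose kernel is smooth and
compactly supported. -/
lemma exists_smooth_kernel {K h : ℂ → ℂ} (hK : ∀ x, x ≠ 0 → ContDiffAt ℝ ∞ K x)
    {R r : ℝ} (hr : 0 < r) (hR : ∀ ξ, R < ‖ξ‖ → h ξ = 0) {z₀ : ℂ}
    (h0 : ∀ ξ ∈ Metric.ball z₀ (2 * r), h ξ = 0) :
    ∃ k : ℂ → ℂ, ContDiff ℝ ∞ k ∧ HasCompactSupport k ∧ potential K h =ᶠ[𝓝 z₀] potential k h ∧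
      ∀ ξ, h ξ ≠ 0 → k =ᶠ[𝓝 (z₀ - ξ)] K := by
  set B := |R| + ‖z₀‖ + r with hB
  have hBp : 0 < B := by positivity
  let χ₁ : ContDiffBump (0 : ℂ) := ⟨r / 4, r / 2, by positivity, by linarith⟩
  let χ₂ : ContDiffBump (0 : ℂ) := ⟨B + 1, B + 2, by positivity, by linarith⟩
  let k : ℂ → ℂ := fun x => (((1 - χ₁ x) * χ₂ x : ℝ) : ℂ) * K x
  have hkK : ∀ x, r / 2 ≤ ‖x‖ → ‖x‖ ≤ B + 1 → k x = K x := by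
    intro x h1 h2
    have e1 : χ₁ x = 0 := χ₁.zero_of_le_dist (by simpa using h1)
    have e2 : χ₂ x = 1 := χ₂.one_of_mem_closedBall (by simpa using h2)
    simp [k, e1, e2]
  have hfar : ∀ ξ, h ξ ≠ 0 → ∀ z ∈ Metric.ball z₀ r, r < ‖z - ξ‖ ∧ ‖z - ξ‖ < B + 1 := by
    intro ξ hξ z hz
    have h1 : ‖ξ‖ ≤ R := not_lt.mp fun hlt => hξ (hR ξ hlt)
    have h2 : 2 * r ≤ ‖ξ - z₀‖ := by
      by_contra hlt
      exact hξ (h0 ξ (by simpa [dist_eq_norm] using hlt))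
    rw [mem_ball_iff_norm] at hz
    constructor
    · have := norm_sub_le_norm_sub_add_norm_sub ξ z z₀
      rw [norm_sub_rev ξ z] at this
      linarith
    · have e : z - ξ = (z - z₀) + z₀ - ξ := by ring
      have h3 : ‖z - ξ‖ ≤ ‖z - z₀‖ + ‖z₀‖ + ‖ξ‖ := by
        rw [e]; exact (norm_sub_le _ _).trans (by gcongr; exact norm_add_le _ _)
      have := le_abs_self R
      linarith
  refine ⟨k, ?_, ?_, ?_, ?_⟩
  · rw [contDiff_iff_contDiffAt]
    intro x
    rcases eq_or_ne x 0 with rfl | hx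
    · have : k =ᶠ[𝓝 0] fun _ => 0 := by
        filter_upwards [Metric.ball_mem_nhds (0 : ℂ) (show 0 < r / 4 by positivity)] with y hy
        have : χ₁ y = 1 := χ₁.one_of_mem_closedBall (Metric.ball_subset_closedBall hy)
        simp [k, this]
      exact contDiffAt_const.congr_of_eventuallyEq this
    · have h1 : ContDiffAt ℝ ∞ (fun x => (1 - χ₁ x) * χ₂ x) x :=
        (contDiffAt_const.sub χ₁.contDiffAt).mul χ₂.contDiffAt
      exact (Complex.ofRealCLM.contDiff.contDiffAt.comp x h1).mul (hK x hx)
  · refine HasCompactSupport.intro (isCompact_closedBall (0 : ℂ) (B + 2)) fun x hx => ?_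
    have : χ₂ x = 0 := χ₂.zero_of_le_dist (by
      rw [mem_closedBall_zero_iff, not_le] at hx
      simpa using hx.le)
    simp [k, this]
  · filter_upwards [Metric.ball_mem_nhds z₀ hr] with z hz
    unfold potential
    congr 1; ext ξ
    rcases eq_or_ne (h ξ) 0 with hξ | hξ
    · simp [hξ]
    · obtain ⟨h1, h2⟩ := hfar ξ hξ z hz
      rw [hkK _ (by linarith) h2.le]
  · intro ξ hξ
    obtain ⟨h1, h2⟩ := hfar ξ hξ z₀ (Metric.mem_ball_self hr)
    filter_upwards [(isOpen_Ioo.preimage continuous_norm).mem_nhds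
      (show z₀ - ξ ∈ norm ⁻¹' Ioo r (B + 1) from ⟨h1, h2⟩)] with x hx
    exact hkK x (by linarith [hx.1]) hx.2.le

section Local

variable {s M R : ℝ} {g φ : ℂ → ℂ} {z₀ : ℂ}

/-- If the density agrees near `z₀` with a smooth compactly supported `φ`, its potential is near
`z₀` the sum of the potential of `φ`, where the singular kernel meets a smooth density, and of a
potential whose kernel is smooth, because the remaining density vanishes near `z₀`. -/
lemma exists_potential_split {K : ℂ → ℂ} (hK : IsTameKernel K) (hs0 : 0 < s)
    (hg : IsRieszDensity s M g) (hR : ∀ ξ, R < ‖ξ‖ → g ξ = 0)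
    (hφ : ContDiff ℝ ∞ φ) (hc : HasCompactSupport φ) (hgφ : g =ᶠ[𝓝 z₀] φ) :
    ∃ k : ℂ → ℂ, ContDiff ℝ ∞ k ∧ HasCompactSupport k ∧
      (potential K g =ᶠ[𝓝 z₀] fun z => potential K φ z + potential k (g - φ) z) ∧
      ∀ ξ, (g - φ) ξ ≠ 0 → k =ᶠ[𝓝 (z₀ - ξ)] K := by
  obtain ⟨r, hr, hball⟩ := Metric.eventually_nhds_iff_ball.mp hgφ
  obtain ⟨R', hR'⟩ := hc.isCompact.isBounded.subset_closedBall 0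
  have hzero : ∀ ξ, max R R' < ‖ξ‖ → (g - φ) ξ = 0 := by
    intro ξ hξ
    have h1 : φ ξ = 0 := by
      by_contra hne
      have := hR' (subset_tsupport _ hne)
      rw [mem_closedBall_zero_iff] at this
      exact absurd (lt_of_le_of_lt (le_max_right R R') hξ) (not_lt.mpr this)
    simp [h1, hR ξ (lt_of_le_of_lt (le_max_left R R') hξ)]
  obtain ⟨k, hk1, hk2, hk3, hk4⟩ := exists_smooth_kernel (K := K) (h := g - φ) hK.contDiffAt
    (half_pos hr) hzero (z₀ := z₀) (fun ξ hξ => by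
      have := hball ξ (by convert! hξ using 2; ring)
      simp [this])
  refine ⟨k, hk1, hk2, ?_, hk4⟩
  filter_upwards [hk3] with z hz
  have i1 := hK.integrable hs0 hg hR z
  have i2 : Integrable fun ξ => K (z - ξ) * φ ξ := by
    have := integrable_potential hc hφ.continuous hK.locallyIntegrable z
    have := this.comp_sub_left z
    simpa [mul_comm] using this
  rw [← hz, potential, potential, potential]
  simp only [Pi.sub_apply, mul_sub]
  rw [integral_sub i1 i2]
  ring

lemma contDiffAt_potential {K : ℂ → ℂ} (hK : IsTameKernel K) (hs0 : 0 < s)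
    (hg : IsRieszDensity s M g) (hR : ∀ ξ, R < ‖ξ‖ → g ξ = 0)
    (hφ : ContDiff ℝ ∞ φ) (hc : HasCompactSupport φ) (hgφ : g =ᶠ[𝓝 z₀] φ) :
    ContDiffAt ℝ ∞ (potential K g) z₀ := by
  obtain ⟨k, hk1, hk2, hk3, -⟩ := exists_potential_split hK hs0 hg hR hφ hc hgφ
  refine ContDiffAt.congr_of_eventuallyEq ?_ hk3
  refine ContDiffAt.add ?_ ?_
  · rw [potential_comm]
    exact (contDiff_potential (n := ⊤) hc hφ hK.locallyIntegrable).contDiffAt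
  · exact (contDiff_potential (n := ⊤) hk2 hk1
      (hg.integrable.locallyIntegrable.sub hφ.continuous.locallyIntegrable)).contDiffAt

/-- Where the density `g` is smooth, its Cauchy transform solves `∂_{z̄} u = π g`. -/
lemma dzbar_cauchyTransform (hs0 : 0 < s)
    (hg : IsRieszDensity s M g) (hR : ∀ ξ, R < ‖ξ‖ → g ξ = 0)
    (hφ : ContDiff ℝ ∞ φ) (hc : HasCompactSupport φ) (hgφ : g =ᶠ[𝓝 z₀] φ) :
    dzbar (potential (fun x => x⁻¹) g) z₀ = Real.pi * g z₀ := by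
  obtain ⟨k, hk1, hk2, hk3, hk4⟩ := exists_potential_split isTameKernel_inv hs0 hg hR hφ hc hgφ
  have hloc : LocallyIntegrable (g - φ) :=
    hg.integrable.locallyIntegrable.sub hφ.continuous.locallyIntegrable
  have d1 : DifferentiableAt ℝ (potential (fun x => x⁻¹) φ) z₀ := by
    rw [potential_comm]
    exact (contDiff_potential (n := ⊤) hc hφ isTameKernel_inv.locallyIntegrable).contDiffAt
      |>.differentiableAt (by simp)
  have d2 : DifferentiableAt ℝ (potential k (g - φ)) z₀ :=
    (contDiff_potential (n := ⊤) hk2 hk1 hloc).contDiffAt.differentiableAt (by simp)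
  rw [dzbar_congr hk3, dzbar_add d1 d2,
    dzbar_potential_inv (hφ.of_le (by simp)) hc, (dz_potential hk2 (hk1.of_le (by simp)) hloc z₀).2,
    hgφ.self_of_nhds]
  have : potential (dzbar k) (g - φ) z₀ = 0 := by
    unfold potential
    refine integral_eq_zero_of_ae (Eventually.of_forall fun ξ => ?_)
    by_cases hξ : (g - φ) ξ = 0
    · simp [hξ]
    · change dzbar k (z₀ - ξ) * (g - φ) ξ = 0
      have hne : z₀ - ξ ≠ 0 := by
        intro h
        apply hξ
        rw [← sub_eq_zero.mp h, Pi.sub_apply, hgφ.self_of_nhds, sub_self]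
      rw [dzbar_congr (hk4 ξ hξ), dzbar_eq_of_hasFDerivAt (hasFDerivAt_wirtinger_inv hne)]
      simp
  rw [this, add_zero]

end Local

/-! ### The Teodorescu operator -/

section Teodorescu

variable {s M R : ℝ} {g : ℂ → ℂ}

lemma IsRieszDensity.conj (hg : IsRieszDensity s M g) :
    IsRieszDensity s M (fun ξ => conj (g ξ)) where
  integrable := by
    refine hg.integrable.mono (Complex.continuous_conj.comp_aestronglyMeasurable
      hg.integrable.aestronglyMeasurable) (Eventually.of_forall fun ξ => by simp)
  integrable_riesz z := by simpa using hg.integrable_riesz z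
  riesz_le z := by simpa using hg.riesz_le z

/-- The Teodorescu integral of a density on the plane, written with the kernels `x / x̄` and
`ln |x|²`. -/
noncomputable def teodorescuPotential (lam mu : ℝ) (g : ℂ → ℂ) (z : ℂ) : ℂ :=
  (1 / Real.pi : ℂ) * ((alphaStar lam mu : ℂ) * potential phaseKernel (fun ξ => conj (g ξ)) z
    - (betaStar lam mu : ℂ) * potential logKernel g z)

lemma teodorescuIntegrand_eq (lam mu : ℝ) (g : ℂ → ℂ) (z ξ : ℂ) :
    teodorescuIntegrand lam mu g z ξ
      = (alphaStar lam mu : ℂ) * (phaseKernel (z - ξ) * conj (g ξ))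
        - (betaStar lam mu : ℂ) * (logKernel (z - ξ) * g ξ) := by
  have e1 : phaseKernel (z - ξ) = (ξ - z) / conj (ξ - z) := by
    rw [phaseKernel, ← neg_sub ξ z, map_neg, neg_div_neg_eq]
  rw [teodorescuIntegrand, e1, logKernel, norm_sub_rev ξ z]
  ring

lemma integrable_teodorescuIntegrand (lam mu : ℝ) (hs0 : 0 < s) (hg : IsRieszDensity s M g)
    (hR : ∀ ξ, R < ‖ξ‖ → g ξ = 0) (z : ℂ) :
    Integrable (teodorescuIntegrand lam mu g z) := by
  have h1 := isTameKernel_phase.integrable hs0 hg.conj (R := R) (fun ξ hξ => by simp [hR ξ hξ]) z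
  have h2 := isTameKernel_log.integrable hs0 hg hR z
  exact ((h1.const_mul _).sub (h2.const_mul _)).congr
    (Eventually.of_forall fun ξ => (teodorescuIntegrand_eq lam mu g z ξ).symm)

lemma integral_teodorescuIntegrand (lam mu : ℝ) (hs0 : 0 < s) (hg : IsRieszDensity s M g)
    (hR : ∀ ξ, R < ‖ξ‖ → g ξ = 0) (z : ℂ) :
    (1 / Real.pi : ℂ) * ∫ ξ, teodorescuIntegrand lam mu g z ξ = teodorescuPotential lam mu g z := by
  have h1 := isTameKernel_phase.integrable hs0 hg.conj (R := R) (fun ξ hξ => by simp [hR ξ hξ]) z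
  have h2 := isTameKernel_log.integrable hs0 hg hR z
  simp only [teodorescuIntegrand_eq]
  rw [integral_sub (h1.const_mul _) (h2.const_mul _), integral_const_mul, integral_const_mul]
  rfl

lemma teodorescuIntegrand_indicator (lam mu : ℝ) (Ω : Set ℂ) (g : ℂ → ℂ) (z : ℂ) :
    teodorescuIntegrand lam mu (Ω.indicator g) z
      = Ω.indicator (teodorescuIntegrand lam mu g z) := by
  ext ξ
  by_cases hξ : ξ ∈ Ω <;> simp [teodorescuIntegrand, hξ]

lemma hasFDerivAt_potential_phase (hs0 : 0 < s) (hs1 : s < 1) (hg : IsRieszDensity s M g)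
    (hR : ∀ ξ, R < ‖ξ‖ → g ξ = 0) (z : ℂ) :
    HasFDerivAt (potential phaseKernel g) (wirtinger (potential (fun x => (conj x)⁻¹) g z)
      (potential (fun x => -(x / conj x ^ 2)) g z)) z := by
  refine hasFDerivAt_potential (A := 3) hs0 hs1 (isCauchyKernel_conj_inv.mono (by norm_num))
    isCauchyKernel_phase (fun x hx => hasFDerivAt_phaseKernel hx) (fun x hx hx1 => ?_) hg
    (isTameKernel_phase.integrable hs0 hg hR) z
  have h1 : 1 ≤ ‖x‖ ^ (-(s / 2)) :=
    Real.one_le_rpow_of_pos_of_le_one_of_nonpos (norm_pos_iff.mpr hx) hx1 (by linarith)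
  linarith [norm_phaseKernel_le x]

lemma hasFDerivAt_potential_log (hs0 : 0 < s) (hs1 : s < 1) (hg : IsRieszDensity s M g)
    (hR : ∀ ξ, R < ‖ξ‖ → g ξ = 0) (z : ℂ) :
    HasFDerivAt (potential logKernel g) (wirtinger (potential (fun x => x⁻¹) g z)
      (potential (fun x => (conj x)⁻¹) g z)) z := by
  have h4 : 0 < 4 / s := by positivity
  refine hasFDerivAt_potential (A := 1 + 4 / s) hs0 hs1 (isCauchyKernel_inv.mono (by linarith))
    (isCauchyKernel_conj_inv.mono (by linarith)) (fun x hx => hasFDerivAt_logKernel hx)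
    (fun x hx hx1 => ?_) hg (isTameKernel_log.integrable hs0 hg hR) z
  have h0 : 0 < ‖x‖ := norm_pos_iff.mpr hx
  have h1 := Real.log_le_rpow_div (inv_nonneg.mpr h0.le) (half_pos hs0)
  rw [Real.log_inv, Real.inv_rpow h0.le, ← Real.rpow_neg h0.le] at h1
  rw [norm_logKernel, abs_of_nonpos (Real.log_nonpos h0.le hx1)]
  have h2 : 0 < ‖x‖ ^ (-(s / 2)) := by positivity
  calc 2 * -Real.log ‖x‖ ≤ 2 * (‖x‖ ^ (-(s / 2)) / (s / 2)) := by gcongr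
    _ = 4 / s * ‖x‖ ^ (-(s / 2)) := by field_simp; norm_num
    _ ≤ _ := by gcongr; linarith

lemma differentiable_teodorescuPotential (lam mu : ℝ) (hs0 : 0 < s) (hs1 : s < 1)
    (hg : IsRieszDensity s M g) (hR : ∀ ξ, R < ‖ξ‖ → g ξ = 0) :
    Differentiable ℝ (teodorescuPotential lam mu g) := fun z => by
  have h1 := (hasFDerivAt_potential_phase hs0 hs1 hg.conj (R := R)
    (fun ξ hξ => by simp [hR ξ hξ]) z).differentiableAt
  have h2 := (hasFDerivAt_potential_log hs0 hs1 hg hR z).differentiableAt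
  exact ((h1.const_mul _).sub (h2.const_mul _)).const_mul _

/-- `∂_z` of the Teodorescu potential is an `ℝ`-linear function of the Cauchy transform. -/
lemma dz_teodorescuPotential (lam mu : ℝ) (hs0 : 0 < s) (hs1 : s < 1)
    (hg : IsRieszDensity s M g) (hR : ∀ ξ, R < ‖ξ‖ → g ξ = 0) (z : ℂ) :
    dz (teodorescuPotential lam mu g) z
      = (1 / Real.pi : ℂ) * ((alphaStar lam mu : ℂ) * conj (potential (fun x => x⁻¹) g z)
        - (betaStar lam mu : ℂ) * potential (fun x => x⁻¹) g z) := by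
  have h1 := hasFDerivAt_potential_phase hs0 hs1 hg.conj (R := R)
    (fun ξ hξ => by simp [hR ξ hξ]) z
  have h2 := hasFDerivAt_potential_log hs0 hs1 hg hR z
  have e : potential (fun x => (conj x)⁻¹) (fun ξ => conj (g ξ)) z
      = conj (potential (fun x => x⁻¹) g z) := by
    rw [← potential_conj]; simp
  have hd : DifferentiableAt ℝ (fun z =>
      (alphaStar lam mu : ℂ) * potential phaseKernel (fun ξ => conj (g ξ)) z
        - (betaStar lam mu : ℂ) * potential logKernel g z) z :=
    (h1.differentiableAt.const_mul _).sub (h2.differentiableAt.const_mul _)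
  unfold teodorescuPotential
  rw [dz_const_mul _ hd,
    dz_sub (h1.differentiableAt.const_mul _) (h2.differentiableAt.const_mul _),
    dz_const_mul _ h1.differentiableAt, dz_const_mul _ h2.differentiableAt,
    dz_eq_of_hasFDerivAt h1, dz_eq_of_hasFDerivAt h2, e]

lemma continuous_dz_teodorescuPotential (lam mu : ℝ) (hs0 : 0 < s) (hs1 : s < 1)
    (hg : IsRieszDensity s M g) (hR : ∀ ξ, R < ‖ξ‖ → g ξ = 0) :
    Continuous (dz (teodorescuPotential lam mu g)) := by
  have h := isCauchyKernel_inv.continuous_potential hs0 hs1 hg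
  rw [funext (dz_teodorescuPotential lam mu hs0 hs1 hg hR)]
  exact continuous_const.mul ((continuous_const.mul (Complex.continuous_conj.comp h)).sub
    (continuous_const.mul h))

section

variable {φ : ℂ → ℂ} {z₀ : ℂ}

lemma contDiffAt_teodorescuPotential (lam mu : ℝ) (hs0 : 0 < s)
    (hg : IsRieszDensity s M g) (hR : ∀ ξ, R < ‖ξ‖ → g ξ = 0)
    (hφ : ContDiff ℝ ∞ φ) (hc : HasCompactSupport φ) (hgφ : g =ᶠ[𝓝 z₀] φ) :
    ContDiffAt ℝ ∞ (teodorescuPotential lam mu g) z₀ := by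
  have h1 : ContDiffAt ℝ ∞ (potential phaseKernel fun ξ => conj (g ξ)) z₀ :=
    contDiffAt_potential (φ := fun ξ => conj (φ ξ)) isTameKernel_phase hs0 hg.conj (R := R)
      (fun ξ hξ => by simp [hR ξ hξ])
      ((Complex.conjCLE : ℂ →L[ℝ] ℂ).contDiff.comp hφ)
      (hc.comp_left (g := fun w : ℂ => conj w) (by simp))
      (hgφ.mono fun ξ hξ => by simp [hξ])
  have h2 := contDiffAt_potential isTameKernel_log hs0 hg hR hφ hc hgφ
  exact contDiffAt_const.mul ((contDiffAt_const.mul h1).sub (contDiffAt_const.mul h2))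

/-- The Teodorescu potential is a right inverse of the Lamé-Navier operator wherever the density
is smooth. -/
lemma lameOp_teodorescuPotential {lam mu : ℝ} (h : alpha lam mu ^ 2 - beta lam mu ^ 2 ≠ 0)
    (hs0 : 0 < s) (hs1 : s < 1)
    (hg : IsRieszDensity s M g) (hR : ∀ ξ, R < ‖ξ‖ → g ξ = 0)
    (hφ : ContDiff ℝ ∞ φ) (hc : HasCompactSupport φ) (hgφ : g =ᶠ[𝓝 z₀] φ) :
    lameOp lam mu (teodorescuPotential lam mu g) z₀ = g z₀ := by
  set W := potential (fun x => x⁻¹) g with hW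
  have hWd : DifferentiableAt ℝ W z₀ :=
    (contDiffAt_potential isTameKernel_inv hs0 hg hR hφ hc hgφ).differentiableAt (by simp)
  have hWc : DifferentiableAt ℝ (fun z => conj (W z)) z₀ :=
    (Complex.conjCLE : ℂ →L[ℝ] ℂ).differentiableAt.comp z₀ hWd
  have hbar := dzbar_cauchyTransform hs0 hg hR hφ hc hgφ
  rw [← hW] at hbar
  have hdW : DifferentiableAt ℝ (fun z => (alphaStar lam mu : ℂ) * conj (W z)
      - (betaStar lam mu : ℂ) * W z) z₀ :=
    (hWc.const_mul (alphaStar lam mu : ℂ)).sub (hWd.const_mul (betaStar lam mu : ℂ))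
  rw [lameOp_eq, funext (dz_teodorescuPotential lam mu hs0 hs1 hg hR), ← hW,
    dz_const_mul _ hdW, dzbar_const_mul _ hdW,
    dz_sub (hWc.const_mul _) (hWd.const_mul _), dzbar_sub (hWc.const_mul _) (hWd.const_mul _),
    dz_const_mul _ hWc, dz_const_mul _ hWd, dzbar_const_mul _ hWc, dzbar_const_mul _ hWd,
    dz_conj, dzbar_conj, hbar]
  have hpi : (Real.pi : ℂ) ≠ 0 := by exact_mod_cast Real.pi_ne_zero
  have h' : ((alpha lam mu : ℂ) ^ 2 - (beta lam mu : ℂ) ^ 2) ≠ 0 := by exact_mod_cast h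
  simp only [map_mul, map_sub, map_div₀, map_one, map_pow, Complex.conj_ofReal, Complex.conj_conj,
    alphaStar, betaStar, Complex.ofReal_div, Complex.ofReal_sub, Complex.ofReal_pow]
  field_simp
  ring

end

end Teodorescu

/-! ### Integrability of powers of the distance to a summable curve -/

/-- A cover of `γ` by balls of radius `τ` gives a cover of the `τ`-neighbourhood of `γ` by balls of
radius `2 τ`. -/
lemma volume_infDist_lt_le {γ : Set ℂ} (hne : γ.Nonempty) {τ : ℝ} (hτ : 0 < τ) :
    volume {z : ℂ | Metric.infDist z γ < τ}
      ≤ ((Metric.externalCoveringNumber τ.toNNReal γ : ℕ∞) : ℝ≥0∞)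
        * ENNReal.ofReal (4 * Real.pi * τ ^ 2) := by
  rcases eq_or_ne (Metric.externalCoveringNumber τ.toNNReal γ) ⊤ with htop | htop
  · rw [htop, ENat.toENNReal_top, ENNReal.top_mul]
    · exact le_top
    · have := Real.pi_pos
      simp; positivity
  obtain ⟨C, hC, hcard⟩ : ∃ C : Set ℂ, Metric.IsCover τ.toNNReal γ C ∧
      C.encard ≤ Metric.externalCoveringNumber τ.toNNReal γ := by
    have h1 : Metric.externalCoveringNumber τ.toNNReal γ
        < Metric.externalCoveringNumber τ.toNNReal γ + 1 := (ENat.lt_add_one_iff htop).mpr le_rfl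
    conv_lhs at h1 => unfold Metric.externalCoveringNumber
    simp only [iInf_lt_iff] at h1
    obtain ⟨C, hC, h2⟩ := h1
    exact ⟨C, hC, (ENat.lt_add_one_iff htop).mp h2⟩
  have hfin : C.Finite := by
    rw [← Set.encard_lt_top_iff]
    exact lt_of_le_of_lt hcard (lt_top_iff_ne_top.mpr htop)
  have hsub : {z : ℂ | Metric.infDist z γ < τ} ⊆ ⋃ y ∈ hfin.toFinset, Metric.ball y (2 * τ) := by
    intro z hz
    obtain ⟨t, ht, hzt⟩ := (Metric.infDist_lt_iff hne).mp hz
    obtain ⟨y, hy, hty⟩ := mem_iUnion₂.mp (hC.subset_iUnion_closedBall ht)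
    refine mem_iUnion₂.mpr ⟨y, by simpa using hy, ?_⟩
    rw [Metric.mem_closedBall, Real.coe_toNNReal _ hτ.le] at hty
    rw [Metric.mem_ball]
    linarith [dist_triangle z t y]
  calc volume {z : ℂ | Metric.infDist z γ < τ}
      ≤ volume (⋃ y ∈ hfin.toFinset, Metric.ball y (2 * τ)) := measure_mono hsub
    _ ≤ ∑ y ∈ hfin.toFinset, volume (Metric.ball y (2 * τ)) := measure_biUnion_finset_le _ _
    _ = (hfin.toFinset.card : ℝ≥0∞) * ENNReal.ofReal (4 * Real.pi * τ ^ 2) := by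
        have hv : ∀ y : ℂ,
            volume (Metric.ball y (2 * τ)) = ENNReal.ofReal (4 * Real.pi * τ ^ 2) := by
          intro y
          rw [Complex.volume_ball, ← ENNReal.ofReal_pow (by positivity)]
          rw [show (4 : ℝ) * Real.pi * τ ^ 2 = (2 * τ) ^ 2 * Real.pi by ring,
            ENNReal.ofReal_mul (by positivity)]
          congr 1
          rw [← NNReal.coe_real_pi, ENNReal.ofReal_coe_nnreal]
        simp [hv]
    _ ≤ _ := by
        gcongr
        rw [hfin.encard_eq_coe_toFinset_card] at hcard
        exact_mod_cast ENat.toENNReal_le.mpr hcard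

/-- The layer-cake representation of `x ^ (-q)`, truncated at height `1`. -/
lemma ofReal_rpow_neg_le {q x : ℝ} (hq : 0 < q) (hx : 0 < x) :
    ENNReal.ofReal (x ^ (-q)) ≤ 1 + ENNReal.ofReal q * ∫⁻ τ in Ioc (0 : ℝ) 1,
      (Ioi x).indicator (fun τ => ENNReal.ofReal (τ ^ (-q - 1))) τ := by
  rcases le_or_gt 1 x with h1 | h1
  · refine le_add_right ?_
    rw [ENNReal.ofReal_le_one]
    exact Real.rpow_le_one_of_one_le_of_nonpos h1 (by linarith)
  have hI : ∫ τ in x..1, τ ^ (-q - 1) = (x ^ (-q) - 1) / q := by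
    rw [integral_rpow (Or.inr ⟨by linarith, by
      rw [uIcc_of_le h1.le]; intro h; linarith [h.1]⟩)]
    rw [show -q - 1 + 1 = -q by ring, Real.one_rpow]
    field_simp
    ring
  have hint : IntegrableOn (fun τ : ℝ => τ ^ (-q - 1)) (Ioc x 1) := by
    rw [← intervalIntegrable_iff_integrableOn_Ioc_of_le h1.le]
    exact intervalIntegral.intervalIntegrable_rpow (Or.inr (by
      rw [uIcc_of_le h1.le]; intro h; linarith [h.1]))
  have e : ∫⁻ τ in Ioc (0 : ℝ) 1, (Ioi x).indicator (fun τ => ENNReal.ofReal (τ ^ (-q - 1))) τ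
      = ENNReal.ofReal ((x ^ (-q) - 1) / q) := by
    rw [← hI, intervalIntegral.integral_of_le h1.le, ofReal_integral_eq_lintegral_ofReal hint]
    · rw [setLIntegral_indicator measurableSet_Ioi]
      congr 2
      ext τ
      simp only [mem_inter_iff, mem_Ioi, mem_Ioc]
      constructor
      · rintro ⟨a, -, b⟩; exact ⟨a, b⟩
      · rintro ⟨a, b⟩; exact ⟨a, hx.trans a, b⟩
    · filter_upwards [self_mem_ae_restrict measurableSet_Ioc] with τ hτ
      exact Real.rpow_nonneg (hx.le.trans hτ.1.le) _
  rw [e, ← ENNReal.ofReal_mul hq.le, ← ENNReal.ofReal_one, ← ENNReal.ofReal_add zero_le_one]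
  · refine ENNReal.ofReal_le_ofReal (le_of_eq ?_)
    field_simp
    ring
  · have : 1 ≤ x ^ (-q) := Real.one_le_rpow_of_pos_of_le_one_of_nonpos hx h1.le (by linarith)
    have : 0 ≤ x ^ (-q) - 1 := by linarith
    positivity

/-- On a bounded set off a `d`-summable curve, `dist(z, γ)^(d-2)` is integrable. -/
lemma lintegral_infDist_rpow_lt_top {d : ℝ} (hd2 : d < 2) {Ω γ : Set ℂ} (hne : γ.Nonempty)
    (hΩfin : volume Ω ≠ ⊤) (hΩm : MeasurableSet Ω)
    (hpos : ∀ z ∈ Ω, 0 < Metric.infDist z γ) (hγ : IsSummable d γ) :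
    ∫⁻ z in Ω, ENNReal.ofReal (Metric.infDist z γ ^ (-(2 - d))) < ⊤ := by
  have hq : 0 < 2 - d := by linarith
  set q := 2 - d with hqd
  -- layer cake: `F z` is the density in `τ` of the distance power at `z`
  let F : ℂ → ℝ → ℝ≥0∞ := fun z τ =>
    (Ioi (Metric.infDist z γ)).indicator (fun τ => ENNReal.ofReal (τ ^ (-q - 1))) τ
  have hFm : Measurable (Function.uncurry F) := by
    have hset : MeasurableSet {p : ℂ × ℝ | Metric.infDist p.1 γ < p.2} :=
      measurableSet_lt ((Metric.continuous_infDist_pt γ).measurable.comp measurable_fst)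
        measurable_snd
    have hf : Measurable fun p : ℂ × ℝ => ENNReal.ofReal (p.2 ^ (-q - 1)) := by fun_prop
    exact hf.indicator hset
  have hinner : ∀ τ ∈ Ioc (0 : ℝ) 1, ∫⁻ z in Ω, F z τ
      ≤ ENNReal.ofReal (4 * Real.pi) * (((Metric.externalCoveringNumber τ.toNNReal γ : ℕ∞) : ℝ≥0∞)
        * ENNReal.ofReal (τ ^ (d - 1))) := by
    intro τ hτ
    have hset : MeasurableSet {z : ℂ | Metric.infDist z γ < τ} :=
      measurableSet_lt (Metric.continuous_infDist_pt γ).measurable measurable_const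
    have hF : (fun z => F z τ) = {z : ℂ | Metric.infDist z γ < τ}.indicator
        (fun _ => ENNReal.ofReal (τ ^ (-q - 1))) := by
      ext z; simp [F, indicator]
    rw [hF]
    calc ∫⁻ z in Ω, {z : ℂ | Metric.infDist z γ < τ}.indicator
          (fun _ => ENNReal.ofReal (τ ^ (-q - 1))) z
        ≤ ∫⁻ z, {z : ℂ | Metric.infDist z γ < τ}.indicator
          (fun _ => ENNReal.ofReal (τ ^ (-q - 1))) z := setLIntegral_le_lintegral _ _
      _ = ENNReal.ofReal (τ ^ (-q - 1)) * volume {z : ℂ | Metric.infDist z γ < τ} := by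
          rw [lintegral_indicator_const hset]
      _ ≤ ENNReal.ofReal (τ ^ (-q - 1)) *
          (((Metric.externalCoveringNumber τ.toNNReal γ : ℕ∞) : ℝ≥0∞)
          * ENNReal.ofReal (4 * Real.pi * τ ^ 2)) := by
          gcongr; exact volume_infDist_lt_le hne hτ.1
      _ = _ := by
          have e : ENNReal.ofReal (τ ^ (-q - 1)) * ENNReal.ofReal (4 * Real.pi * τ ^ 2)
              = ENNReal.ofReal (4 * Real.pi) * ENNReal.ofReal (τ ^ (d - 1)) := by
            rw [← ENNReal.ofReal_mul (Real.rpow_nonneg hτ.1.le _),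
              ← ENNReal.ofReal_mul (by positivity)]
            congr 1
            have : τ ^ (d - 1) = τ ^ (-q - 1) * τ ^ 2 := by
              rw [← Real.rpow_natCast τ 2, ← Real.rpow_add hτ.1]
              congr 1; rw [hqd]; push_cast; ring
            rw [this]; ring
          rw [mul_left_comm, e]; ring
  calc ∫⁻ z in Ω, ENNReal.ofReal (Metric.infDist z γ ^ (-q))
      ≤ ∫⁻ z in Ω, (1 + ENNReal.ofReal q * ∫⁻ τ in Ioc (0 : ℝ) 1, F z τ) :=
        setLIntegral_mono' hΩm fun z hz => ofReal_rpow_neg_le hq (hpos z hz)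
    _ = volume Ω + ENNReal.ofReal q * ∫⁻ z in Ω, ∫⁻ τ in Ioc (0 : ℝ) 1, F z τ := by
        rw [lintegral_add_left measurable_const, lintegral_const_mul']
        · simp
        · exact ENNReal.ofReal_ne_top
    _ = volume Ω + ENNReal.ofReal q * ∫⁻ τ in Ioc (0 : ℝ) 1, ∫⁻ z in Ω, F z τ := by
        rw [lintegral_lintegral_swap hFm.aemeasurable]
    _ ≤ volume Ω + ENNReal.ofReal q * ∫⁻ τ in Ioc (0 : ℝ) 1, ENNReal.ofReal (4 * Real.pi) *
        (((Metric.externalCoveringNumber τ.toNNReal γ : ℕ∞) : ℝ≥0∞)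
          * ENNReal.ofReal (τ ^ (d - 1))) := by
        gcongr 2
        exact setLIntegral_mono' measurableSet_Ioc hinner
    _ < ⊤ := by
        rw [lintegral_const_mul' _ _ ENNReal.ofReal_ne_top]
        exact ENNReal.add_lt_top.mpr ⟨lt_top_iff_ne_top.mpr hΩfin,
          ENNReal.mul_lt_top ENNReal.ofReal_lt_top (ENNReal.mul_lt_top ENNReal.ofReal_lt_top hγ)⟩

/-- By Young's inequality, a density on a bounded set that is dominated by a function in `L^p`,
`p > 2`, has bounded Riesz potentials of some order below `1`. -/
lemma exists_isRieszDensity {Ω : Set ℂ} (hΩm : MeasurableSet Ω) (hΩfin : volume Ω ≠ ⊤)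
    {g : ℂ → ℂ} {B : ℂ → ℝ} {p : ℝ} (hp : 2 < p)
    (hgm : AEStronglyMeasurable g (volume.restrict Ω))
    (hgB : ∀ ξ ∈ Ω, ‖g ξ‖ ^ p ≤ B ξ) (hB : IntegrableOn B Ω) :
    ∃ s M : ℝ, 0 < s ∧ s < 1 ∧ IsRieszDensity s M (Ω.indicator g) := by
  set p' := p / (p - 1) with hp'
  have hp1 : 0 < p - 1 := by linarith
  have hconj : p'.HolderConjugate p := by
    rw [Real.holderConjugate_comm]
    exact Real.HolderConjugate.conjExponent (by linarith)
  have hp'2 : p' < 2 := by rw [hp', div_lt_iff₀ hp1]; linarith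
  have hp'1 : 1 < p' := by rw [hp', lt_div_iff₀ hp1]; linarith
  -- the exponent `1 + s` is the midpoint of `1` and `2 / p'`
  set s := (2 / p' - 1) / 2 with hs
  have h2p : 1 < 2 / p' := by rw [lt_div_iff₀ (by linarith)]; linarith
  have h2p' : 2 / p' < 2 := by rw [div_lt_iff₀ (by linarith)]; linarith
  have hs0 : 0 < s := by rw [hs]; linarith
  have hs1 : s < 1 := by rw [hs]; linarith
  set a := (1 + s) * p' with ha
  have ha2 : a < 2 := by
    have : a = 1 + p' / 2 := by rw [ha, hs]; field_simp; ring
    linarith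
  have ha0 : 0 < a := by positivity
  -- `k` and `D` are integrable and dominate the two terms of Young's inequality
  let k : ℂ → ℝ := (Metric.ball (0 : ℂ) 1).indicator fun x => ‖x‖ ^ (-a)
  have hk : Integrable k := by
    rw [integrable_indicator_iff Metric.isOpen_ball.measurableSet]
    refine integrableOn_ball_of_norm_le_rpow (C := 1) (α := a)
      (by simp [Complex.finrank_real_complex]) (by simpa [Complex.finrank_real_complex] using ha2)
      (Eventually.of_forall fun x => ?_) ?_
    · rw [one_mul, Real.norm_of_nonneg (by positivity)]
    · exact (measurable_norm.pow_const _).aestronglyMeasurable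
  let D : ℂ → ℝ := Ω.indicator fun ξ => 1 + B ξ
  have hD : Integrable D := by
    rw [integrable_indicator_iff hΩm]
    exact (integrableOn_const hΩfin).add hB
  have hgint : AEStronglyMeasurable (Ω.indicator g) volume :=
    (aestronglyMeasurable_indicator_iff hΩm).mpr hgm
  have hk0 : ∀ x, 0 ≤ k x := fun x => indicator_nonneg (fun _ _ => by positivity) x
  have hbound : ∀ z ξ, ‖z - ξ‖ ^ (-1 - s) * ‖Ω.indicator g ξ‖ ≤ k (z - ξ) + D ξ := by
    intro z ξ
    by_cases hξ : ξ ∈ Ω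
    · simp only [D, indicator_of_mem hξ]
      have hy := Real.young_inequality_of_nonneg (a := ‖z - ξ‖ ^ (-1 - s)) (b := ‖g ξ‖)
        (by positivity) (norm_nonneg _) hconj
      have e1 : (‖z - ξ‖ ^ (-1 - s)) ^ p' = ‖z - ξ‖ ^ (-a) := by
        rw [← Real.rpow_mul (norm_nonneg _)]; congr 1; rw [ha]; ring
      rw [e1] at hy
      have h1 : ‖z - ξ‖ ^ (-a) / p' ≤ ‖z - ξ‖ ^ (-a) :=
        div_le_self (by positivity) hp'1.le
      have h2 : ‖g ξ‖ ^ p / p ≤ ‖g ξ‖ ^ p := div_le_self (by positivity) (by linarith)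
      have h3 : ‖z - ξ‖ ^ (-a) ≤ k (z - ξ) + 1 := by
        by_cases hb : z - ξ ∈ Metric.ball (0 : ℂ) 1
        · simp [k, indicator_of_mem hb]
        · simp only [k, indicator_of_notMem hb, zero_add]
          rw [mem_ball_zero_iff, not_lt] at hb
          exact Real.rpow_le_one_of_one_le_of_nonpos hb (by linarith)
      linarith [hgB ξ hξ]
    · simp [D, hξ, hk0]
  have hkz : ∀ z, Integrable fun ξ => k (z - ξ) := fun z => hk.comp_sub_left z
  have hI : ∀ z, Integrable fun ξ => ‖z - ξ‖ ^ (-1 - s) * ‖Ω.indicator g ξ‖ := by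
    intro z
    refine ((hkz z).add hD).mono' ?_ (Eventually.of_forall fun ξ => ?_)
    · exact (((measurable_const.sub measurable_id).norm).pow_const _).aestronglyMeasurable.mul
        hgint.norm
    · rw [Real.norm_of_nonneg (by positivity)]
      exact hbound z ξ
  refine ⟨s, (∫ x, k x) + ∫ ξ, D ξ, hs0, hs1, ?_, hI, ?_⟩
  · refine hD.mono' hgint (Eventually.of_forall fun ξ => ?_)
    by_cases hξ : ξ ∈ Ω
    · simp only [D, indicator_of_mem hξ]
      refine le_trans ?_ (add_le_add_right (hgB ξ hξ) 1)
      rcases le_total ‖g ξ‖ 1 with h | h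
      · have : 0 ≤ ‖g ξ‖ ^ p := by positivity
        linarith
      · have := Real.self_le_rpow_of_one_le h (show 1 ≤ p by linarith)
        linarith
    · simp [D, hξ]
  · intro z
    calc _ ≤ ∫ ξ, (k (z - ξ) + D ξ) :=
          integral_mono (hI z) ((hkz z).add hD) (hbound z)
      _ = _ := by
          rw [integral_add (hkz z) hD, integral_sub_left_eq_self k volume z]

/-! ### The jump problem -/

lemma IsJordanCurve.isCompact {γ : Set ℂ} (h : IsJordanCurve γ) : IsCompact γ := by
  obtain ⟨φ, hφ, -, rfl⟩ := h
  exact isCompact_range hφ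

lemma IsJordanCurve.nonempty {γ : Set ℂ} (h : IsJordanCurve γ) : γ.Nonempty := by
  obtain ⟨φ, -, -, rfl⟩ := h
  exact range_nonempty φ

section

variable {Ω γ : Set ℂ}

lemma IsJordanDomain.notMem_curve (h : IsJordanDomain Ω γ) {z : ℂ} (hz : z ∈ Ω) : z ∉ γ := by
  rw [← h.frontier_eq, h.isOpen.frontier_eq]
  exact fun hh => hh.2 hz

lemma IsJordanDomain.isOpen_exterior (h : IsJordanDomain Ω γ) :
    IsOpen (exteriorDomain Ω γ) := by
  have : Ω ∪ γ = closure Ω := by rw [closure_eq_self_union_frontier, h.frontier_eq]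
  rw [exteriorDomain, this]
  exact isClosed_closure.isOpen_compl

end

section Density

variable {ν : ℝ} {γ : Set ℂ} {f₀ f₁ f₂ F : ℂ → ℂ}

lemma IsWhitneyExtension.contDiffAt (hF : IsWhitneyExtension ν γ f₀ f₁ f₂ F) (hγ : IsClosed γ)
    {z : ℂ} (hz : z ∉ γ) : ContDiffAt ℝ ∞ F z :=
  hF.smooth_off.contDiffAt (hγ.isOpen_compl.mem_nhds hz)

lemma IsWhitneyExtension.contDiffAt_lameOp (hF : IsWhitneyExtension ν γ f₀ f₁ f₂ F)
    (hγ : IsClosed γ) (lam mu : ℝ) {z : ℂ} (hz : z ∉ γ) :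
    ContDiffAt ℝ ∞ (lameOp lam mu F) z := by
  have h1 := contDiffAt_dz (m := ∞) (hF.contDiffAt hγ hz) (by simp)
  have h2 := contDiffAt_dz (m := ∞) h1 (by simp)
  have h3 := contDiffAt_dzbar (m := ∞) h1 (by simp)
  rw [funext (lameOp_eq lam mu F)]
  exact (contDiffAt_const.mul ((Complex.conjCLE : ℂ →L[ℝ] ℂ).contDiff.contDiffAt.comp z h2)).add
    (contDiffAt_const.mul h3)

lemma IsWhitneyExtension.norm_lameOp_le (hF : IsWhitneyExtension ν γ f₀ f₁ f₂ F)
    (hγ : IsClosed γ) (lam mu : ℝ) :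
    ∃ C, 0 ≤ C ∧ ∀ z ∉ γ, ‖lameOp lam mu F z‖ ≤ C * Metric.infDist z γ ^ (ν - 1) := by
  obtain ⟨c, hc⟩ := hF.second_bound
  refine ⟨(|alpha lam mu| + |beta lam mu|) * |c|, by positivity, fun z hz => ?_⟩
  have h0 : 0 ≤ Metric.infDist z γ ^ (ν - 1) := Real.rpow_nonneg Metric.infDist_nonneg _
  have h1 : ‖dz (dz F) z‖ ≤ |c| * Metric.infDist z γ ^ (ν - 1) :=
    (hc 2 0 rfl z hz).trans (by gcongr; exact le_abs_self c)
  have h2 : ‖dzbar (dz F) z‖ ≤ |c| * Metric.infDist z γ ^ (ν - 1) := by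
    rw [← dz_dzbar_comm ((hF.contDiffAt hγ hz).of_le ENat.LEInfty.out)]
    exact (hc 1 1 rfl z hz).trans (by gcongr; exact le_abs_self c)
  rw [lameOp_eq]
  refine (norm_add_le _ _).trans ?_
  rw [norm_mul, norm_mul, Complex.norm_real, Complex.norm_real, Complex.norm_conj,
    Real.norm_eq_abs, Real.norm_eq_abs]
  calc _ ≤ |alpha lam mu| * (|c| * Metric.infDist z γ ^ (ν - 1))
        + |beta lam mu| * (|c| * Metric.infDist z γ ^ (ν - 1)) := by gcongr
    _ = _ := by ring

/-- The density `L F` of a Whitney extension `F` has bounded Riesz potentials: it is in `L^p` for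
`p = (2 - d) / (1 - ν)`, and `p > 2` is the condition `ν > d / 2`. -/
lemma IsWhitneyExtension.exists_isRieszDensity {d : ℝ} (hd2 : d < 2) (hν1 : ν < 1)
    (hνd : d / 2 < ν) {Ω : Set ℂ} (hΩ : IsJordanDomain Ω γ) (hγ : IsSummable d γ)
    (hF : IsWhitneyExtension ν γ f₀ f₁ f₂ F) (lam mu : ℝ) :
    ∃ s M : ℝ, 0 < s ∧ s < 1 ∧ IsRieszDensity s M (Ω.indicator (lameOp lam mu F)) := by
  have hcl : IsClosed γ := hΩ.isJordanCurve.isCompact.isClosed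
  have hne := hΩ.isJordanCurve.nonempty
  obtain ⟨C, hC0, hC⟩ := hF.norm_lameOp_le hcl lam mu
  have hpos : ∀ z ∈ Ω, 0 < Metric.infDist z γ := fun z hz =>
    (hcl.notMem_iff_infDist_pos hne).mp (hΩ.notMem_curve hz)
  have hvol : volume Ω ≠ ⊤ := hΩ.isBounded.measure_lt_top.ne
  have hm := hΩ.isOpen.measurableSet
  have hfin := lintegral_infDist_rpow_lt_top hd2 hne hvol hm hpos hγ
  set p := (2 - d) / (1 - ν) with hp
  have hν' : 0 < 1 - ν := by linarith
  have hp2 : 2 < p := by rw [hp, lt_div_iff₀ hν']; linarith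
  refine LameNavier.exists_isRieszDensity hm hvol (p := p)
    (B := fun z => C ^ p * Metric.infDist z γ ^ (-(2 - d))) hp2 ?_ ?_ ?_
  · refine ContinuousOn.aestronglyMeasurable (fun z hz => ?_) hm
    exact (hF.contDiffAt_lameOp hcl lam mu (hΩ.notMem_curve hz)).continuousAt.continuousWithinAt
  · intro z hz
    have hδ := hpos z hz
    calc ‖lameOp lam mu F z‖ ^ p ≤ (C * Metric.infDist z γ ^ (ν - 1)) ^ p := by
          gcongr
          exact hC z (hΩ.notMem_curve hz)
      _ = _ := by
          rw [Real.mul_rpow hC0 (by positivity), ← Real.rpow_mul hδ.le]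
          congr 2
          rw [hp]; field_simp; ring
  · refine Integrable.const_mul ?_ _
    refine ⟨((Metric.continuous_infDist_pt γ).measurable.pow_const _).aestronglyMeasurable, ?_⟩
    rw [hasFiniteIntegral_iff_ofReal]
    · exact hfin
    · exact Eventually.of_forall fun z => Real.rpow_nonneg Metric.infDist_nonneg _

end Density

/-- A function smooth near `z₀` agrees near `z₀` with a smooth compactly supported one. -/
lemma exists_contDiff_eventuallyEq {g : ℂ → ℂ} {U : Set ℂ} (hU : IsOpen U) {z₀ : ℂ} (hz : z₀ ∈ U)
    (hg : ∀ z ∈ U, ContDiffAt ℝ ∞ g z) :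
    ∃ φ : ℂ → ℂ, ContDiff ℝ ∞ φ ∧ HasCompactSupport φ ∧ g =ᶠ[𝓝 z₀] φ := by
  obtain ⟨r, hr, hball⟩ := Metric.isOpen_iff.mp hU z₀ hz
  let χ : ContDiffBump z₀ := ⟨r / 4, r / 2, by positivity, by linarith⟩
  have hts : tsupport (fun z => ((χ z : ℝ) : ℂ) * g z) ⊆ Metric.closedBall z₀ (r / 2) := by
    refine closure_minimal (fun z hz => ?_) Metric.isClosed_closedBall
    have h1 : χ z ≠ 0 := fun h => hz (by simp [h])
    have h2 : z ∈ Function.support χ := h1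
    rw [χ.support_eq] at h2
    exact Metric.ball_subset_closedBall h2
  refine ⟨fun z => ((χ z : ℝ) : ℂ) * g z, ?_, ?_, ?_⟩
  · refine contDiff_iff_contDiffAt.mpr fun z => ?_
    by_cases hz : z ∈ tsupport (fun z => ((χ z : ℝ) : ℂ) * g z)
    swap
    · exact contDiffAt_const.congr_of_eventuallyEq (notMem_tsupport_iff_eventuallyEq.mp hz)
    have hzU : z ∈ U := hball (Metric.closedBall_subset_ball (by linarith) (hts hz))
    exact (Complex.ofRealCLM.contDiff.contDiffAt.comp z χ.contDiffAt).mul (hg z hzU)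
  · exact (isCompact_closedBall z₀ (r / 2)).of_isClosed_subset (isClosed_tsupport _) hts
  · filter_upwards [χ.eventuallyEq_one] with z hz
    simp [hz]

/-- `α² - β² = -μ (2 μ + λ)`, which is negative for admissible Lamé constants. -/
lemma alpha_sq_sub_beta_sq_ne_zero {lam mu : ℝ} (hmu : 0 < mu) (hlam : -(2 * mu / 3) < lam) :
    alpha lam mu ^ 2 - beta lam mu ^ 2 ≠ 0 := by
  have : alpha lam mu ^ 2 - beta lam mu ^ 2 = -(mu * (2 * mu + lam)) := by
    unfold alpha beta; ring
  rw [this, neg_ne_zero]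
  have : 0 < 2 * mu + lam := by linarith
  positivity

lemma lameOp_sub {lam mu : ℝ} {u v : ℂ → ℂ} {z : ℂ} (hu : ContDiffAt ℝ 2 u z)
    (hv : ContDiffAt ℝ 2 v z) :
    lameOp lam mu (fun w => u w - v w) z = lameOp lam mu u z - lameOp lam mu v z := by
  have h1 : ∀ᶠ w in 𝓝 z, ContDiffAt ℝ 2 u w := hu.eventually (by simp)
  have h2 : ∀ᶠ w in 𝓝 z, ContDiffAt ℝ 2 v w := hv.eventually (by simp)
  have e : dz (fun w => u w - v w) =ᶠ[𝓝 z] fun w => dz u w - dz v w := by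
    filter_upwards [h1, h2] with w hw1 hw2
    exact dz_sub (hw1.differentiableAt (by simp)) (hw2.differentiableAt (by simp))
  have d1 := (contDiffAt_dz (m := 1) hu (by norm_num)).differentiableAt (by simp)
  have d2 := (contDiffAt_dz (m := 1) hv (by norm_num)).differentiableAt (by simp)
  rw [lameOp_eq, lameOp_eq, lameOp_eq, dz_congr e, dzbar_congr e, dz_sub d1 d2, dzbar_sub d1 d2,
    map_sub]
  ring

lemma lameOp_congr {lam mu : ℝ} {u v : ℂ → ℂ} {z : ℂ} (h : u =ᶠ[𝓝 z] v) :
    lameOp lam mu u z = lameOp lam mu v z := by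
  rw [lameOp_eq, lameOp_eq, dz_congr (eventuallyEq_dz h), dzbar_congr (eventuallyEq_dz h)]

lemma lameOp_zero (lam mu : ℝ) (z : ℂ) : lameOp lam mu (fun _ => 0) z = 0 := by
  have : dz (fun _ => 0) = fun _ => 0 := by ext w; simp [dz]
  rw [lameOp_eq, this]
  simp [dz, dzbar]

/-- The jump problem is solved as soon as `L ft` has bounded Riesz potentials. The summability
of the curve and the second-derivative bounds of `ft` enter only through this hypothesis. -/
lemma IsWhitneyExtension.solvesJumpProblem {lam mu : ℝ}
    (hdet : alpha lam mu ^ 2 - beta lam mu ^ 2 ≠ 0) {ν : ℝ} {Ω γ : Set ℂ}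
    (hΩ : IsJordanDomain Ω γ) {f₀ f₁ f₂ ft : ℂ → ℂ} (hF : IsWhitneyExtension ν γ f₀ f₁ f₂ ft)
    {s M : ℝ} (hs0 : 0 < s) (hs1 : s < 1)
    (hg : IsRieszDensity s M (Ω.indicator (lameOp lam mu ft))) :
    (∀ z : ℂ, IntegrableOn (teodorescuIntegrand lam mu (lameOp lam mu ft) z) Ω volume) ∧
      SolvesJumpProblem lam mu Ω γ f₀ f₁
        (fun z => Ω.indicator ft z - teodorescu lam mu Ω (lameOp lam mu ft) z) := by
  set g := Ω.indicator (lameOp lam mu ft) with hgdef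
  have hcl : IsClosed γ := hΩ.isJordanCurve.isCompact.isClosed
  have hm := hΩ.isOpen.measurableSet
  obtain ⟨R, hRball⟩ := hΩ.isBounded.subset_closedBall 0
  have hR : ∀ ξ, R < ‖ξ‖ → g ξ = 0 := by
    intro ξ hξ
    refine indicator_of_notMem (fun h => ?_) _
    have := hRball h
    rw [mem_closedBall_zero_iff] at this
    linarith
  have hT : ∀ z, teodorescu lam mu Ω (lameOp lam mu ft) z = teodorescuPotential lam mu g z := by
    intro z
    rw [← integral_teodorescuIntegrand lam mu hs0 hg hR, hgdef, teodorescuIntegrand_indicator,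
      integral_indicator hm]
    rfl
  have hInt : ∀ z : ℂ, IntegrableOn (teodorescuIntegrand lam mu (lameOp lam mu ft) z) Ω := by
    intro z
    rw [← integrable_indicator_iff hm, ← teodorescuIntegrand_indicator]
    exact integrable_teodorescuIntegrand lam mu hs0 hg hR z
  refine ⟨hInt, ?_⟩
  simp only [hT]
  -- `T` is of class `C¹` on the plane, smooth off `γ`, and `L T = g` there
  set T := teodorescuPotential lam mu g with hTdef
  have hTdiff : Differentiable ℝ T := differentiable_teodorescuPotential lam mu hs0 hs1 hg hR
  have hTdz : Continuous (dz T) := continuous_dz_teodorescuPotential lam mu hs0 hs1 hg hR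
  have hloc : ∀ z ∈ Ω ∪ exteriorDomain Ω γ,
      ∃ φ : ℂ → ℂ, ContDiff ℝ ∞ φ ∧ HasCompactSupport φ ∧ g =ᶠ[𝓝 z] φ := by
    rintro z (hz | hz)
    · refine exists_contDiff_eventuallyEq hΩ.isOpen hz fun w hw => ?_
      refine (hF.contDiffAt_lameOp hcl lam mu (hΩ.notMem_curve hw)).congr_of_eventuallyEq ?_
      filter_upwards [hΩ.isOpen.mem_nhds hw] with x hx
      exact indicator_of_mem hx _
    · refine ⟨fun _ => 0, contDiff_const, HasCompactSupport.zero, ?_⟩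
      filter_upwards [hΩ.isOpen_exterior.mem_nhds hz] with x hx
      exact indicator_of_notMem (fun h => hx (Or.inl h)) _
  have hTsmooth : ∀ z ∈ Ω ∪ exteriorDomain Ω γ, ContDiffAt ℝ ∞ T z := fun z hz => by
    obtain ⟨φ, h1, h2, h3⟩ := hloc z hz
    exact contDiffAt_teodorescuPotential lam mu hs0 hg hR h1 h2 h3
  have hTL : ∀ z ∈ Ω ∪ exteriorDomain Ω γ, lameOp lam mu T z = g z := fun z hz => by
    obtain ⟨φ, h1, h2, h3⟩ := hloc z hz
    exact lameOp_teodorescuPotential hdet hs0 hs1 hg hR h1 h2 h3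
  have hin : ∀ z ∈ Ω, (fun w => Ω.indicator ft w - T w) =ᶠ[𝓝 z] fun w => ft w - T w := by
    intro z hz
    filter_upwards [hΩ.isOpen.mem_nhds hz] with w hw
    rw [indicator_of_mem hw]
  have hout : ∀ z ∈ exteriorDomain Ω γ,
      (fun w => Ω.indicator ft w - T w) =ᶠ[𝓝 z] fun w => (0 : ℂ) - T w := by
    intro z hz
    filter_upwards [hΩ.isOpen_exterior.mem_nhds hz] with w hw
    rw [indicator_of_notMem fun h => hw (Or.inl h)]
  have hft : ∀ z ∈ Ω, ContDiffAt ℝ 2 ft z := fun z hz =>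
    (hF.contDiffAt hcl (hΩ.notMem_curve hz)).of_le ENat.LEInfty.out
  have hT2 : ∀ z ∈ Ω ∪ exteriorDomain Ω γ, ContDiffAt ℝ 2 T z := fun z hz =>
    (hTsmooth z hz).of_le ENat.LEInfty.out
  have hftc : Continuous ft := hF.contDiff_one.continuous
  have hftd : Differentiable ℝ ft := hF.contDiff_one.differentiable one_ne_zero
  have hftdz : Continuous (dz ft) := by
    rw [funext (dz_eq ft)]
    exact dzL.continuous.comp (hF.contDiff_one.continuous_fderiv one_ne_zero)
  refine ⟨?_, ?_, ?_, ?_⟩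
  · intro z hz
    refine ContDiffAt.contDiffWithinAt ?_
    rcases hz with hz | hz
    · exact ((hft z hz).sub (hT2 z (Or.inl hz))).congr_of_eventuallyEq (hin z hz)
    · exact (contDiffAt_const.sub (hT2 z (Or.inr hz))).congr_of_eventuallyEq (hout z hz)
  · rintro z (hz | hz)
    · rw [lameOp_congr (hin z hz), lameOp_sub (hft z hz) (hT2 z (Or.inl hz)), hTL z (Or.inl hz),
        hgdef, indicator_of_mem hz, sub_self]
    · rw [lameOp_congr (hout z hz), lameOp_sub contDiffAt_const (hT2 z (Or.inr hz)),
        hTL z (Or.inr hz), hgdef, indicator_of_notMem fun h => hz (Or.inl h), lameOp_zero,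
        sub_self]
  · intro t ht
    refine ⟨ft t - T t, 0 - T t, ?_, ?_, by rw [← hF.eq_zero t ht]; ring⟩
    · refine ((hftc.sub hTdiff.continuous).tendsto t |>.mono_left nhdsWithin_le_nhds).congr' ?_
      filter_upwards [self_mem_nhdsWithin] with w hw
      simp [indicator_of_mem hw]
    · refine ((continuous_const.sub hTdiff.continuous).tendsto t
        |>.mono_left nhdsWithin_le_nhds).congr' ?_
      filter_upwards [self_mem_nhdsWithin] with w hw
      simp [indicator_of_notMem (show w ∉ Ω from fun h => hw (Or.inl h))]
  · intro t ht
    refine ⟨dz ft t - dz T t, 0 - dz T t, ?_, ?_, by rw [← hF.eq_one t ht]; ring⟩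
    · refine ((hftdz.sub hTdz).tendsto t |>.mono_left nhdsWithin_le_nhds).congr' ?_
      filter_upwards [self_mem_nhdsWithin] with w hw
      rw [dz_congr (hin w hw), dz_sub (hftd w) (hTdiff w), Pi.sub_apply]
    · refine ((continuous_const.sub hTdz).tendsto t |>.mono_left nhdsWithin_le_nhds).congr' ?_
      filter_upwards [self_mem_nhdsWithin] with w hw
      rw [dz_congr (hout w hw), dz_sub (differentiableAt_const _) (hTdiff w)]
      simp [dz]

/-! ### Mollification at a given scale -/

/-- A bump function of integral one on the unit disc. -/
noncomputable def unitBump (x : ℂ) : ℂ :=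
  (((⟨1 / 2, 1, by norm_num, by norm_num⟩ : ContDiffBump (0 : ℂ)).normed volume x : ℝ) : ℂ)

lemma contDiff_unitBump : ContDiff ℝ ∞ unitBump :=
  Complex.ofRealCLM.contDiff.comp (ContDiffBump.contDiff_normed (n := ⊤) _)

lemma unitBump_eq_zero {x : ℂ} (hx : 1 ≤ ‖x‖) : unitBump x = 0 := by
  have h : x ∉ Function.support ((⟨1 / 2, 1, by norm_num, by norm_num⟩ :
      ContDiffBump (0 : ℂ)).normed volume) := by
    rw [ContDiffBump.support_normed_eq]
    simpa using hx
  rw [unitBump, Function.notMem_support.mp h, Complex.ofReal_zero]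

lemma hasCompactSupport_unitBump : HasCompactSupport unitBump :=
  HasCompactSupport.intro (isCompact_closedBall (0 : ℂ) 1) fun x hx => by
    rw [mem_closedBall_zero_iff, not_le] at hx
    exact unitBump_eq_zero hx.le

lemma integral_unitBump : ∫ x, unitBump x = 1 := by
  unfold unitBump
  rw [integral_complex_ofReal, ContDiffBump.integral_normed, Complex.ofReal_one]

lemma unitBump_neg (x : ℂ) : unitBump (-x) = unitBump x := by
  rw [unitBump, ContDiffBump.normed_neg, unitBump]

/-- The bump function of integral one, rescaled to the disc of radius `ε`. -/
noncomputable def mollifier (ε : ℝ) (x : ℂ) : ℂ := (ε⁻¹ ^ 2) • unitBump (ε⁻¹ • x)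

section Mollifier

variable {ε : ℝ}

lemma contDiff_mollifier (ε : ℝ) : ContDiff ℝ ∞ (mollifier ε) :=
  (contDiff_unitBump.comp (contDiff_id.const_smul ε⁻¹)).const_smul (ε⁻¹ ^ 2)

lemma mollifier_eq_zero (hε : 0 < ε) {x : ℂ} (hx : ε ≤ ‖x‖) : mollifier ε x = 0 := by
  have : 1 ≤ ‖ε⁻¹ • x‖ := by
    rw [norm_smul, norm_inv, Real.norm_of_nonneg hε.le, inv_mul_eq_div, one_le_div hε]
    exact hx
  rw [mollifier, unitBump_eq_zero this, smul_zero]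

lemma hasCompactSupport_mollifier (hε : 0 < ε) : HasCompactSupport (mollifier ε) :=
  HasCompactSupport.intro (isCompact_closedBall (0 : ℂ) ε) fun x hx => by
    rw [mem_closedBall_zero_iff, not_le] at hx
    exact mollifier_eq_zero hε hx.le

lemma integral_mollifier (hε : 0 < ε) : ∫ x, mollifier ε x = 1 := by
  unfold mollifier
  rw [integral_smul, Measure.integral_comp_smul, integral_unitBump,
    Complex.finrank_real_complex, abs_of_nonneg (by positivity)]
  simp only [Complex.real_smul, mul_one]
  rw [← Complex.ofReal_mul, mul_inv_cancel₀ (by positivity), Complex.ofReal_one]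

lemma mollifier_neg (x : ℂ) : mollifier ε (-x) = mollifier ε x := by
  rw [mollifier, smul_neg, unitBump_neg, mollifier]

lemma fderiv_mollifier (x : ℂ) :
    fderiv ℝ (mollifier ε) x = (ε⁻¹ ^ 3) • fderiv ℝ unitBump (ε⁻¹ • x) := by
  have hd : Differentiable ℝ fun x : ℂ => unitBump (ε⁻¹ • x) :=
    (contDiff_unitBump.comp (contDiff_id.const_smul ε⁻¹)).differentiable (by simp)
  have : mollifier ε = (ε⁻¹ ^ 2) • fun x : ℂ => unitBump (ε⁻¹ • x) := rfl
  rw [this, fderiv_const_smul (hd x), fderiv_comp_smul, smul_smul]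
  congr 1

lemma fderiv_fderiv_mollifier (x : ℂ) :
    fderiv ℝ (fderiv ℝ (mollifier ε)) x
      = (ε⁻¹ ^ 4) • fderiv ℝ (fderiv ℝ unitBump) (ε⁻¹ • x) := by
  have hd : Differentiable ℝ fun x : ℂ => fderiv ℝ unitBump (ε⁻¹ • x) :=
    ((contDiff_unitBump.fderiv_right (m := 1) (by norm_cast)).comp
      (contDiff_id.const_smul ε⁻¹)).differentiable (by simp)
  have : fderiv ℝ (mollifier ε) = (ε⁻¹ ^ 3) • fun x : ℂ => fderiv ℝ unitBump (ε⁻¹ • x) :=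
    funext fderiv_mollifier
  rw [this, fderiv_const_smul (hd x), fderiv_comp_smul (f := fderiv ℝ unitBump), smul_smul]
  congr 1

lemma contDiff_fderiv_unitBump : ContDiff ℝ 1 (fderiv ℝ unitBump) :=
  contDiff_unitBump.fderiv_right (m := 1) (by norm_cast)

lemma exists_unitBump_bounds : ∃ S : ℝ, 0 ≤ S ∧ ∀ x, ‖unitBump x‖ ≤ S ∧
    ‖fderiv ℝ unitBump x‖ ≤ S ∧ ‖fderiv ℝ (fderiv ℝ unitBump) x‖ ≤ S := by
  have hc1 : HasCompactSupport (fderiv ℝ unitBump) := hasCompactSupport_unitBump.fderiv ℝ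
  have hc2 : HasCompactSupport (fderiv ℝ (fderiv ℝ unitBump)) := hc1.fderiv ℝ
  obtain ⟨S₀, h₀⟩ := contDiff_unitBump.continuous.bounded_above_of_compact_support
    hasCompactSupport_unitBump
  obtain ⟨S₁, h₁⟩ := contDiff_fderiv_unitBump.continuous.bounded_above_of_compact_support hc1
  obtain ⟨S₂, h₂⟩ := (contDiff_fderiv_unitBump.continuous_fderiv
    one_ne_zero).bounded_above_of_compact_support hc2
  have p0 := (norm_nonneg _).trans (h₀ 0)
  have p1 := (norm_nonneg _).trans (h₁ 0)
  have p2 := (norm_nonneg _).trans (h₂ 0)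
  refine ⟨S₀ + S₁ + S₂, by positivity, fun x => ⟨?_, ?_, ?_⟩⟩
  · linarith [h₀ x]
  · linarith [h₁ x]
  · linarith [h₂ x]

/-- Bounds for the derivatives of the mollifier at scale `ε`. -/
lemma exists_mollifier_bounds : ∃ S : ℝ, 0 ≤ S ∧ ∀ ε : ℝ, 0 < ε → ∀ x,
    ‖mollifier ε x‖ ≤ S / ε ^ 2 ∧ ‖fderiv ℝ (mollifier ε) x‖ ≤ S / ε ^ 3 ∧
      ‖fderiv ℝ (fderiv ℝ (mollifier ε)) x‖ ≤ S / ε ^ 4 := by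
  obtain ⟨S, hS, h⟩ := exists_unitBump_bounds
  refine ⟨S, hS, fun ε hε x => ?_⟩
  obtain ⟨h0, h1, h2⟩ := h (ε⁻¹ • x)
  have hn : ∀ n : ℕ, ‖ε⁻¹ ^ n‖ = (ε ^ n)⁻¹ := fun n => by
    rw [inv_pow, Real.norm_of_nonneg (by positivity)]
  refine ⟨?_, ?_, ?_⟩
  · rw [mollifier, norm_smul, hn, inv_mul_eq_div]
    gcongr
  · rw [fderiv_mollifier, norm_smul, hn, inv_mul_eq_div]
    gcongr
  · rw [fderiv_fderiv_mollifier]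
    refine (ContinuousLinearMap.opNorm_smul_le _ _).trans ?_
    rw [hn, inv_mul_eq_div]
    gcongr

lemma norm_potential_le {κ h : ℂ → ℂ} {S H : ℝ} (hε : 0 < ε) (hS : 0 ≤ S)
    (hκ0 : ∀ x, ε < ‖x‖ → κ x = 0) (hκ : ∀ x, ‖κ x‖ ≤ S) {z : ℂ}
    (hh : ∀ ξ ∈ Metric.closedBall z ε, ‖h ξ‖ ≤ H) :
    ‖potential κ h z‖ ≤ S * H * (Real.pi * ε ^ 2) := by
  unfold potential
  have hm : MeasurableSet (Metric.closedBall z ε) := Metric.isClosed_closedBall.measurableSet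
  have hI : Integrable ((Metric.closedBall z ε).indicator fun _ => S * H) :=
    (integrable_indicator_iff hm).mpr
      (integrableOn_const (isCompact_closedBall z ε).measure_lt_top.ne)
  refine (norm_integral_le_of_norm_le hI (Eventually.of_forall fun ξ => ?_)).trans (le_of_eq ?_)
  · by_cases hξ : ξ ∈ Metric.closedBall z ε
    · rw [indicator_of_mem hξ, norm_mul]
      exact mul_le_mul (hκ _) (hh ξ hξ) (norm_nonneg _) hS
    · rw [indicator_of_notMem hξ, hκ0 _ (by
        rw [Metric.mem_closedBall, not_le, dist_eq_norm] at hξ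
        rwa [norm_sub_rev]), zero_mul, norm_zero]
  · rw [integral_indicator_const _ hm, Measure.real,
      Complex.volume_closedBall, smul_eq_mul, ENNReal.toReal_mul, ENNReal.toReal_pow,
      ENNReal.toReal_ofReal hε.le]
    simp
    ring

/-- Mollification at scale `ε` costs a factor `ε⁻¹` for each derivative, and only sees the values
of the density within distance `ε`. -/
lemma exists_mollify_bound : ∃ C : ℝ, 0 ≤ C ∧ ∀ (ε : ℝ), 0 < ε → ∀ (h : ℂ → ℂ),
    LocallyIntegrable h → ∀ (z : ℂ) (H : ℝ), (∀ ξ ∈ Metric.closedBall z ε, ‖h ξ‖ ≤ H) →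
      ∀ j ≤ 2, ‖iteratedFDeriv ℝ j (potential (mollifier ε) h) z‖ ≤ C * H / ε ^ j := by
  obtain ⟨S, hS, hb⟩ := exists_mollifier_bounds
  refine ⟨S * Real.pi, by positivity, fun ε hε h hh z H hH j hj => ?_⟩
  have hH0 : 0 ≤ H := (norm_nonneg _).trans (hH z (Metric.mem_closedBall_self hε.le))
  have hsm := contDiff_mollifier ε
  have hcs := hasCompactSupport_mollifier hε
  have c1 : ContDiff ℝ 1 (fderiv ℝ (mollifier ε)) := hsm.fderiv_right (m := 1) (by norm_cast)
  have z0 : ∀ x : ℂ, ε < ‖x‖ → mollifier ε =ᶠ[𝓝 x] fun _ => 0 := fun x hx => by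
    filter_upwards [(isOpen_lt continuous_const continuous_norm).mem_nhds hx] with y hy
    exact mollifier_eq_zero hε (le_of_lt hy)
  have z1 : ∀ x : ℂ, ε < ‖x‖ → fderiv ℝ (mollifier ε) x = 0 := fun x hx => by
    rw [(z0 x hx).fderiv_eq]; simp
  have z2 : ∀ x : ℂ, ε < ‖x‖ → fderiv ℝ (fderiv ℝ (mollifier ε)) x = 0 := fun x hx => by
    have := (z0 x hx).fderiv (𝕜 := ℝ)
    rw [this.fderiv_eq]; simp
  have hP := contDiff_potential (n := ⊤) hcs hsm hh
  interval_cases j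
  · rw [norm_iteratedFDeriv_zero]
    refine (norm_potential_le hε (by positivity) (fun x hx => mollifier_eq_zero hε hx.le)
      (fun x => (hb ε hε x).1) hH).trans (le_of_eq ?_)
    field_simp
  · rw [norm_iteratedFDeriv_one]
    refine ContinuousLinearMap.opNorm_le_bound _ (by positivity) fun v => ?_
    rw [fderiv_potential hcs (hsm.of_le (by simp)) hh]
    refine (norm_potential_le (S := S / ε ^ 3 * ‖v‖) hε (by positivity)
      (fun x hx => by simp [z1 x hx])
      (fun x => (ContinuousLinearMap.le_opNorm _ _).trans (by gcongr; exact (hb ε hε x).2.1))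
      hH).trans (le_of_eq ?_)
    field_simp
  · rw [← norm_iteratedFDeriv_fderiv, norm_iteratedFDeriv_one]
    have hd : Differentiable ℝ (fderiv ℝ (potential (mollifier ε) h)) :=
      (hP.fderiv_right (m := 1) (by norm_cast)).differentiable one_ne_zero
    refine ContinuousLinearMap.opNorm_le_bound _ (by positivity) fun v => ?_
    refine ContinuousLinearMap.opNorm_le_bound _ (by positivity) fun w => ?_
    have e1 : fderiv ℝ (fderiv ℝ (potential (mollifier ε) h)) z v w
        = fderiv ℝ (fun y => fderiv ℝ (potential (mollifier ε) h) y w) z v := by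
      rw [fderiv_clm_apply (hd z) (differentiableAt_const w)]; simp
    have e2 : (fun y => fderiv ℝ (potential (mollifier ε) h) y w)
        = potential (fun x => fderiv ℝ (mollifier ε) x w) h :=
      funext fun y => fderiv_potential hcs (hsm.of_le (by simp)) hh y w
    have e3 : ∀ x, fderiv ℝ (fun x => fderiv ℝ (mollifier ε) x w) x v
        = fderiv ℝ (fderiv ℝ (mollifier ε)) x v w := fun x => by
      rw [fderiv_clm_apply (c1.differentiable one_ne_zero x) (differentiableAt_const w)]; simp
    have hcs1 : HasCompactSupport fun x => fderiv ℝ (mollifier ε) x w :=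
      (hcs.fderiv ℝ).comp_left (g := fun A : ℂ →L[ℝ] ℂ => A w) (by simp)
    rw [e1, e2, fderiv_potential hcs1 (c1.clm_apply contDiff_const) hh]
    simp only [e3]
    refine (norm_potential_le (S := S / ε ^ 4 * ‖v‖ * ‖w‖) hε (by positivity)
      (fun x hx => by simp [z2 x hx]) (fun x => ?_) hH).trans (le_of_eq ?_)
    · refine (ContinuousLinearMap.le_opNorm _ _).trans ?_
      gcongr
      exact (ContinuousLinearMap.le_opNorm _ _).trans (by gcongr; exact (hb ε hε x).2.2)
    · field_simp

/-- The mollifier is even with integral one, so it reproduces affine functions. -/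
lemma potential_mollifier_affine (hε : 0 < ε) (a b c z : ℂ) :
    potential (mollifier ε) (fun ξ => a + b * ξ + c * conj ξ) z = a + b * z + c * conj z := by
  have hcs := hasCompactSupport_mollifier hε
  have hcont := (contDiff_mollifier ε).continuous
  rw [potential_comm, potential]
  have i1 : Integrable (mollifier ε) := hcont.integrable_of_hasCompactSupport hcs
  have i2 : Integrable fun x => (b * x + c * conj x) * mollifier ε x :=
    Continuous.integrable_of_hasCompactSupport (by fun_prop) hcs.mul_left
  have hodd : ∫ x, (b * x + c * conj x) * mollifier ε x = 0 := by
    have h1 := integral_neg_eq_self (fun x => (b * x + c * conj x) * mollifier ε x) volume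
    have h2 : (fun x => (b * -x + c * conj (-x)) * mollifier ε (-x))
        = fun x => -((b * x + c * conj x) * mollifier ε x) := by
      ext x; rw [mollifier_neg, map_neg]; ring
    rw [h2, integral_neg] at h1
    exact self_eq_neg.mp h1.symm
  have e : ∀ x, (a + b * (z - x) + c * conj (z - x)) * mollifier ε x
      = (a + b * z + c * conj z) * mollifier ε x - (b * x + c * conj x) * mollifier ε x := by
    intro x; rw [map_sub]; ring
  simp only [e]
  rw [integral_sub (i1.const_mul _) i2, integral_const_mul, integral_mollifier hε, hodd]
  ring

lemma potential_mollifier_const (hε : 0 < ε) {h : ℂ → ℂ} {z a : ℂ}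
    (hh : ∀ ξ ∈ Metric.ball z ε, h ξ = a) : potential (mollifier ε) h z = a := by
  have h1 := potential_mollifier_affine hε a 0 0 z
  simp only [zero_mul, add_zero] at h1
  rw [← h1]
  unfold potential
  congr 1; ext ξ
  by_cases hξ : ξ ∈ Metric.ball z ε
  · rw [hh ξ hξ]
  · rw [mollifier_eq_zero hε (by
      rw [Metric.mem_ball, not_lt, dist_eq_norm] at hξ
      rwa [norm_sub_rev]), zero_mul, zero_mul]

end Mollifier

/-! ### A Whitney partition of unity by dyadic shells -/

/-- A smooth cutoff equal to `1` where `dist(z, γ) ≤ (11/8) e` and to `0` where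
`dist(z, γ) ≥ (7/4) e`: the indicator of a neighbourhood of `γ`, mollified at scale `e / 8`. -/
noncomputable def shellCutoff (γ : Set ℂ) (e : ℝ) : ℂ → ℂ :=
  potential (mollifier (e / 8)) ({w | Metric.infDist w γ ≤ 3 / 2 * e}.indicator fun _ => 1)

/-- The dyadic scale `2⁻ᵏ`. -/
noncomputable def scale (k : ℕ) : ℝ := (1 / 2) ^ k

/-- The member of the partition of unity living on the shell `dist(z, γ) ≈ 2⁻ᵏ`. The sum over all
`k` telescopes to `1` where `0 < dist(z, γ) ≤ 11/8`. -/
noncomputable def shellBump (γ : Set ℂ) (k : ℕ) (z : ℂ) : ℂ :=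
  shellCutoff γ (scale k) z - shellCutoff γ (scale (k + 1)) z

/-- The density `h`, mollified on the `k`-th shell at the scale of that shell and glued along the
first `N` members of the partition of unity. -/
noncomputable def shellSum (γ : Set ℂ) (N : ℕ) (h : ℂ → ℂ) (z : ℂ) : ℂ :=
  ∑ k ∈ Finset.range N, shellBump γ k z * potential (mollifier (scale k / 8)) h z

lemma scale_pos (k : ℕ) : 0 < scale k := by unfold scale; positivity

lemma scale_succ (k : ℕ) : scale (k + 1) = scale k / 2 := by
  unfold scale; rw [pow_succ]; ring

lemma scale_le_one (k : ℕ) : scale k ≤ 1 := pow_le_one₀ (by norm_num) (by norm_num)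

lemma scale_zero : scale 0 = 1 := by simp [scale]

lemma scale_antitone : Antitone scale := fun _ _ h =>
  pow_le_pow_of_le_one (by norm_num) (by norm_num) h

lemma exists_scale_lt {x : ℝ} (hx : 0 < x) : ∃ k, scale k < x :=
  exists_pow_lt_of_lt_one hx (by norm_num)

section Shells

variable {γ : Set ℂ}

lemma infDist_le_add (γ : Set ℂ) (z w : ℂ) :
    Metric.infDist w γ ≤ Metric.infDist z γ + ‖w - z‖ := by
  rw [← dist_eq_norm]; exact Metric.infDist_le_infDist_add_dist

lemma locallyIntegrable_indicator_infDist (e : ℝ) :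
    LocallyIntegrable ({w | Metric.infDist w γ ≤ e}.indicator fun _ => (1 : ℂ)) := by
  refine (locallyIntegrable_const (1 : ℂ)).mono
    ((measurable_const.indicator (measurableSet_le
      (Metric.continuous_infDist_pt γ).measurable measurable_const)).aestronglyMeasurable)
    (Eventually.of_forall fun w => norm_indicator_le_norm_self _ _)

lemma contDiff_shellCutoff {e : ℝ} (he : 0 < e) : ContDiff ℝ ∞ (shellCutoff γ e) :=
  contDiff_potential (n := ⊤) (hasCompactSupport_mollifier (by positivity)) (contDiff_mollifier _)
    (locallyIntegrable_indicator_infDist _)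

lemma contDiff_shellBump (k : ℕ) : ContDiff ℝ ∞ (shellBump γ k) :=
  (contDiff_shellCutoff (scale_pos k)).sub (contDiff_shellCutoff (scale_pos (k + 1)))

lemma shellCutoff_eq_one {e : ℝ} (he : 0 < e) {z : ℂ} (hz : Metric.infDist z γ ≤ 11 / 8 * e) :
    shellCutoff γ e z = 1 := by
  refine potential_mollifier_const (by positivity) fun ξ hξ => indicator_of_mem ?_ _
  rw [mem_ball_iff_norm] at hξ
  have := infDist_le_add γ z ξ
  simp only [mem_ofPred_eq]
  linarith

lemma shellCutoff_eq_zero {e : ℝ} (he : 0 < e) {z : ℂ} (hz : 7 / 4 * e ≤ Metric.infDist z γ) :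
    shellCutoff γ e z = 0 := by
  refine potential_mollifier_const (by positivity) fun ξ hξ => indicator_of_notMem ?_ _
  rw [mem_ball_iff_norm] at hξ
  have := infDist_le_add γ ξ z
  rw [norm_sub_rev] at this
  simp only [mem_ofPred_eq, not_le]
  linarith

lemma shellBump_eq_zero_of_le {k : ℕ} {z : ℂ} (hz : Metric.infDist z γ ≤ 11 / 16 * scale k) :
    shellBump γ k z = 0 := by
  have hk := scale_pos k
  rw [shellBump, shellCutoff_eq_one hk (by linarith),
    shellCutoff_eq_one (scale_pos _) (by rw [scale_succ]; linarith), sub_self]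

lemma shellBump_eq_zero_of_ge {k : ℕ} {z : ℂ} (hz : 7 / 4 * scale k ≤ Metric.infDist z γ) :
    shellBump γ k z = 0 := by
  have hk := scale_pos k
  rw [shellBump, shellCutoff_eq_zero hk hz,
    shellCutoff_eq_zero (scale_pos _) (by rw [scale_succ]; linarith), sub_self]

lemma shellBump_eventuallyEq_zero {k : ℕ} {z : ℂ}
    (hz : Metric.infDist z γ ≤ scale k / 2 ∨ 2 * scale k ≤ Metric.infDist z γ) :
    shellBump γ k =ᶠ[𝓝 z] fun _ => 0 := by
  have hk := scale_pos k
  rcases hz with hz | hz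
  · filter_upwards [(isOpen_lt (Metric.continuous_infDist_pt γ) continuous_const).mem_nhds
      (show Metric.infDist z γ < 11 / 16 * scale k by linarith)] with w hw
    exact shellBump_eq_zero_of_le (le_of_lt hw)
  · filter_upwards [(isOpen_lt continuous_const (Metric.continuous_infDist_pt γ)).mem_nhds
      (show 7 / 4 * scale k < Metric.infDist z γ by linarith)] with w hw
    exact shellBump_eq_zero_of_ge (le_of_lt hw)

lemma sum_shellBump (N : ℕ) (z : ℂ) :
    ∑ k ∈ Finset.range N, shellBump γ k z = shellCutoff γ (scale 0) z - shellCutoff γ (scale N) z :=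
  Finset.sum_range_sub' (fun k => shellCutoff γ (scale k) z) N

lemma contDiff_shellSum (N : ℕ) {h : ℂ → ℂ} (hh : LocallyIntegrable h) :
    ContDiff ℝ ∞ (shellSum γ N h) :=
  ContDiff.sum fun k _ => (contDiff_shellBump k).mul
    (contDiff_potential (n := ⊤) (hasCompactSupport_mollifier (by have := scale_pos k; positivity))
      (contDiff_mollifier _) hh)

lemma exists_shellBump_bound (γ : Set ℂ) : ∃ C : ℝ, 0 ≤ C ∧ ∀ (k : ℕ) (z : ℂ), ∀ j ≤ 2,
    ‖iteratedFDeriv ℝ j (shellBump γ k) z‖ ≤ C / scale k ^ j := by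
  obtain ⟨C, hC, hb⟩ := exists_mollify_bound
  refine ⟨2 * (256 * C), by positivity, fun k z j hj => ?_⟩
  have hk := scale_pos k
  have hcut : ∀ e : ℝ, 0 < e → scale k ≤ 2 * e →
      ‖iteratedFDeriv ℝ j (shellCutoff γ e) z‖ ≤ 256 * C / scale k ^ j := by
    intro e he hke
    refine (hb (e / 8) (by positivity) _ (locallyIntegrable_indicator_infDist _) z 1
      (fun ξ _ => (norm_indicator_le_norm_self _ _).trans (by simp)) j hj).trans ?_
    have h1 : (scale k / 16) ^ j ≤ (e / 8) ^ j :=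
      pow_le_pow_left₀ (by positivity) (by linarith) j
    have h2 : (16 : ℝ) ^ j ≤ 256 := by
      calc (16 : ℝ) ^ j ≤ 16 ^ 2 := pow_le_pow_right₀ (by norm_num) hj
        _ = 256 := by norm_num
    calc C * 1 / (e / 8) ^ j ≤ C * 1 / (scale k / 16) ^ j := by gcongr
      _ = 16 ^ j * C / scale k ^ j := by rw [div_pow]; field_simp
      _ ≤ _ := by gcongr
  have hsub : iteratedFDeriv ℝ j (shellBump γ k) z
      = iteratedFDeriv ℝ j (shellCutoff γ (scale k)) z
        - iteratedFDeriv ℝ j (shellCutoff γ (scale (k + 1))) z :=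
    iteratedFDeriv_sub_apply
      ((contDiff_shellCutoff hk).contDiffAt.of_le (by exact_mod_cast le_top))
      ((contDiff_shellCutoff (scale_pos (k + 1))).contDiffAt.of_le (by exact_mod_cast le_top))
  rw [hsub]
  refine (norm_sub_le _ _).trans ?_
  have h1 := hcut (scale k) hk (by linarith)
  have h2 := hcut (scale (k + 1)) (scale_pos _) (by rw [scale_succ]; linarith)
  calc _ ≤ 256 * C / scale k ^ j + 256 * C / scale k ^ j := add_le_add h1 h2
    _ = _ := by ring

/-- At most three shells meet a given point. -/
lemma card_shells_le (N : ℕ) {x : ℝ} (hx : 0 < x) :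
    ((Finset.range N).filter fun k => scale k / 2 < x ∧ x < 2 * scale k).card ≤ 3 := by
  have hex : ∃ k, scale k < 2 * x := exists_scale_lt (by positivity)
  classical
  set k₀ := Nat.find hex with hk₀
  have hsub : ((Finset.range N).filter fun k => scale k / 2 < x ∧ x < 2 * scale k)
      ⊆ Finset.Icc k₀ (k₀ + 2) := by
    intro k hk
    obtain ⟨-, h1, h2⟩ := Finset.mem_filter.mp hk
    rw [Finset.mem_Icc]
    refine ⟨Nat.find_min' hex (by linarith), ?_⟩
    by_contra hlt
    have h3 : scale k ≤ scale (k₀ + 2 + 1) := scale_antitone (by omega)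
    have h4 : scale k₀ < 2 * x := Nat.find_spec hex
    rw [scale_succ, scale_succ, scale_succ] at h3
    have := scale_pos k₀
    linarith
  refine (Finset.card_le_card hsub).trans ?_
  rw [Nat.card_Icc]
  omega

/-- The glued mollifications obey scale-invariant bounds in terms of the size of the density near
the point. -/
lemma exists_shellSum_bound (γ : Set ℂ) : ∃ C : ℝ, 0 ≤ C ∧ ∀ h : ℂ → ℂ, LocallyIntegrable h →
    ∀ (z : ℂ) (H : ℝ), 0 < Metric.infDist z γ →
      (∀ ξ ∈ Metric.closedBall z (Metric.infDist z γ / 4), ‖h ξ‖ ≤ H) → ∀ N : ℕ, ∀ j ≤ 2,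
        ‖iteratedFDeriv ℝ j (shellSum γ N h) z‖ ≤ C * H / Metric.infDist z γ ^ j := by
  obtain ⟨A, hA, hφ⟩ := exists_shellBump_bound γ
  obtain ⟨B, hB, hU⟩ := exists_mollify_bound
  refine ⟨3 * (4 * (4 * (A * (64 * B)))), by positivity, fun h hh z H hδ hH N j hj => ?_⟩
  set δ := Metric.infDist z γ with hδdef
  have hH0 : 0 ≤ H := (norm_nonneg _).trans (hH z (Metric.mem_closedBall_self (by positivity)))
  have hsmU : ∀ k, ContDiff ℝ ∞ (potential (mollifier (scale k / 8)) h) := fun k =>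
    contDiff_potential (n := ⊤)
      (hasCompactSupport_mollifier (by have := scale_pos k; positivity)) (contDiff_mollifier _) hh
  have hsum : iteratedFDeriv ℝ j (shellSum γ N h) z = ∑ k ∈ Finset.range N,
      iteratedFDeriv ℝ j (fun z => shellBump γ k z * potential (mollifier (scale k / 8)) h z) z
      := by
    have := iteratedFDeriv_sum (𝕜 := ℝ) (i := j) (u := Finset.range N)
      (f := fun k z => shellBump γ k z * potential (mollifier (scale k / 8)) h z)
      (fun k _ => ((contDiff_shellBump k).mul (hsmU k)).of_le (by exact_mod_cast le_top))
    have h2 := congrFun this z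
    rw [Finset.sum_apply] at h2
    exact h2
  have hterm : ∀ k, ‖iteratedFDeriv ℝ j
      (fun z => shellBump γ k z * potential (mollifier (scale k / 8)) h z) z‖
      ≤ if scale k / 2 < δ ∧ δ < 2 * scale k then 4 * (4 * (A * (64 * B))) * H / δ ^ j else 0 := by
    intro k
    have hk := scale_pos k
    split_ifs with hc
    · have hUk : ∀ i ≤ 2, ‖iteratedFDeriv ℝ i (potential (mollifier (scale k / 8)) h) z‖
          ≤ 64 * B * H / scale k ^ i := by
        intro i hi
        refine (hU (scale k / 8) (by positivity) h hh z H (fun ξ hξ => hH ξ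
          (Metric.closedBall_subset_closedBall (by linarith [hc.1]) hξ)) i hi).trans ?_
        have h2 : (8 : ℝ) ^ i ≤ 64 := by
          calc (8 : ℝ) ^ i ≤ 8 ^ 2 := pow_le_pow_right₀ (by norm_num) hi
            _ = 64 := by norm_num
        calc B * H / (scale k / 8) ^ i = 8 ^ i * (B * H) / scale k ^ i := by
              rw [div_pow]; field_simp
          _ ≤ 64 * (B * H) / scale k ^ i := by gcongr
          _ = _ := by ring
      have hmul := norm_iteratedFDeriv_mul_le (N := ∞) (contDiff_shellBump (γ := γ) k) (hsmU k) z
        (n := j) (by exact_mod_cast le_top)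
      have hpow : 1 / scale k ^ j ≤ 4 / δ ^ j := by
        have h1 : δ ^ j ≤ (2 * scale k) ^ j := by gcongr; exact hc.2.le
        have h2 : (2 : ℝ) ^ j ≤ 4 := by
          calc (2 : ℝ) ^ j ≤ 2 ^ 2 := pow_le_pow_right₀ (by norm_num) hj
            _ = 4 := by norm_num
        rw [div_le_div_iff₀ (by positivity) (by positivity), one_mul]
        calc δ ^ j ≤ 2 ^ j * scale k ^ j := by rw [← mul_pow]; exact h1
          _ ≤ 4 * scale k ^ j := by gcongr
      calc _ ≤ _ := hmul
        _ ≤ ∑ i ∈ Finset.range (j + 1), (j.choose i : ℝ) *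
            (A * (64 * B) * H / scale k ^ j) := by
            refine Finset.sum_le_sum fun i hi => ?_
            have hij : i ≤ j := Nat.lt_succ_iff.mp (Finset.mem_range.mp hi)
            rw [mul_assoc]
            gcongr
            calc _ ≤ A / scale k ^ i * (64 * B * H / scale k ^ (j - i)) :=
                  mul_le_mul (hφ k z i (hij.trans hj)) (hUk (j - i) (by omega)) (norm_nonneg _)
                    (by positivity)
              _ = _ := by
                  rw [div_mul_div_comm, ← pow_add, Nat.add_sub_cancel' hij]; ring
        _ = 2 ^ j * (A * (64 * B) * H * (1 / scale k ^ j)) := by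
            rw [← Finset.sum_mul]
            have := Nat.sum_range_choose j
            rw [← Nat.cast_sum, this]; push_cast; ring
        _ ≤ 4 * (A * (64 * B) * H * (4 / δ ^ j)) := by
            have h2 : (2 : ℝ) ^ j ≤ 4 := by
              calc (2 : ℝ) ^ j ≤ 2 ^ 2 := pow_le_pow_right₀ (by norm_num) hj
                _ = 4 := by norm_num
            gcongr
        _ = _ := by ring
    · have hz : shellBump γ k =ᶠ[𝓝 z] fun _ => 0 := shellBump_eventuallyEq_zero (by
        rw [not_and_or, not_lt, not_lt] at hc; exact hc)
      have hz' : (fun z => shellBump γ k z * potential (mollifier (scale k / 8)) h z)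
          =ᶠ[𝓝 z] fun _ => (0 : ℂ) := by
        filter_upwards [hz] with w hw
        rw [hw, zero_mul]
      have := (hz'.iteratedFDeriv ℝ j).self_of_nhds
      rw [this]
      simp
  rw [hsum]
  calc _ ≤ ∑ k ∈ Finset.range N, _ := norm_sum_le _ _
    _ ≤ ∑ k ∈ Finset.range N, if scale k / 2 < δ ∧ δ < 2 * scale k then
        4 * (4 * (A * (64 * B))) * H / δ ^ j else 0 := Finset.sum_le_sum fun k _ => hterm k
    _ = ((Finset.range N).filter fun k => scale k / 2 < δ ∧ δ < 2 * scale k).card *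
        (4 * (4 * (A * (64 * B))) * H / δ ^ j) := by
        rw [← Finset.sum_filter, Finset.sum_const, nsmul_eq_mul]
    _ ≤ 3 * (4 * (4 * (A * (64 * B))) * H / δ ^ j) := by
        gcongr
        exact_mod_cast card_shells_le N hδ
    _ = _ := by ring

end Shells

/-! ### Whitney's extension theorem for a planar jet -/

/-- The first-order Taylor polynomial of the jet at `t`. -/
noncomputable def jetPoly (f₀ f₁ f₂ : ℂ → ℂ) (t z : ℂ) : ℂ :=
  f₀ t + (z - t) * f₁ t + conj (z - t) * f₂ t

lemma jetPoly_eq_affine (f₀ f₁ f₂ : ℂ → ℂ) (t : ℂ) :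
    jetPoly f₀ f₁ f₂ t
      = fun z => (f₀ t - t * f₁ t - conj t * f₂ t) + f₁ t * z + f₂ t * conj z := by
  ext z
  rw [jetPoly, map_sub]; ring

/-- A measurable choice of almost nearest points on a closed set: the first sufficiently close
member of a dense sequence. The choice has countable range, so its composition with an arbitrary
function is measurable. -/
lemma exists_measurable_almost_nearest {γ : Set ℂ} (hcl : IsClosed γ) (hne : γ.Nonempty) :
    ∃ T : ℂ → ℂ, (∀ w, T w ∈ γ) ∧ (∀ w ∉ γ, ‖w - T w‖ ≤ 2 * Metric.infDist w γ) ∧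
      ∀ f : ℂ → ℂ, Measurable fun w => f (T w) := by
  classical
  have : Nonempty γ := hne.to_subtype
  let q : ℕ → γ := TopologicalSpace.denseSeq γ
  have hq : DenseRange q := TopologicalSpace.denseRange_denseSeq γ
  have hex : ∀ w : ℂ, ∃ n, w ∈ γ ∨ dist w (q n) < 2 * Metric.infDist w γ := by
    intro w
    by_cases hw : w ∈ γ
    · exact ⟨0, Or.inl hw⟩
    have hpos : 0 < Metric.infDist w γ := (hcl.notMem_iff_infDist_pos hne).mp hw
    obtain ⟨t, ht, hwt⟩ := (Metric.infDist_lt_iff (x := w) (r := 3 / 2 * Metric.infDist w γ) hne).mp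
      (by linarith)
    obtain ⟨n, hn⟩ := hq.exists_dist_lt ⟨t, ht⟩ (half_pos hpos)
    have h2 : dist t (q n) < Metric.infDist w γ / 2 := hn
    exact ⟨n, Or.inr (by linarith [dist_triangle w t (q n)])⟩
  have hmeas : Measurable fun w => Nat.find (hex w) := by
    refine measurable_find hex fun k => ?_
    exact hcl.measurableSet.union (measurableSet_lt
      (measurable_id.dist measurable_const)
      ((Metric.continuous_infDist_pt γ).measurable.const_mul 2))
  refine ⟨fun w => q (Nat.find (hex w)), fun w => (q _).2, fun w hw => ?_, fun f => ?_⟩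
  · rw [← dist_eq_norm]
    exact ((Nat.find_spec (hex w)).resolve_left hw).le
  · exact (measurable_from_nat (f := fun n => f (q n))).comp hmeas

section Extension

variable {ν c M : ℝ} {γ : Set ℂ} {f₀ f₁ f₂ : ℂ → ℂ}

/-- Taylor polynomials of the jet at two points of the curve, compared at a third point. -/
lemma norm_jetPoly_sub_le (hc : ∀ t ∈ γ, ∀ τ ∈ γ,
      ‖f₀ t - f₀ τ - (t - τ) * f₁ τ - conj (t - τ) * f₂ τ‖ ≤ c * ‖t - τ‖ ^ (1 + ν) ∧
      ‖f₁ t - f₁ τ‖ ≤ c * ‖t - τ‖ ^ ν ∧ ‖f₂ t - f₂ τ‖ ≤ c * ‖t - τ‖ ^ ν)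
    {t τ : ℂ} (ht : t ∈ γ) (hτ : τ ∈ γ) (w : ℂ) :
    ‖jetPoly f₀ f₁ f₂ t w - jetPoly f₀ f₁ f₂ τ w‖
      ≤ c * ‖t - τ‖ ^ (1 + ν) + 2 * (‖w - t‖ * (c * ‖t - τ‖ ^ ν)) := by
  obtain ⟨h0, h1, h2⟩ := hc t ht τ hτ
  have e : jetPoly f₀ f₁ f₂ t w - jetPoly f₀ f₁ f₂ τ w
      = (f₀ t - f₀ τ - (t - τ) * f₁ τ - conj (t - τ) * f₂ τ)
        + (w - t) * (f₁ t - f₁ τ) + conj (w - t) * (f₂ t - f₂ τ) := by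
    simp only [jetPoly, map_sub]; ring
  rw [e]
  calc _ ≤ ‖f₀ t - f₀ τ - (t - τ) * f₁ τ - conj (t - τ) * f₂ τ‖
        + ‖(w - t) * (f₁ t - f₁ τ)‖ + ‖conj (w - t) * (f₂ t - f₂ τ)‖ := norm_add₃_le
    _ ≤ c * ‖t - τ‖ ^ (1 + ν) + ‖w - t‖ * (c * ‖t - τ‖ ^ ν)
        + ‖w - t‖ * (c * ‖t - τ‖ ^ ν) := by
        rw [norm_mul, norm_mul, Complex.norm_conj]
        gcongr
    _ = _ := by ring

/-- The extension operator applied to the density `G`: the values `f₀` on `γ`, and the glued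
mollifications of `G` off `γ`. The sum is locally finite off `γ`. -/
noncomputable def whitneyExtension (γ : Set ℂ) (f₀ G : ℂ → ℂ) (z : ℂ) : ℂ :=
  open Classical in
  if z ∈ γ then f₀ z else ∑' k, shellBump γ k z * potential (mollifier (scale k / 8)) G z

lemma whitneyExtension_eventuallyEq (hcl : IsClosed γ) (f₀ G : ℂ → ℂ) {z : ℂ}
    (hz : z ∉ γ) {N : ℕ} (hN : 2 * scale N ≤ Metric.infDist z γ) :
    whitneyExtension γ f₀ G =ᶠ[𝓝 z] shellSum γ N G := by
  have hp := scale_pos N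
  filter_upwards [hcl.isOpen_compl.mem_nhds hz,
    (isOpen_lt continuous_const (Metric.continuous_infDist_pt γ)).mem_nhds
      (show 7 / 4 * scale N < Metric.infDist z γ by linarith)] with w hw hw2
  rw [whitneyExtension, if_neg hw, shellSum]
  refine tsum_eq_sum fun k hk => ?_
  have hk' : scale k ≤ scale N := scale_antitone (by simpa using hk)
  have hw2' : 7 / 4 * scale N < Metric.infDist w γ := hw2
  rw [shellBump_eq_zero_of_ge (by linarith), zero_mul]

lemma exists_shell_index {x : ℝ} (hx : 0 < x) : ∃ N, 2 * scale N ≤ x := by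
  obtain ⟨N, hN⟩ := exists_scale_lt (half_pos hx)
  exact ⟨N, by linarith⟩

lemma contDiffAt_whitneyExtension (hcl : IsClosed γ) (hne : γ.Nonempty) {G : ℂ → ℂ}
    (hG : LocallyIntegrable G) {z : ℂ} (hz : z ∉ γ) :
    ContDiffAt ℝ ∞ (whitneyExtension γ f₀ G) z := by
  obtain ⟨N, hN⟩ := exists_shell_index ((hcl.notMem_iff_infDist_pos hne).mp hz)
  exact (contDiff_shellSum N hG).contDiffAt.congr_of_eventuallyEq
    (whitneyExtension_eventuallyEq hcl f₀ G hz hN)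

lemma hasFDerivAt_affine (a b c z : ℂ) :
    HasFDerivAt (fun z : ℂ => a + b * z + c * conj z) (wirtinger b c) z := by
  have h := ((wirtinger b c).hasFDerivAt (x := z)).const_add a
  convert! h using 1
  ext w; simp; ring

/-- If `G` is within `H` of an affine function `p` near `z`, the extension is within a multiple of
`H` of `p`, with matching bounds for two derivatives. Where `dist(z, γ) ≥ 1` the partition of unity
is not complete, and only `p = 0` is allowed. -/
lemma exists_whitneyExtension_bound (hcl : IsClosed γ) (hne : γ.Nonempty) (f₀ : ℂ → ℂ) :
    ∃ C : ℝ, 0 ≤ C ∧ ∀ G : ℂ → ℂ, LocallyIntegrable G → ∀ z ∉ γ, ∀ a b c : ℂ, ∀ H : ℝ,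
      (Metric.infDist z γ < 1 ∨ (a = 0 ∧ b = 0 ∧ c = 0)) →
      (∀ ξ ∈ Metric.closedBall z (Metric.infDist z γ / 4), ‖G ξ - (a + b * ξ + c * conj ξ)‖ ≤ H) →
      ‖whitneyExtension γ f₀ G z - (a + b * z + c * conj z)‖ ≤ C * H ∧
      ‖fderiv ℝ (whitneyExtension γ f₀ G) z - wirtinger b c‖ ≤ C * H / Metric.infDist z γ ∧
      ‖fderiv ℝ (fderiv ℝ (whitneyExtension γ f₀ G)) z‖ ≤ C * H / Metric.infDist z γ ^ 2 := by
  obtain ⟨C, hC, hb⟩ := exists_shellSum_bound γ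
  refine ⟨C, hC, fun G hG z hz a b c H hcase hH => ?_⟩
  set p : ℂ → ℂ := fun z => a + b * z + c * conj z with hp
  have hδ : 0 < Metric.infDist z γ := (hcl.notMem_iff_infDist_pos hne).mp hz
  obtain ⟨N, hN⟩ := exists_shell_index hδ
  have hpc : Continuous p := by fun_prop
  have hloc : LocallyIntegrable (G - p) := hG.sub hpc.locallyIntegrable
  have hpN := scale_pos N
  -- near `z` the shell sum of `G - p` is the extension minus `p`
  have hev : (fun w => whitneyExtension γ f₀ G w - p w) =ᶠ[𝓝 z] shellSum γ N (G - p) := by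
    have hsum : ∀ᶠ w in 𝓝 z, (∑ k ∈ Finset.range N, shellBump γ k w) * p w = p w := by
      rcases hcase with h1 | ⟨rfl, rfl, rfl⟩
      · filter_upwards [(isOpen_lt (Metric.continuous_infDist_pt γ) continuous_const).mem_nhds
            (show Metric.infDist z γ < 1 from h1),
          (isOpen_lt continuous_const (Metric.continuous_infDist_pt γ)).mem_nhds
            (show 7 / 4 * scale N < Metric.infDist z γ by linarith)] with w hw1 hw2
        have hw1' : Metric.infDist w γ < 1 := hw1
        rw [sum_shellBump, shellCutoff_eq_one (scale_pos 0) (by rw [scale_zero]; linarith),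
          shellCutoff_eq_zero hpN (le_of_lt hw2), sub_zero, one_mul]
      · exact Eventually.of_forall fun w => by simp [hp]
    filter_upwards [whitneyExtension_eventuallyEq hcl f₀ G hz hN, hsum] with w h1 h2
    rw [h1, ← h2, Finset.sum_mul, shellSum, shellSum, ← Finset.sum_sub_distrib]
    refine Finset.sum_congr rfl fun k _ => ?_
    have hε : 0 < scale k / 8 := by have := scale_pos k; positivity
    have e : potential (mollifier (scale k / 8)) (G - p) w
        = potential (mollifier (scale k / 8)) G w - p w := by
      have hpp : potential (mollifier (scale k / 8)) p w = p w :=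
        potential_mollifier_affine hε a b c w
      rw [← hpp]
      unfold potential
      rw [← integral_sub
        (integrable_potential (hasCompactSupport_mollifier hε) (contDiff_mollifier _).continuous
          hG w)
        (integrable_potential (hasCompactSupport_mollifier hε) (contDiff_mollifier _).continuous
          hpc.locallyIntegrable w)]
      congr 1; ext ξ
      rw [Pi.sub_apply]; ring
    rw [e]; ring
  -- all three bounds are bounds on derivatives of this difference
  have hbd : ∀ j ≤ 2, ‖iteratedFDeriv ℝ j (fun w => whitneyExtension γ f₀ G w - p w) z‖
      ≤ C * H / Metric.infDist z γ ^ j := by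
    intro j hj
    rw [(hev.iteratedFDeriv ℝ j).self_of_nhds]
    exact hb (G - p) hloc z H hδ hH N j hj
  have hfd : fderiv ℝ (fun w => whitneyExtension γ f₀ G w - p w)
      =ᶠ[𝓝 z] fun w => fderiv ℝ (whitneyExtension γ f₀ G) w - wirtinger b c := by
    filter_upwards [hcl.isOpen_compl.mem_nhds hz] with w hw
    have hd := (contDiffAt_whitneyExtension (f₀ := f₀) hcl hne hG hw).differentiableAt (by simp)
    rw [fderiv_fun_sub hd (hasFDerivAt_affine a b c w).differentiableAt,
      (hasFDerivAt_affine a b c w).fderiv]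
  refine ⟨?_, ?_, ?_⟩
  · simpa using hbd 0 (by norm_num)
  · have := hbd 1 (by norm_num)
    rwa [norm_iteratedFDeriv_one, hfd.self_of_nhds, pow_one] at this
  · have := hbd 2 le_rfl
    rwa [← norm_iteratedFDeriv_fderiv, norm_iteratedFDeriv_one, hfd.fderiv_eq,
      fderiv_sub_const] at this

/-- A function that is smooth off a compact set `γ`, close to the Taylor polynomials of a Whitney
jet near `γ`, and with second derivatives `O(dist^(ν-1))`, is of class `C^{1,ν}` and has the jet as
its first-order jet on `γ`. -/
lemma hasFDerivAt_and_holder_of_jet (hcpt : IsCompact γ) (hne : γ.Nonempty) (hν0 : 0 < ν)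
    (hν1 : ν < 1) (hc0 : 0 < c)
    (hc : ∀ t ∈ γ, ∀ τ ∈ γ,
      ‖f₀ t - f₀ τ - (t - τ) * f₁ τ - conj (t - τ) * f₂ τ‖ ≤ c * ‖t - τ‖ ^ (1 + ν) ∧
      ‖f₁ t - f₁ τ‖ ≤ c * ‖t - τ‖ ^ ν ∧ ‖f₂ t - f₂ τ‖ ≤ c * ‖t - τ‖ ^ ν)
    {F : ℂ → ℂ} {C : ℝ} (hC : 0 ≤ C) (hF0 : ∀ t ∈ γ, F t = f₀ t)
    (hsm : ∀ z ∉ γ, ContDiffAt ℝ ∞ F z)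
    (hF : ∀ z ∉ γ, ∀ t ∈ γ, ‖z - t‖ = Metric.infDist z γ → Metric.infDist z γ < 1 →
      ‖F z - jetPoly f₀ f₁ f₂ t z‖ ≤ C * Metric.infDist z γ ^ (1 + ν))
    (hF1 : ∀ z ∉ γ, ∀ t ∈ γ, ‖z - t‖ = Metric.infDist z γ →
      ‖fderiv ℝ F z - wirtinger (f₁ t) (f₂ t)‖ ≤ C * Metric.infDist z γ ^ ν)
    (hF2 : ∀ z ∉ γ, ‖fderiv ℝ (fderiv ℝ F) z‖ ≤ C * Metric.infDist z γ ^ (ν - 1)) :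
    (∀ t ∈ γ, HasFDerivAt F (wirtinger (f₁ t) (f₂ t)) t) ∧
      ∃ K : ℝ, ∀ z w : ℂ, ‖fderiv ℝ F z - fderiv ℝ F w‖ ≤ K * ‖z - w‖ ^ ν := by
  have hcl := hcpt.isClosed
  have hnear : ∀ z : ℂ, ∃ t ∈ γ, ‖z - t‖ = Metric.infDist z γ := fun z => by
    obtain ⟨t, ht, h⟩ := hcpt.exists_infDist_eq_dist hne z
    exact ⟨t, ht, by rw [h, dist_eq_norm]⟩
  have hle : ∀ z : ℂ, ∀ t ∈ γ, Metric.infDist z γ ≤ ‖z - t‖ := fun z t ht => by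
    rw [← dist_eq_norm]; exact Metric.infDist_le_dist_of_mem ht
  have hderiv : ∀ t ∈ γ, HasFDerivAt F (wirtinger (f₁ t) (f₂ t)) t := by
    intro t ht
    rw [hasFDerivAt_iff_isLittleO]
    have hbig : (fun z => F z - F t - wirtinger (f₁ t) (f₂ t) (z - t))
        =O[𝓝 t] fun z => ‖z - t‖ ^ (1 + ν) := by
      refine Asymptotics.IsBigO.of_bound (C + 12 * c) ?_
      filter_upwards [Metric.ball_mem_nhds t one_pos] with z hz
      rw [mem_ball_iff_norm] at hz
      have e : F z - F t - wirtinger (f₁ t) (f₂ t) (z - t) = F z - jetPoly f₀ f₁ f₂ t z := by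
        rw [hF0 t ht, wirtinger_apply, jetPoly]; ring
      rw [e, Real.norm_of_nonneg (by positivity)]
      by_cases hzγ : z ∈ γ
      · have h1 := (hc z hzγ t ht).1
        rw [hF0 z hzγ, jetPoly]
        calc _ = ‖f₀ z - f₀ t - (z - t) * f₁ t - conj (z - t) * f₂ t‖ := by congr 1; ring
          _ ≤ c * ‖z - t‖ ^ (1 + ν) := h1
          _ ≤ _ := by gcongr; linarith
      · obtain ⟨τ, hτ, hzτ⟩ := hnear z
        have hδ := hle z t ht
        have h1 := hF z hzγ τ hτ hzτ (by linarith)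
        have h2 := norm_jetPoly_sub_le hc hτ ht z
        have hτt : ‖τ - t‖ ≤ 2 * ‖z - t‖ := by
          have := norm_sub_le_norm_sub_add_norm_sub τ z t
          rw [norm_sub_rev τ z, hzτ] at this
          linarith
        have h3 : ‖τ - t‖ ^ (1 + ν) ≤ 4 * ‖z - t‖ ^ (1 + ν) := by
          calc ‖τ - t‖ ^ (1 + ν) ≤ (2 * ‖z - t‖) ^ (1 + ν) := by gcongr
            _ = 2 ^ (1 + ν) * ‖z - t‖ ^ (1 + ν) := Real.mul_rpow (by norm_num) (norm_nonneg _)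
            _ ≤ 4 * ‖z - t‖ ^ (1 + ν) := by
                gcongr
                calc (2 : ℝ) ^ (1 + ν) ≤ 2 ^ (2 : ℝ) :=
                      Real.rpow_le_rpow_of_exponent_le (by norm_num) (by linarith)
                  _ = 4 := by norm_num
        have h4 : ‖z - τ‖ * (c * ‖τ - t‖ ^ ν) ≤ 4 * (c * ‖z - t‖ ^ (1 + ν)) := by
          have hzt : 0 < ‖z - t‖ := by
            rw [norm_pos_iff, sub_ne_zero]
            rintro rfl
            exact hzγ ht
          calc ‖z - τ‖ * (c * ‖τ - t‖ ^ ν) ≤ ‖z - t‖ * (c * (2 * ‖z - t‖) ^ ν) := by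
                rw [hzτ]; gcongr
            _ = 2 ^ ν * (c * ‖z - t‖ ^ (1 + ν)) := by
                rw [Real.mul_rpow (by norm_num) (norm_nonneg _), Real.rpow_add hzt, Real.rpow_one]
                ring
            _ ≤ 4 * (c * ‖z - t‖ ^ (1 + ν)) := by
                gcongr
                calc (2 : ℝ) ^ ν ≤ 2 ^ (2 : ℝ) :=
                      Real.rpow_le_rpow_of_exponent_le (by norm_num) (by linarith)
                  _ = 4 := by norm_num
        have h5 : Metric.infDist z γ ^ (1 + ν) ≤ ‖z - t‖ ^ (1 + ν) := by
          have := Metric.infDist_nonneg (x := z) (s := γ)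
          gcongr
        calc _ ≤ ‖F z - jetPoly f₀ f₁ f₂ τ z‖
              + ‖jetPoly f₀ f₁ f₂ τ z - jetPoly f₀ f₁ f₂ t z‖ :=
              norm_sub_le_norm_sub_add_norm_sub _ _ _
          _ ≤ C * ‖z - t‖ ^ (1 + ν)
              + (c * (4 * ‖z - t‖ ^ (1 + ν)) + 2 * (4 * (c * ‖z - t‖ ^ (1 + ν)))) := by
              refine add_le_add (h1.trans (by gcongr)) (h2.trans ?_)
              gcongr
          _ = _ := by ring
    refine hbig.trans_isLittleO ?_
    rw [← Asymptotics.isLittleO_norm_right, Asymptotics.isLittleO_iff_tendsto (by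
      intro z hz
      rw [hz, Real.zero_rpow (by linarith)])]
    have e : (fun z : ℂ => ‖z - t‖ ^ (1 + ν) / ‖z - t‖) = fun z : ℂ => ‖z - t‖ ^ ν := by
      ext z
      rcases eq_or_ne (z - t) 0 with hz | hz
      · simp [hz, Real.zero_rpow hν0.ne']
      · rw [add_comm, Real.rpow_add_one (norm_ne_zero_iff.mpr hz)]
        field_simp [norm_ne_zero_iff.mpr hz]
    rw [e]
    have hcont : Continuous fun z : ℂ => ‖z - t‖ ^ ν :=
      ((continuous_id.sub continuous_const).norm).rpow_const fun _ => Or.inr hν0.le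
    simpa [Real.zero_rpow hν0.ne'] using hcont.tendsto t
  refine ⟨hderiv, 4 * C + 10 * c, ?_⟩
  have happrox : ∀ z : ℂ, ∃ t ∈ γ, ‖z - t‖ = Metric.infDist z γ ∧
      ‖fderiv ℝ F z - wirtinger (f₁ t) (f₂ t)‖ ≤ C * Metric.infDist z γ ^ ν := by
    intro z
    obtain ⟨t, ht, hzt⟩ := hnear z
    refine ⟨t, ht, hzt, ?_⟩
    by_cases hz : z ∈ γ
    · have h0 : Metric.infDist z γ = 0 := Metric.infDist_zero_of_mem hz
      rw [h0, norm_eq_zero, sub_eq_zero] at hzt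
      subst hzt
      rw [(hderiv z hz).fderiv, sub_self, norm_zero]
      exact mul_nonneg hC (Real.rpow_nonneg Metric.infDist_nonneg _)
    · exact hF1 z hz t ht hzt
  intro z w
  wlog hzw : Metric.infDist w γ ≤ Metric.infDist z γ generalizing z w
  · rw [norm_sub_rev, norm_sub_rev z w]
    exact this w z (by linarith)
  set D := ‖z - w‖ with hD
  have hD0 : 0 ≤ D := norm_nonneg _
  have hDν : 0 ≤ D ^ ν := by positivity
  rcases le_or_gt (Metric.infDist z γ) (2 * D) with hcase | hcase
  · -- both points are at distance at most `2 D` from `γ`: compare through the jet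
    obtain ⟨t, ht, hzt, h1⟩ := happrox z
    obtain ⟨τ, hτ, hwτ, h2⟩ := happrox w
    have htτ : ‖t - τ‖ ≤ 5 * D := by
      have e : t - τ = (t - z) + (z - w) + (w - τ) := by ring
      have h3 : ‖t - τ‖ ≤ ‖t - z‖ + ‖z - w‖ + ‖w - τ‖ := by rw [e]; exact norm_add₃_le
      rw [norm_sub_rev t z, hzt, hwτ] at h3
      linarith
    have hpow : ∀ (n : ℝ), 1 ≤ n → (n * D) ^ ν ≤ n * D ^ ν := fun n hn => by
      rw [Real.mul_rpow (by linarith) hD0]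
      gcongr
      calc n ^ ν ≤ n ^ (1 : ℝ) := Real.rpow_le_rpow_of_exponent_le hn hν1.le
        _ = n := Real.rpow_one n
    have h3 : ‖wirtinger (f₁ t) (f₂ t) - wirtinger (f₁ τ) (f₂ τ)‖ ≤ 2 * (c * (5 * D ^ ν)) := by
      rw [wirtinger_sub]
      obtain ⟨-, g1, g2⟩ := hc t ht τ hτ
      have h5 : ‖t - τ‖ ^ ν ≤ 5 * D ^ ν :=
        (Real.rpow_le_rpow (norm_nonneg _) htτ hν0.le).trans (hpow 5 (by norm_num))
      calc _ ≤ ‖f₁ t - f₁ τ‖ + ‖f₂ t - f₂ τ‖ := norm_wirtinger_le _ _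
        _ ≤ c * ‖t - τ‖ ^ ν + c * ‖t - τ‖ ^ ν := add_le_add g1 g2
        _ = 2 * (c * ‖t - τ‖ ^ ν) := by ring
        _ ≤ _ := by gcongr
    have h4 : ∀ x : ℂ, Metric.infDist x γ ≤ 2 * D → Metric.infDist x γ ^ ν ≤ 2 * D ^ ν :=
      fun x hx => (Real.rpow_le_rpow Metric.infDist_nonneg hx hν0.le).trans (hpow 2 (by norm_num))
    have e : fderiv ℝ F z - fderiv ℝ F w
        = (fderiv ℝ F z - wirtinger (f₁ t) (f₂ t))
          + (wirtinger (f₁ t) (f₂ t) - wirtinger (f₁ τ) (f₂ τ))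
          - (fderiv ℝ F w - wirtinger (f₁ τ) (f₂ τ)) := by abel
    rw [e]
    calc _ ≤ ‖fderiv ℝ F z - wirtinger (f₁ t) (f₂ t)‖
          + ‖wirtinger (f₁ t) (f₂ t) - wirtinger (f₁ τ) (f₂ τ)‖
          + ‖fderiv ℝ F w - wirtinger (f₁ τ) (f₂ τ)‖ :=
          (norm_sub_le _ _).trans (add_le_add_left (norm_add_le _ _) _)
      _ ≤ C * (2 * D ^ ν) + 2 * (c * (5 * D ^ ν)) + C * (2 * D ^ ν) := by
          refine add_le_add (add_le_add (h1.trans ?_) h3) (h2.trans ?_)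
          · gcongr; exact h4 z hcase
          · gcongr; exact h4 w (hzw.trans hcase)
      _ = _ := by ring
  · -- the segment stays away from `γ`: integrate the second derivative
    rcases hD0.eq_or_lt with hD' | hD'
    · have : z = w := by rw [← sub_eq_zero, ← norm_eq_zero]; exact hD'.symm
      rw [this, sub_self, norm_zero]
      positivity
    have hseg : ∀ y ∈ segment ℝ w z, D ≤ Metric.infDist y γ := by
      intro y hy
      rw [segment_symm] at hy
      have h1 := norm_sub_le_of_mem_segment hy
      rw [norm_sub_rev w z] at h1
      have h2 := infDist_le_add γ y z
      rw [norm_sub_rev] at h2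
      linarith
    have hnot : ∀ y ∈ segment ℝ w z, y ∉ γ := fun y hy => by
      rw [hcl.notMem_iff_infDist_pos hne]; linarith [hseg y hy]
    have key := (convex_segment w z).norm_image_sub_le_of_norm_fderiv_le (𝕜 := ℝ)
      (f := fderiv ℝ F) (C := C * D ^ (ν - 1))
      (fun y hy => (((hsm y (hnot y hy)).fderiv_right (m := 1) (by norm_cast)).differentiableAt
        one_ne_zero))
      (fun y hy => (hF2 y (hnot y hy)).trans (mul_le_mul_of_nonneg_left
        (Real.rpow_le_rpow_of_nonpos hD' (hseg y hy) (by linarith)) hC))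
      (left_mem_segment ℝ w z) (right_mem_segment ℝ w z)
    refine key.trans ?_
    rw [← hD, mul_assoc, ← Real.rpow_add_one hD'.ne', sub_add_cancel]
    gcongr
    linarith

/-- Whitney's extension theorem for jets in `Lip(1 + ν, γ)`, with second derivatives controlled by
the distance to `γ`. -/
lemma exists_isWhitneyExtension (hcpt : IsCompact γ) (hne : γ.Nonempty) (hν0 : 0 < ν)
    (hν1 : ν < 1) (hf : IsLipJet ν γ f₀ f₁ f₂) : ∃ F, IsWhitneyExtension ν γ f₀ f₁ f₂ F := by
  have hcl := hcpt.isClosed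
  obtain ⟨M, hM⟩ := hf.bounded
  obtain ⟨c, hc0, hc⟩ := hf.lipschitz
  obtain ⟨T, hTγ, hTd, hTm⟩ := exists_measurable_almost_nearest hcl hne
  have hM0 : 0 ≤ M := (norm_nonneg _).trans (hM _ hne.choose_spec).1
  set G : ℂ → ℂ := fun w => jetPoly f₀ f₁ f₂ (T w) w with hG
  have hpoly : ∀ t ∈ γ, ∀ w, ‖jetPoly f₀ f₁ f₂ t w‖ ≤ M + 2 * (‖w - t‖ * M) := by
    intro t ht w
    obtain ⟨h0, h1, h2⟩ := hM t ht
    calc _ ≤ ‖f₀ t‖ + ‖(w - t) * f₁ t‖ + ‖conj (w - t) * f₂ t‖ := norm_add₃_le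
      _ ≤ M + ‖w - t‖ * M + ‖w - t‖ * M := by
          rw [norm_mul, norm_mul, Complex.norm_conj]; gcongr
      _ = _ := by ring
  have hGloc : LocallyIntegrable G := by
    obtain ⟨R, hR⟩ := hcpt.isBounded.subset_closedBall 0
    have hm : Measurable G := by
      have h1 := hTm f₀
      have h2 := hTm f₁
      have h3 := hTm f₂
      have h4 : Measurable fun w => w - T w := measurable_id.sub (hTm id)
      exact (h1.add (h4.mul h2)).add ((measurable_conj.comp h4).mul h3)
    have hcont : Continuous fun w : ℂ => M + 2 * ((‖w‖ + R) * M) := by fun_prop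
    refine hcont.locallyIntegrable.mono hm.aestronglyMeasurable
      (Eventually.of_forall fun w => ?_)
    have h1 : ‖T w‖ ≤ R := by simpa using hR (hTγ w)
    refine ((hpoly _ (hTγ w) w).trans ?_).trans (le_abs_self _)
    gcongr
    exact (norm_sub_le _ _).trans (by gcongr)
  obtain ⟨C, hC, hb⟩ := exists_whitneyExtension_bound hcl hne f₀
  set F := whitneyExtension γ f₀ G with hFdef
  have hδpos : ∀ z ∉ γ, 0 < Metric.infDist z γ := fun z hz =>
    (hcl.notMem_iff_infDist_pos hne).mp hz
  have hsm : ∀ z ∉ γ, ContDiffAt ℝ ∞ F z := fun z hz => contDiffAt_whitneyExtension hcl hne hGloc hz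
  -- geometry of the points seen by the mollification near `z`
  have hTξ : ∀ z ∉ γ, ∀ ξ ∈ Metric.closedBall z (Metric.infDist z γ / 4),
      ‖ξ - T ξ‖ ≤ 5 / 2 * Metric.infDist z γ := by
    intro z hz ξ hξ
    have hδ := hδpos z hz
    rw [mem_closedBall_iff_norm] at hξ
    have h1 := infDist_le_add γ z ξ
    have h2 := infDist_le_add γ ξ z
    rw [norm_sub_rev] at h2
    have hξγ : ξ ∉ γ := by
      rw [hcl.notMem_iff_infDist_pos hne]; linarith
    linarith [hTd ξ hξγ]
  have hnearG : ∀ z ∉ γ, ∀ t ∈ γ, ‖z - t‖ = Metric.infDist z γ →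
      ∀ ξ ∈ Metric.closedBall z (Metric.infDist z γ / 4),
        ‖G ξ - jetPoly f₀ f₁ f₂ t ξ‖ ≤ 36 * c * Metric.infDist z γ ^ (1 + ν) := by
    intro z hz t ht hzt ξ hξ
    have hδ := hδpos z hz
    have h1 := hTξ z hz ξ hξ
    rw [mem_closedBall_iff_norm] at hξ
    set δ := Metric.infDist z γ with hδdef
    have h2 : ‖T ξ - t‖ ≤ 4 * δ := by
      have e : T ξ - t = (T ξ - ξ) + (ξ - z) + (z - t) := by ring
      have h3 : ‖T ξ - t‖ ≤ ‖T ξ - ξ‖ + ‖ξ - z‖ + ‖z - t‖ := by rw [e]; exact norm_add₃_le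
      rw [norm_sub_rev (T ξ) ξ, hzt] at h3
      linarith
    have hpν : ‖T ξ - t‖ ^ ν ≤ 4 * δ ^ ν := by
      calc ‖T ξ - t‖ ^ ν ≤ (4 * δ) ^ ν := by gcongr
        _ = 4 ^ ν * δ ^ ν := Real.mul_rpow (by norm_num) hδ.le
        _ ≤ 4 * δ ^ ν := by
            gcongr
            calc (4 : ℝ) ^ ν ≤ 4 ^ (1 : ℝ) :=
                  Real.rpow_le_rpow_of_exponent_le (by norm_num) hν1.le
              _ = 4 := by norm_num
    have hpν1 : ‖T ξ - t‖ ^ (1 + ν) ≤ 16 * δ ^ (1 + ν) := by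
      calc ‖T ξ - t‖ ^ (1 + ν) ≤ (4 * δ) ^ (1 + ν) := by gcongr
        _ = 4 ^ (1 + ν) * δ ^ (1 + ν) := Real.mul_rpow (by norm_num) hδ.le
        _ ≤ 16 * δ ^ (1 + ν) := by
            gcongr
            calc (4 : ℝ) ^ (1 + ν) ≤ 4 ^ (2 : ℝ) :=
                  Real.rpow_le_rpow_of_exponent_le (by norm_num) (by linarith)
              _ = 16 := by norm_num
    have hδν : δ * δ ^ ν = δ ^ (1 + ν) := by rw [Real.rpow_add hδ, Real.rpow_one]
    calc _ ≤ c * ‖T ξ - t‖ ^ (1 + ν) + 2 * (‖ξ - T ξ‖ * (c * ‖T ξ - t‖ ^ ν)) :=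
          norm_jetPoly_sub_le hc (hTγ ξ) ht ξ
      _ ≤ c * (16 * δ ^ (1 + ν)) + 2 * (5 / 2 * δ * (c * (4 * δ ^ ν))) := by gcongr
      _ = 16 * c * δ ^ (1 + ν) + 20 * c * (δ * δ ^ ν) := by ring
      _ = _ := by rw [hδν]; ring
  have hclose : ∀ z ∉ γ, ∀ t ∈ γ, ‖z - t‖ = Metric.infDist z γ → Metric.infDist z γ < 1 →
      ‖F z - jetPoly f₀ f₁ f₂ t z‖ ≤ C * (36 * c * Metric.infDist z γ ^ (1 + ν)) ∧
      ‖fderiv ℝ F z - wirtinger (f₁ t) (f₂ t)‖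
        ≤ C * (36 * c * Metric.infDist z γ ^ (1 + ν)) / Metric.infDist z γ ∧
      ‖fderiv ℝ (fderiv ℝ F) z‖
        ≤ C * (36 * c * Metric.infDist z γ ^ (1 + ν)) / Metric.infDist z γ ^ 2 := by
    intro z hz t ht hzt h1
    have h := hnearG z hz t ht hzt
    rw [jetPoly_eq_affine] at h ⊢
    exact hb G hGloc z hz _ _ _ _ (Or.inl h1) h
  -- where the partition of unity is not complete, boundedness of the jet suffices
  have hfar : ∀ z ∉ γ, 1 ≤ Metric.infDist z γ →
      ‖fderiv ℝ F z‖ ≤ C * (6 * M * Metric.infDist z γ) / Metric.infDist z γ ∧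
      ‖fderiv ℝ (fderiv ℝ F) z‖
        ≤ C * (6 * M * Metric.infDist z γ) / Metric.infDist z γ ^ 2 := by
    intro z hz h1
    have h := hb G hGloc z hz 0 0 0 (6 * M * Metric.infDist z γ) (Or.inr ⟨rfl, rfl, rfl⟩)
      (fun ξ hξ => by
        have h2 := hTξ z hz ξ hξ
        simp only [zero_mul, add_zero, sub_zero]
        calc ‖G ξ‖ ≤ M + 2 * (‖ξ - T ξ‖ * M) := hpoly _ (hTγ ξ) ξ
          _ ≤ M * Metric.infDist z γ + 2 * (5 / 2 * Metric.infDist z γ * M) := by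
              gcongr
              exact le_mul_of_one_le_right hM0 h1
          _ = _ := by ring)
    have hw : wirtinger 0 0 = 0 := by ext v; simp
    obtain ⟨-, h3, h4⟩ := h
    rw [hw, sub_zero] at h3
    exact ⟨h3, h4⟩
  -- the first summand serves `dist(z, γ) < 1`, the others `dist(z, γ) ≥ 1`
  set K := 36 * C * c + 6 * C * M + 2 * M with hK
  have hK0 : 0 ≤ K := by positivity
  have hF0 : ∀ t ∈ γ, F t = f₀ t := fun t ht => by
    rw [hFdef, whitneyExtension, if_pos ht]
  have hFK : ∀ z ∉ γ, ∀ t ∈ γ, ‖z - t‖ = Metric.infDist z γ → Metric.infDist z γ < 1 →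
      ‖F z - jetPoly f₀ f₁ f₂ t z‖ ≤ K * Metric.infDist z γ ^ (1 + ν) := by
    intro z hz t ht hzt h1
    refine (hclose z hz t ht hzt h1).1.trans ?_
    have := hδpos z hz
    rw [← mul_assoc]
    gcongr
    rw [hK]
    have : 0 ≤ 6 * C * M + 2 * M := by positivity
    linarith
  have hFK1 : ∀ z ∉ γ, ∀ t ∈ γ, ‖z - t‖ = Metric.infDist z γ →
      ‖fderiv ℝ F z - wirtinger (f₁ t) (f₂ t)‖ ≤ K * Metric.infDist z γ ^ ν := by
    intro z hz t ht hzt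
    have hδ := hδpos z hz
    rcases lt_or_ge (Metric.infDist z γ) 1 with h1 | h1
    · refine (hclose z hz t ht hzt h1).2.1.trans ?_
      rw [Real.rpow_add hδ, Real.rpow_one]
      have e : C * (36 * c * (Metric.infDist z γ * Metric.infDist z γ ^ ν)) / Metric.infDist z γ
          = 36 * C * c * Metric.infDist z γ ^ ν := by field_simp
      rw [e]
      gcongr
      rw [hK]
      have : 0 ≤ 6 * C * M + 2 * M := by positivity
      linarith
    · have h2 := (hfar z hz h1).1
      have e : C * (6 * M * Metric.infDist z γ) / Metric.infDist z γ = 6 * C * M := by field_simp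
      rw [e] at h2
      obtain ⟨-, g1, g2⟩ := hM t ht
      have h3 : ‖wirtinger (f₁ t) (f₂ t)‖ ≤ 2 * M := (norm_wirtinger_le _ _).trans (by linarith)
      have h4 : 1 ≤ Metric.infDist z γ ^ ν := Real.one_le_rpow h1 hν0.le
      calc _ ≤ 6 * C * M + 2 * M := (norm_sub_le _ _).trans (add_le_add h2 h3)
        _ ≤ K := by
            rw [hK]
            have : 0 ≤ 36 * C * c := by positivity
            linarith
        _ ≤ _ := le_mul_of_one_le_right hK0 h4
  have hFK2 : ∀ z ∉ γ, ‖fderiv ℝ (fderiv ℝ F) z‖ ≤ K * Metric.infDist z γ ^ (ν - 1) := by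
    intro z hz
    have hδ := hδpos z hz
    rcases lt_or_ge (Metric.infDist z γ) 1 with h1 | h1
    · obtain ⟨t, ht, hzt⟩ := hcpt.exists_infDist_eq_dist hne z
      rw [dist_eq_norm] at hzt
      refine (hclose z hz t ht hzt.symm h1).2.2.trans ?_
      have e : C * (36 * c * Metric.infDist z γ ^ (1 + ν)) / Metric.infDist z γ ^ 2
          = 36 * C * c * Metric.infDist z γ ^ (ν - 1) := by
        have : Metric.infDist z γ ^ (1 + ν)
            = Metric.infDist z γ ^ (ν - 1) * Metric.infDist z γ ^ 2 := by
          rw [← Real.rpow_natCast (Metric.infDist z γ) 2, ← Real.rpow_add hδ]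
          congr 1; push_cast; ring
        rw [this]; field_simp
      rw [e]
      gcongr
      rw [hK]
      have : 0 ≤ 6 * C * M + 2 * M := by positivity
      linarith
    · refine (hfar z hz h1).2.trans ?_
      have e : C * (6 * M * Metric.infDist z γ) / Metric.infDist z γ ^ 2
          = 6 * C * M * Metric.infDist z γ ^ (-1 : ℝ) := by
        rw [Real.rpow_neg_one]; field_simp
      rw [e]
      gcongr
      · rw [hK]
        have : 0 ≤ 36 * C * c + 2 * M := by positivity
        linarith
      · linarith
  obtain ⟨hderiv, L, hL⟩ := hasFDerivAt_and_holder_of_jet hcpt hne hν0 hν1 hc0 hc hK0 hF0 hsm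
    hFK hFK1 hFK2
  have hdiff : Differentiable ℝ F := fun z => by
    by_cases hz : z ∈ γ
    · exact (hderiv z hz).differentiableAt
    · exact (hsm z hz).differentiableAt (by simp)
  have hfc : Continuous (fderiv ℝ F) := by
    rw [continuous_iff_continuousAt]
    intro z
    rw [ContinuousAt, tendsto_iff_norm_sub_tendsto_zero]
    refine squeeze_zero (fun _ => norm_nonneg _) (fun w => hL w z) ?_
    have hcont : Continuous fun w : ℂ => L * ‖w - z‖ ^ ν :=
      continuous_const.mul (((continuous_id.sub continuous_const).norm).rpow_const
        fun _ => Or.inr hν0.le)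
    simpa [Real.zero_rpow hν0.ne'] using hcont.tendsto z
  refine ⟨F, ?_, ?_, ⟨L, hL⟩, hF0, ?_, ?_, fun z hz => (hsm z hz).contDiffWithinAt, K, ?_⟩
  · refine HasCompactSupport.intro' (K := Metric.cthickening 2 γ) hcpt.cthickening
      Metric.isClosed_cthickening fun z hz => ?_
    have h2 : 2 < Metric.infDist z γ := by
      by_contra hle
      exact hz (Metric.mem_cthickening_of_dist_le z _ 2 γ
        (hcpt.exists_infDist_eq_dist hne z).choose_spec.1 (by
          rw [← (hcpt.exists_infDist_eq_dist hne z).choose_spec.2]; linarith))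
    have hzγ : z ∉ γ := by rw [hcl.notMem_iff_infDist_pos hne]; linarith
    rw [hFdef, whitneyExtension, if_neg hzγ]
    refine (tsum_congr fun k => ?_).trans tsum_zero
    have := scale_le_one k
    rw [shellBump_eq_zero_of_ge (by linarith), zero_mul]
  · rw [contDiff_one_iff_fderiv]
    exact ⟨hdiff, hfc⟩
  · intro t ht
    exact dz_eq_of_hasFDerivAt (hderiv t ht)
  · intro t ht
    exact dzbar_eq_of_hasFDerivAt (hderiv t ht)
  · intro j₁ j₂ hj z hz
    have hd : DifferentiableAt ℝ (fderiv ℝ F) z :=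
      ((hsm z hz).fderiv_right (m := 1) (by norm_cast)).differentiableAt one_ne_zero
    have f1 : fderiv ℝ (dz F) z = dzL.comp (fderiv ℝ (fderiv ℝ F) z) := by
      rw [funext (dz_eq F)]; exact (dzL.hasFDerivAt.comp z hd.hasFDerivAt).fderiv
    have f2 : fderiv ℝ (dzbar F) z = dzbarL.comp (fderiv ℝ (fderiv ℝ F) z) := by
      rw [funext (dzbar_eq F)]; exact (dzbarL.hasFDerivAt.comp z hd.hasFDerivAt).fderiv
    have n1 : ‖fderiv ℝ (dz F) z‖ ≤ ‖fderiv ℝ (fderiv ℝ F) z‖ := by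
      rw [f1]
      refine ContinuousLinearMap.opNorm_le_bound _ (ContinuousLinearMap.opNorm_nonneg _) fun v => ?_
      exact (norm_dzL_le _).trans (ContinuousLinearMap.le_opNorm _ _)
    have n2 : ‖fderiv ℝ (dzbar F) z‖ ≤ ‖fderiv ℝ (fderiv ℝ F) z‖ := by
      rw [f2]
      refine ContinuousLinearMap.opNorm_le_bound _ (ContinuousLinearMap.opNorm_nonneg _) fun v => ?_
      exact (norm_dzbarL_le _).trans (ContinuousLinearMap.le_opNorm _ _)
    refine le_trans ?_ (hFK2 z hz)
    have hcases : (j₁ = 2 ∧ j₂ = 0) ∨ (j₁ = 1 ∧ j₂ = 1) ∨ (j₁ = 0 ∧ j₂ = 2) := by omega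
    rcases hcases with ⟨rfl, rfl⟩ | ⟨rfl, rfl⟩ | ⟨rfl, rfl⟩
    · change ‖dz (dz F) z‖ ≤ _
      rw [dz_eq]; exact (norm_dzL_le _).trans n1
    · change ‖dz (dzbar F) z‖ ≤ _
      rw [dz_eq]; exact (norm_dzL_le _).trans n2
    · change ‖dzbar (dzbar F) z‖ ≤ _
      rw [dzbar_eq]; exact (norm_dzbarL_le _).trans n2

end Extension

end LameNavier

theorem mainTheorem6 (lam mu : ℝ) (hmu : 0 < mu) (hlam : -(2 * mu / 3) < lam)
    (d ν : ℝ) (hd1 : 1 < d) (hd2 : d < 2) (hν0 : 0 < ν) (hν1 : ν < 1) (hνd : d / 2 < ν)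
    (Ω γ : Set ℂ) (hΩ : LameNavier.IsJordanDomain Ω γ) (hγ : LameNavier.IsSummable d γ)
    (f₀ f₁ f₂ : ℂ → ℂ) (hf : LameNavier.IsLipJet ν γ f₀ f₁ f₂) :
    (∃ ft : ℂ → ℂ, LameNavier.IsWhitneyExtension ν γ f₀ f₁ f₂ ft) ∧
    ∀ ft : ℂ → ℂ, LameNavier.IsWhitneyExtension ν γ f₀ f₁ f₂ ft →
      (∀ z : ℂ, IntegrableOn
        (LameNavier.teodorescuIntegrand lam mu (LameNavier.lameOp lam mu ft) z) Ω volume) ∧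
      LameNavier.SolvesJumpProblem lam mu Ω γ f₀ f₁
        (fun z => Ω.indicator ft z
          - LameNavier.teodorescu lam mu Ω (LameNavier.lameOp lam mu ft) z) := by
  have hγc := hΩ.isJordanCurve.isCompact
  refine ⟨LameNavier.exists_isWhitneyExtension hγc hΩ.isJordanCurve.nonempty hν0 hν1 hf,
    fun ft hft => ?_⟩
  obtain ⟨s, M, hs0, hs1, hg⟩ := hft.exists_isRieszDensity hd2 hν1 hνd hΩ hγ lam mu
  exact hft.solvesJumpProblem (LameNavier.alpha_sq_sub_beta_sq_ne_zero hmu hlam) hΩ hs0 hs1 hg
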